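/- Let $n\ge 2$, and let $T=|P|^r$ on $\mathbb{R}^n$, where $1\le r<\infty$ and $P:\mathbb{R}^n\to\mathbb{R}$ is measurable and locally bounded. Let $S=\{p: T(p)=0\}$ have finitely many connected components. Assume there are a compact set $\Omega\supset S$ and $\sigma>0$ such that every point of $S$ has distance at least $\sigma$ from the complement of $\Omega$, that $P\in C^2(\Omega)$ (it suffices that $P$ is continuous on $\Omega$ and $C^2$ in its interior) with $\nabla P\neq 0$ in the interior of $\Omega$, and that $T(p)\ge C_1|p|^s+C_2$ for $p\notin\Omega$, with constants $C_1,C_2,s>0$. Fix $\varepsilon>0$ (relevant only if $n=s$). For $e>0$ let $$f(e)=\begin{cases}\dfrac{2\pi}{r\sin(\pi/r)}\,e^{-(r-1)/r}, & r>1,\\ 2\ln(1+1/e), & r=1,\end{cases}\qquad g(e)=\begin{cases}1,&1\le r<2,\\ 1+\ln(1+1/e),& r=2,\\ 1+e^{2-r},&r>2,\end{cases}$$ and let $\mathcal A(V)=\|V\|_{n/s}$ if $n>s$, $\mathcal A(V)=\|V\|_{1+\varepsilon}$ if $n=s$, $\mathcal A(V)=\|V\|_1$ if $n<s$. With $dp$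 the surface measure on $S$, let $$(F_S\varphi)(p)=\frac{1}{(2\pi)^{n/2}\sqrt{|\nabla P(p)|}}\int_{\mathbb{R}^n}e^{-ix\cdot p}\varphi(x)\,dx\quad(p\in S),\qquad (F_S^*u)(x)=\frac1{(2\pi)^{n/2}}\int_S\frac{e^{ix\cdot p}}{\sqrt{|\nabla P(p)|}}u(p)\,dp .$$ Let $(T+e)^{-1}$ be the operator on $L^2(\mathbb{R}^n)$ that multiplies the Fourier transform $\hat\varphi(p)=(2\pi)^{-n/2}\int e^{-ix\cdot p}\varphi(x)\,dx$ by $(T(p)+e)^{-1}$. For real-valued $V\in L^1(\mathbb{R}^n)$ with $\mathcal A(V)<\infty$ put $V^{1/2}=\operatorname{sgn}(V)|V|^{1/2}$ and $$M_e=V^{1/2}\Big(\frac1{T+e}-f(e)F_S^*F_S\Big)|V|^{1/2}.$$ Then $M_e$, defined on the $\psi\in L^2(\mathbb{R}^n)$ with $|V|^{1/2}\psi\in L^2(\mathbb{R}^n)$, extends uniquely to a bounded operator on $L^2(\mathbb{R}^n)$. Let $\kappa=2$; if $T$ is radial, one may also take $\kappa=0$ when $n\ge3$ and $\kappa=1$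 when $n=2$. Then there is a constant $C$, independent of $V$ and $e$, such that for all such $V$ with $\iint|V(x)||x-y|^\kappa|V(y)|\,dx\,dy<\infty$ and all $e>0$, $$\|M_e\|\le C\left(g(e)\left[\|V\|_1+\Big(\iint|V(x)||x-y|^\kappa|V(y)|\,dx\,dy\Big)^{1/2}\right]+\mathcal A(V)\right).$$ In particular, if $r<2$, then for every such $V$ the operators $M_e$ are bounded uniformly in $e>0$. -/

import Mathlib

open MeasureTheory FourierTransform
open scoped ENNReal RealInnerProductSpace

noncomputable section

/-- Euclidean space `ℝⁿ`. -/
abbrev Rn (n : ℕ) : Type := EuclideanSpace ℝ (Fin n)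

/-- The complex Hilbert space `L²(ℝⁿ)`. -/
abbrev L2 (n : ℕ) : Type := Lp (α := Rn n) ℂ 2 (volume : Measure (Rn n))

/-- The assumptions on the kinetic energy `T = |P|^r`: `P` is a locally bounded measurable
function and `1 ≤ r < ∞`. The zero set `S` of `T` (which is the zero set of `P`) has finitely many
connected components, and its `σ`-neighbourhood lies in the compact set `Ω`. The function `P` is
`C²` on `Ω` with non-vanishing gradient, where only the following consequences are kept:
`P` is continuous on `Ω`, and it is `C²` with non-vanishing gradient in the interior of `Ω` (the
interior contains `S`). Outside `Ω` one has `T(p) ≥ C₁ |p|^s + C₂`. -/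
structure KineticSymbol (n : ℕ) where
  P : Rn n → ℝ
  r : ℝ
  Ω : Set (Rn n)
  σ : ℝ
  C₁ : ℝ
  C₂ : ℝ
  s : ℝ
  one_le_r : 1 ≤ r
  measurable_P : Measurable P
  locallyBounded_P : ∀ B : Set (Rn n), IsCompact B → Bornology.IsBounded (P '' B)
  isCompact_Ω : IsCompact Ω
  finite_components : Finite (ConnectedComponents {p : Rn n | |P p| ^ r = 0})
  σ_pos : 0 < σ
  ball_subset_Ω : ∀ p : Rn n, |P p| ^ r = 0 → Metric.ball p σ ⊆ Ω
  continuousOn_P : ContinuousOn P Ω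
  contDiffOn_P : ContDiffOn ℝ 2 P (interior Ω)
  gradient_ne_zero : ∀ p ∈ interior Ω, gradient P p ≠ 0
  C₁_pos : 0 < C₁
  C₂_pos : 0 < C₂
  s_pos : 0 < s
  lower_bound : ∀ p : Rn n, p ∉ Ω → C₁ * ‖p‖ ^ s + C₂ ≤ |P p| ^ r

namespace KineticSymbol

variable {n : ℕ} (K : KineticSymbol n)

/-- The symbol `T(p) = |P(p)|^r`. -/
def T (p : Rn n) : ℝ := |K.P p| ^ K.r

/-- The minimum set `S = {p | T(p) = 0}`. -/
def S : Set (Rn n) := {p | K.T p = 0}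

/-- `T` is a radial function. -/
def IsRadial : Prop := ∀ p q : Rn n, ‖p‖ = ‖q‖ → K.T p = K.T q

/-- The surface (Lebesgue) measure on `S`, i.e. `(n-1)`-dimensional Hausdorff measure restricted
to `S`, normalised so as to agree with Lebesgue measure on hyperplanes. -/
def surface : Measure (Rn n) :=
  (Measure.euclideanHausdorffMeasure (n - 1) : Measure (Rn n)).restrict K.S

/-- `(F_S φ)(p) = (2π)^{-n/2} |∇P(p)|^{-1/2} ∫ e^{-i x·p} φ(x) dx`; only `p ∈ S` matters. -/
def FS (φ : Rn n → ℂ) (p : Rn n) : ℂ :=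
  ((Real.sqrt ((2 * Real.pi) ^ n) * Real.sqrt ‖gradient K.P p‖ : ℝ) : ℂ)⁻¹ *
    ∫ x : Rn n, Complex.exp (-Complex.I * (⟪x, p⟫ : ℝ)) * φ x

/-- `(F_S^* u)(x) = (2π)^{-n/2} ∫_S e^{i x·p} |∇P(p)|^{-1/2} u(p) dp`. -/
def FSadj (u : Rn n → ℂ) (x : Rn n) : ℂ :=
  ((Real.sqrt ((2 * Real.pi) ^ n) : ℝ) : ℂ)⁻¹ *
    ∫ p, (Complex.exp (Complex.I * (⟪x, p⟫ : ℝ)) / (Real.sqrt ‖gradient K.P p‖ : ℝ)) * u p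
      ∂K.surface

theorem T_nonneg (p : Rn n) : 0 ≤ K.T p := Real.rpow_nonneg (abs_nonneg _) _

theorem measurable_T : Measurable K.T := by
  have h : Measurable fun p => |K.P p| := by
    simpa [Real.norm_eq_abs] using K.measurable_P.norm
  exact h.pow_const K.r

/-- The multiplier `(T(2πξ) + e)⁻¹` preserves `L²`. -/
theorem memLp_multiplier {e : ℝ} (he : 0 < e) (g : L2 n) :
    MemLp (fun ξ : Rn n => (((K.T ((2 * Real.pi) • ξ) + e)⁻¹ : ℝ) : ℂ) * g ξ) 2 volume := by
  have hm : Measurable fun ξ : Rn n => (((K.T ((2 * Real.pi) • ξ) + e)⁻¹ : ℝ) : ℂ) :=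
    Complex.measurable_ofReal.comp
      (((K.measurable_T.comp (measurable_const_smul (2 * Real.pi))).add_const e).inv)
  refine (Lp.memLp g).of_le_mul (c := e⁻¹) (hm.aestronglyMeasurable.mul (Lp.memLp g).1) ?_
  refine Filter.Eventually.of_forall fun ξ => ?_
  rw [norm_mul, Complex.norm_real, Real.norm_eq_abs]
  have h0 := K.T_nonneg ((2 * Real.pi) • ξ)
  have h1 : |(K.T ((2 * Real.pi) • ξ) + e)⁻¹| ≤ e⁻¹ := by
    rw [abs_of_nonneg (by positivity)]
    exact inv_anti₀ he (by linarith)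
  exact mul_le_mul_of_nonneg_right h1 (norm_nonneg _)

/-- The operator `(T + e)⁻¹` on `L²(ℝⁿ)`: in Fourier space, multiplication by `(T(p) + e)⁻¹`,
where `p` is the variable of the Fourier transform `φ̂(p) = (2π)^{-n/2} ∫ e^{-i x·p} φ(x) dx`.
The transform `𝓕` used here is the one with kernel `e^{-2πi x·ξ}`, so that `p = 2πξ`. -/
def resolvent {e : ℝ} (he : 0 < e) (φ : L2 n) : L2 n :=
  𝓕⁻ ((K.memLp_multiplier he (𝓕 φ)).toLp _)

/-- The function `f(e)`. -/
def f (e : ℝ) : ℝ :=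
  if K.r = 1 then 2 * Real.log (1 + 1 / e)
  else 2 * Real.pi / (K.r * Real.sin (Real.pi / K.r)) * (1 / e ^ ((K.r - 1) / K.r))

/-- The function `g(e)`. -/
def g (e : ℝ) : ℝ :=
  if K.r < 2 then 1
  else if K.r = 2 then 1 + Real.log (1 + 1 / e)
  else 1 + e ^ (2 - K.r)

/-- `M` is the bounded operator `M_e = V^{1/2} ((T+e)⁻¹ - f(e) F_S^* F_S) |V|^{1/2}` on `L²(ℝⁿ)`,
with the convention `V^{1/2} = sgn(V) |V|^{1/2}`: on the (dense) domain of the multiplication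
operator `|V|^{1/2}`, consisting of those `ψ ∈ L²` with `|V|^{1/2} ψ ∈ L²`, it is the composition
of the operators in this formula. -/
def IsM (V : Rn n → ℝ) {e : ℝ} (he : 0 < e) (M : L2 n →L[ℂ] L2 n) : Prop :=
  ∀ (ψ : L2 n) (hψ : MemLp (fun x => ((Real.sqrt |V x| : ℝ) : ℂ) * ψ x) 2 volume),
    M ψ =ᵐ[volume] fun x =>
      ((Real.sign (V x) * Real.sqrt |V x| : ℝ) : ℂ) *
        (K.resolvent he (hψ.toLp _) x -
          (K.f e : ℂ) * K.FSadj (K.FS fun y => ((Real.sqrt |V y| : ℝ) : ℂ) * ψ y) x)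

/-- The exponent of the norm `𝒜(V)`: `n/s` if `n > s`, `1 + ε` if `n = s`, `1` if `n < s`. -/
def exponent (ε : ℝ) : ℝ≥0∞ :=
  if K.s < n then ENNReal.ofReal (n / K.s)
  else if K.s = n then ENNReal.ofReal (1 + ε)
  else 1

/-- `𝒜(V)`. -/
def A (ε : ℝ) (V : Rn n → ℝ) : ℝ := lpNorm V (K.exponent ε) volume

/-- The values of `κ`: `2` for every `T`; if `T` is radial, also `0` for `n ≥ 3` and `1` for
`n = 2`. -/
def AdmissibleWeight (κ : ℝ) : Prop :=
  κ = 2 ∨ (K.IsRadial ∧ 3 ≤ n ∧ κ = 0) ∨ (K.IsRadial ∧ n = 2 ∧ κ = 1)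

end KineticSymbol

/-- The function `|V(x)| |x - y|^κ |V(y)|` on `ℝⁿ × ℝⁿ`. -/
def weightedPair {n : ℕ} (κ : ℝ) (V : Rn n → ℝ) (z : Rn n × Rn n) : ℝ :=
  |V z.1| * ‖z.1 - z.2‖ ^ κ * |V z.2|

end

open Filter Topology Set
open scoped NNReal

/-! Let χ be a C¹ cutoff, equal to 1 near S and supported in the interior of Ω. The symbol 1/(T+e)
splits into χ/(T+e) and (1-χ)/(T+e). The second part is at most C(1+|p|)^(-s) uniformly in e;
sandwiched between the roots of V it is controlled by a Sobolev inequality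
(`exists_lintegral_op_rpow_le`) and yields 𝒜(V). The first part minus f(e) F_S^* F_S is convolution
with (2π)^(-n) times `kernel`; sandwiched, it is Hilbert–Schmidt, and it suffices that |kernel(z)|²
≤ C g(e)² (1+|z|^κ).

The kernel bound uses no coordinates on the level sets of P. If a is a C¹ field with a·∇P = χ, then
∫ φ'(P) χ F = -∫ φ(P) div(Fa) for every C¹ function φ (`IsTransverse.integral_deriv_comp_smul`). If
φ is the odd primitive Φ_e of 1/(|u|^r+e), the left side is the resolvent integral. If φ =
arctan(·/τ) and τ → 0, it becomes π times the integral of F/|∇P| over S, with (π/2) sgn(P) on the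
right (`IsCutoff.surface_integral_eq`). So the quantity to bound is -∫ (Φ_e(P) - f(e) sgn(P)/2)
div(Fa). Since f(e)/2 equals ∫_0^1 du/(u^r+e) up to a bounded error, the bracket is bounded on supp
χ except for the tail ∫_{|P|}^1 du/(u^r+e). By vol{|P|<u} = O(u), itself a case of the same
integration by parts, the tail integrates to at most a constant times ∫_0^1 u/(u^r+e) du = O(g(e)).
The outcome, `IsCutoff.exists_kernel_bound`, involves F only through its C¹ size on supp χ.

For a general T, F is the plane wave, of C¹ size 1+|z|, which gives κ = 2. For a radial T the plane
wave may be replaced by its spherical mean, which solves a Bessel-type equation; an energy estimate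
bounds its gradient at |z| = t by a constant if n ≥ 3 and by a constant times √t if n = 2, whence κ
= 0 and κ = 1.

That the limit τ → 0 produces the Hausdorff surface measure is `tendsto_cauchyMean`. It is proved by
straightening the level sets with charts whose derivative at the base point is the identity: they
are bi-Lipschitz with constant as close to 1 as desired, hence distort Lebesgue and Hausdorff
measures by factors close to 1. -/

/-! ### Cauchy kernels concentrating on a hyperplane -/

theorem measurePreserving_line_add_orthogonal {n : ℕ} (ν : Rn n) (hν : ‖ν‖ = 1) :
    MeasurePreserving (fun q : ℝ × (ℝ ∙ ν)ᗮ => q.1 • ν + (q.2 : Rn n))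
      ((volume : Measure ℝ).prod (volume : Measure (ℝ ∙ ν)ᗮ)) volume := by
  have h1 := ((ℝ ∙ ν).measurePreserving_measurableEquivProd (0 : Rn n)).symm
  rw [InnerProductSpace.euclideanHausdorffMeasure_eq_volume] at h1
  have h2 := (LinearIsometryEquiv.toSpanUnitSingleton ν hν (𝕜 := ℝ)).measurePreserving
  have h3 := h1.comp (h2.prod (MeasurePreserving.id (volume : Measure (ℝ ∙ ν)ᗮ)))
  convert! h3 using 1
  ext q
  simp

/-- Isometric embeddings preserve Hausdorff measure, and on an inner product space of dimension n-1
the normalised one is Lebesgue measure. -/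
theorem map_subtype_orthogonal_eq_euclideanHausdorffMeasure {n : ℕ} (ν : Rn n) (hν : ‖ν‖ = 1) :
    (volume : Measure (ℝ ∙ ν)ᗮ).map Subtype.val =
      (Measure.euclideanHausdorffMeasure (n - 1) : Measure (Rn n)).restrict {y | ⟪ν, y⟫ = 0} := by
  have hr : Module.finrank ℝ (ℝ ∙ ν)ᗮ = n - 1 := by
    have h := (ℝ ∙ ν).finrank_add_finrank_orthogonal
    rw [finrank_span_singleton (by rintro rfl; simp at hν)] at h
    simp at h
    omega
  have h := (isometry_subtype_coe (s := ((ℝ ∙ ν)ᗮ : Set (Rn n)))).map_euclideanHausdorffMeasure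
    (d := n - 1)
  have h2 : (Measure.euclideanHausdorffMeasure (n - 1) : Measure (ℝ ∙ ν)ᗮ) = volume := by
    rw [← hr]
    exact InnerProductSpace.euclideanHausdorffMeasure_eq_volume
  have h3 : range (Subtype.val : ((ℝ ∙ ν)ᗮ : Set (Rn n)) → Rn n) = {y | ⟪ν, y⟫ = 0} := by
    ext y
    simp [Submodule.mem_orthogonal_singleton_iff_inner_right]
  rw [h3] at h
  rw [← h, ← h2]
  rfl

/-- Orthogonality gives |v| ≤ |tν + v|, so all slices of the support lie in one ball of the
hyperplane, and a constant on that ball dominates every integrand. -/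
theorem continuous_integral_add_orthogonal {n : ℕ} (ν : Rn n) {w : Rn n → ℝ}
    (hw : Continuous w) (hc : HasCompactSupport w) :
    Continuous (fun t : ℝ => ∫ v : (ℝ ∙ ν)ᗮ, w (t • ν + v)) ∧
      ∃ M, ∀ t : ℝ, |∫ v : (ℝ ∙ ν)ᗮ, w (t • ν + v)| ≤ M := by
  obtain ⟨C, hC⟩ := hw.bounded_above_of_compact_support hc
  obtain ⟨R, hR⟩ := hc.isCompact.isBounded.subset_closedBall 0
  have hC0 : 0 ≤ C := (norm_nonneg _).trans (hC 0)
  have hbd : ∀ (t : ℝ) (v : (ℝ ∙ ν)ᗮ), ‖w (t • ν + v)‖ ≤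
      (Metric.closedBall (0 : (ℝ ∙ ν)ᗮ) R).indicator (fun _ => C) v := by
    intro t v
    by_cases hv : v ∈ Metric.closedBall (0 : (ℝ ∙ ν)ᗮ) R
    · rw [indicator_of_mem hv]; exact hC _
    · rw [indicator_of_notMem hv]
      have : t • ν + (v : Rn n) ∉ tsupport w := by
        intro h
        apply hv
        have h1 := hR h
        rw [mem_closedBall_zero_iff] at h1 ⊢
        have h2 : ⟪t • ν, (v : Rn n)⟫ = 0 := by
          rw [inner_smul_left, (Submodule.mem_orthogonal_singleton_iff_inner_right).1 v.2]; simp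
        have h3 := norm_add_sq_eq_norm_sq_add_norm_sq_of_inner_eq_zero _ _ h2
        have h4 : ‖(v : Rn n)‖ * ‖(v : Rn n)‖ ≤ R * R := by nlinarith [norm_nonneg (t • ν), norm_nonneg (t • ν + (v : Rn n))]
        have : 0 ≤ R := (norm_nonneg _).trans h1
        change ‖(v : Rn n)‖ ≤ R
        nlinarith [norm_nonneg (v : Rn n)]
      rw [image_eq_zero_of_notMem_tsupport this, norm_zero]
  have hint : Integrable ((Metric.closedBall (0 : (ℝ ∙ ν)ᗮ) R).indicator (fun _ => C)) :=
    (integrable_indicator_iff measurableSet_closedBall).2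
      (integrableOn_const (isCompact_closedBall _ _).measure_lt_top.ne)
  refine ⟨continuous_of_dominated (fun t => ?_) (fun t => Eventually.of_forall (hbd t)) hint
    (Eventually.of_forall fun v => ?_), ∫ v, (Metric.closedBall (0 : (ℝ ∙ ν)ᗮ) R).indicator (fun _ => C) v, fun t => ?_⟩
  · exact (by fun_prop : Continuous fun v : (ℝ ∙ ν)ᗮ => w (t • ν + v)).aestronglyMeasurable
  · fun_prop
  · rw [← Real.norm_eq_abs]
    exact norm_integral_le_of_norm_le hint (Eventually.of_forall (hbd t))

/-- The substitution t = τu leaves the fixed integrable function (1 + (au)²)⁻¹, of mass π/a, against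
I(τu); dominated convergence does the rest. -/
theorem tendsto_integral_cauchy_kernel {a : ℝ} (ha : 0 < a) {I : ℝ → ℝ} (hI : Continuous I)
    {M : ℝ} (hM : ∀ t, |I t| ≤ M) :
    Tendsto (fun τ : ℝ => ∫ t, τ / (τ ^ 2 + (a * t) ^ 2) * I t) (𝓝[>] 0)
      (𝓝 (Real.pi / a * I 0)) := by
  have h1 : ∀ᶠ τ : ℝ in 𝓝[>] 0, ∫ u : ℝ, (1 + (a * u) ^ 2)⁻¹ * I (τ * u) =
      ∫ t, τ / (τ ^ 2 + (a * t) ^ 2) * I t := by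
    filter_upwards [self_mem_nhdsWithin] with τ (hτ : 0 < τ)
    have h := Measure.integral_comp_mul_left (fun t => τ * (τ / (τ ^ 2 + (a * t) ^ 2) * I t)) τ
    rw [integral_const_mul τ (fun t => τ / (τ ^ 2 + (a * t) ^ 2) * I t), abs_of_pos (by positivity),
      smul_eq_mul, inv_mul_cancel_left₀ hτ.ne'] at h
    rw [← h]
    congr 1
    ext u
    have : 0 < 1 + (a * u) ^ 2 := by positivity
    field_simp
  have hint : Integrable fun u : ℝ => (1 + (a * u) ^ 2)⁻¹ :=
    (integrable_inv_one_add_sq).comp_mul_left' ha.ne'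
  have h2 : ∫ u : ℝ, (1 + (a * u) ^ 2)⁻¹ = Real.pi / a := by
    rw [Measure.integral_comp_mul_left (fun u : ℝ => (1 + u ^ 2)⁻¹) a, integral_univ_inv_one_add_sq,
      abs_of_pos (by positivity), smul_eq_mul]
    ring
  rw [← h2, ← integral_mul_const]
  refine Tendsto.congr' h1 ?_
  refine tendsto_integral_filter_of_dominated_convergence (fun u => (1 + (a * u) ^ 2)⁻¹ * M)
    (Eventually.of_forall fun τ => ?_) (Eventually.of_forall fun τ => Eventually.of_forall fun u => ?_)
    (hint.mul_const _) (Eventually.of_forall fun u => ?_)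
  · exact hint.aestronglyMeasurable.mul (by fun_prop : Continuous fun u => I (τ * u)).aestronglyMeasurable
  · rw [norm_mul, Real.norm_of_nonneg (by positivity), Real.norm_eq_abs]
    exact mul_le_mul_of_nonneg_left (hM _) (by positivity)
  · refine Tendsto.const_mul _ ?_
    have : Tendsto (fun τ : ℝ => I (τ * u)) (𝓝 0) (𝓝 (I (0 * u))) := by
      apply Continuous.tendsto; fun_prop
    rw [zero_mul] at this
    exact this.mono_left nhdsWithin_le_nhds

/-- The model case P = a⟪ν,·⟫ of `tendsto_cauchyMean`: Fubini along ν reduces it to one dimension.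
-/
theorem tendsto_integral_cauchy_hyperplane {n : ℕ} (ν : Rn n) (hν : ‖ν‖ = 1) {a : ℝ} (ha : 0 < a)
    {w : Rn n → ℝ} (hw : Continuous w) (hc : HasCompactSupport w) :
    Tendsto (fun τ : ℝ => ∫ y, τ / (τ ^ 2 + (a * ⟪ν, y⟫) ^ 2) * w y) (𝓝[>] 0)
      (𝓝 (Real.pi / a * ∫ y in {y | ⟪ν, y⟫ = 0}, w y ∂(Measure.euclideanHausdorffMeasure (n - 1)))) := by
  obtain ⟨hI, M, hM⟩ := continuous_integral_add_orthogonal ν hw hc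
  have key := tendsto_integral_cauchy_kernel ha hI hM
  rw [← map_subtype_orthogonal_eq_euclideanHausdorffMeasure ν hν, integral_map
    (by fun_prop) hw.aestronglyMeasurable]
  simp only [zero_smul, zero_add] at key
  refine key.congr' ?_
  filter_upwards [self_mem_nhdsWithin] with τ (hτ : 0 < τ)
  have hcont : Continuous fun y : Rn n => τ / (τ ^ 2 + (a * ⟪ν, y⟫) ^ 2) * w y := by
    refine Continuous.mul ?_ hw
    exact continuous_const.div (by fun_prop) fun y => by positivity
  have hP := measurePreserving_line_add_orthogonal ν hν
  have hint : Integrable (fun y : Rn n => τ / (τ ^ 2 + (a * ⟪ν, y⟫) ^ 2) * w y) :=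
    hcont.integrable_of_hasCompactSupport hc.mul_left
  rw [← hP.map_eq, integral_map hP.aemeasurable hcont.aestronglyMeasurable, integral_prod]
  · congr 1
    ext t
    rw [← integral_const_mul]
    congr 1
    ext v
    have : ⟪ν, t • ν + (v : Rn n)⟫ = t := by
      rw [inner_add_right, inner_smul_right, real_inner_self_eq_norm_sq, hν,
        (Submodule.mem_orthogonal_singleton_iff_inner_right).1 v.2]
      simp
    rw [this]
  · exact hP.integrable_comp_of_integrable hint

/-! ### Straightening charts with bi-Lipschitz constant close to 1 -/

/-- Strict differentiability makes ψ minus the identity ε-Lipschitz near p₀. With ε = 1 - 1/L the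
lower constant 1 - ε is exactly 1/L, and the upper one satisfies 1 + ε = 2 - 1/L ≤ L because
(L-1)²/L ≥ 0. -/
theorem exists_bilipschitz_chart {n : ℕ} {ψ : Rn n → Rn n} {p₀ : Rn n}
    (h : HasStrictFDerivAt ψ (ContinuousLinearMap.id ℝ (Rn n)) p₀) {L : ℝ≥0} (hL : 1 < L)
    {N : Set (Rn n)} (hN : N ∈ 𝓝 p₀) :
    ∃ e : OpenPartialHomeomorph (Rn n) (Rn n), (e : Rn n → Rn n) = ψ ∧ p₀ ∈ e.source ∧
      e.source ⊆ N ∧ LipschitzOnWith L ψ e.source ∧ LipschitzOnWith L e.symm e.target := by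
  have hL' : (1 : ℝ) < L := hL
  set ε : ℝ := 1 - (L : ℝ)⁻¹ with hε
  have hLi : (L : ℝ) * (L : ℝ)⁻¹ = 1 := mul_inv_cancel₀ (by positivity)
  have hε0 : 0 < ε := by
    have := inv_lt_one_of_one_lt₀ hL'
    linarith
  obtain ⟨s, hs, hap⟩ := h.approximates_deriv_on_nhds (c := ⟨ε, hε0.le⟩) (Or.inr hε0)
  have h' : HasStrictFDerivAt ψ ((ContinuousLinearEquiv.refl ℝ (Rn n) : Rn n ≃L[ℝ] Rn n) :
      Rn n →L[ℝ] Rn n) p₀ := h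
  set e₀ := h'.toOpenPartialHomeomorph ψ with he₀
  have hsub : interior (s ∩ N) ∈ 𝓝 p₀ := interior_mem_nhds.2 (inter_mem hs hN)
  have key : ∀ x ∈ s, ∀ y ∈ s, ‖x - y‖ ≤ L * ‖ψ x - ψ y‖ ∧ ‖ψ x - ψ y‖ ≤ L * ‖x - y‖ := by
    intro x hx y hy
    have h1 : ‖ψ x - ψ y - (x - y)‖ ≤ ε * ‖x - y‖ := hap x hx y hy
    have h2 := norm_sub_norm_le (x - y) (ψ x - ψ y)
    have h3 := norm_sub_norm_le (ψ x - ψ y) (x - y)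
    rw [norm_sub_rev (x - y) (ψ x - ψ y)] at h2
    have h4 := norm_nonneg (x - y)
    constructor
    · have : (L : ℝ)⁻¹ * ‖x - y‖ ≤ ‖ψ x - ψ y‖ := by rw [hε] at h1; linarith
      calc ‖x - y‖ = L * ((L : ℝ)⁻¹ * ‖x - y‖) := by rw [← mul_assoc, hLi, one_mul]
        _ ≤ _ := by gcongr
    · have : 1 + ε ≤ L := by
        have : 0 ≤ (L - 1 : ℝ) ^ 2 * (L : ℝ)⁻¹ := by positivity
        have h5 : (L - 1 : ℝ) ^ 2 * (L : ℝ)⁻¹ = L * (L * (L : ℝ)⁻¹) - 2 * (L * (L : ℝ)⁻¹) + (L : ℝ)⁻¹ := by ring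
        rw [hLi] at h5
        rw [hε]; linarith
      nlinarith
  refine ⟨e₀.restrOpen (interior (s ∩ N)) isOpen_interior, ?_, ?_, ?_, ?_, ?_⟩
  · rfl
  · simp only [OpenPartialHomeomorph.restrOpen_source]
    exact ⟨h'.mem_toOpenPartialHomeomorph_source, mem_of_mem_nhds hsub⟩
  · simp only [OpenPartialHomeomorph.restrOpen_source]
    exact fun x hx => (interior_subset hx.2).2
  · refine LipschitzOnWith.of_dist_le_mul fun x hx y hy => ?_
    simp only [OpenPartialHomeomorph.restrOpen_source] at hx hy
    rw [dist_eq_norm, dist_eq_norm]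
    exact (key x (interior_subset hx.2).1 y (interior_subset hy.2).1).2
  · refine LipschitzOnWith.of_dist_le_mul fun x hx y hy => ?_
    set e := e₀.restrOpen (interior (s ∩ N)) isOpen_interior with he
    have hx' := e.map_target hx
    have hy' := e.map_target hy
    have hxx : ψ (e.symm x) = x := e.right_inv hx
    have hyy : ψ (e.symm y) = y := e.right_inv hy
    rw [dist_eq_norm, dist_eq_norm]
    rw [he, OpenPartialHomeomorph.restrOpen_source, ← he] at hx' hy'
    have := (key _ (interior_subset hx'.2).1 _ (interior_subset hy'.2).1).1
    rwa [hxx, hyy] at this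

theorem LipschitzOnWith.euclideanHausdorffMeasure_image_le {n : ℕ} {L : ℝ≥0} {f : Rn n → Rn n}
    {s : Set (Rn n)} (h : LipschitzOnWith L f s) (d : ℕ) :
    Measure.euclideanHausdorffMeasure d (f '' s) ≤
      (L : ℝ≥0∞) ^ d * Measure.euclideanHausdorffMeasure d s := by
  rw [Measure.euclideanHausdorffMeasure_def, Measure.smul_apply, Measure.smul_apply]
  have h1 := h.hausdorffMeasure_image_le (d := d) (by positivity)
  rw [ENNReal.rpow_natCast] at h1
  calc _ ≤ _ • ((L : ℝ≥0∞) ^ d * _) := by gcongr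
    _ = _ := by rw [ENNReal.smul_def, ENNReal.smul_def, smul_eq_mul, smul_eq_mul]; ring

/-- A Lipschitz image scales d-dimensional measure by at most L^d; applied to the chart and to its
inverse, this compares the restricted measures in both directions. It serves twice: with d = n-1 and
Y a hyperplane, and with d = n and Y everything. -/
theorem lintegral_chart_le {n : ℕ} {ψ : Rn n → Rn n} (hψ : Measurable ψ)
    {e : OpenPartialHomeomorph (Rn n) (Rn n)} (he : (e : Rn n → Rn n) = ψ) {L : ℝ≥0}
    (h1 : LipschitzOnWith L ψ e.source) (h2 : LipschitzOnWith L e.symm e.target) (d : ℕ)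
    (Y : Set (Rn n)) {h : Rn n → ℝ≥0∞} (hh : Measurable h) :
    ∫⁻ y in e.target ∩ Y, h y ∂(Measure.euclideanHausdorffMeasure d) ≤
      (L : ℝ≥0∞) ^ d * ∫⁻ p in e.source ∩ ψ ⁻¹' Y, h (ψ p) ∂(Measure.euclideanHausdorffMeasure d) ∧
    ∫⁻ p in e.source ∩ ψ ⁻¹' Y, h (ψ p) ∂(Measure.euclideanHausdorffMeasure d) ≤
      (L : ℝ≥0∞) ^ d * ∫⁻ y in e.target ∩ Y, h y ∂(Measure.euclideanHausdorffMeasure d) := by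
  subst he
  have hA : (Measure.euclideanHausdorffMeasure d).restrict (e.target ∩ Y) ≤
      (L : ℝ≥0∞) ^ d • ((Measure.euclideanHausdorffMeasure d).restrict (e.source ∩ e ⁻¹' Y)).map e := by
    refine Measure.le_iff.2 fun T hT => ?_
    rw [Measure.restrict_apply hT, Measure.smul_apply, Measure.map_apply hψ hT,
      Measure.restrict_apply (hψ hT)]
    have : T ∩ (e.target ∩ Y) = e '' (e ⁻¹' T ∩ (e.source ∩ e ⁻¹' Y)) := by
      ext y
      constructor
      · rintro ⟨a, b, c⟩
        exact ⟨e.symm y, ⟨by simpa [b] using a, e.map_target b, by simpa [b] using c⟩, e.right_inv b⟩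
      · rintro ⟨x, ⟨a, b, c⟩, rfl⟩
        exact ⟨a, e.map_source b, c⟩
    rw [this]
    exact (h1.mono (inter_subset_right.trans inter_subset_left)).euclideanHausdorffMeasure_image_le d
  have hB : ((Measure.euclideanHausdorffMeasure d).restrict (e.source ∩ e ⁻¹' Y)).map e ≤
      (L : ℝ≥0∞) ^ d • (Measure.euclideanHausdorffMeasure d).restrict (e.target ∩ Y) := by
    refine Measure.le_iff.2 fun T hT => ?_
    rw [Measure.smul_apply, Measure.restrict_apply hT, Measure.map_apply hψ hT,
      Measure.restrict_apply (hψ hT)]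
    have : e ⁻¹' T ∩ (e.source ∩ e ⁻¹' Y) = e.symm '' (T ∩ (e.target ∩ Y)) := by
      ext x
      constructor
      · rintro ⟨a, b, c⟩
        exact ⟨e x, ⟨a, e.map_source b, c⟩, e.left_inv b⟩
      · rintro ⟨y, ⟨a, b, c⟩, rfl⟩
        exact ⟨by simpa [b] using a, e.map_target b, by simpa [b] using c⟩
    rw [this]
    exact (h2.mono (inter_subset_right.trans inter_subset_left)).euclideanHausdorffMeasure_image_le d
  constructor
  · calc _ ≤ ∫⁻ y, h y ∂((L : ℝ≥0∞) ^ d •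
          ((Measure.euclideanHausdorffMeasure d).restrict (e.source ∩ e ⁻¹' Y)).map e) :=
        lintegral_mono' hA le_rfl
      _ = _ := by rw [lintegral_smul_measure, lintegral_map hh hψ, smul_eq_mul]
  · rw [← lintegral_map hh hψ]
    calc _ ≤ ∫⁻ y, h y ∂((L : ℝ≥0∞) ^ d •
          (Measure.euclideanHausdorffMeasure d).restrict (e.target ∩ Y)) :=
        lintegral_mono' hB le_rfl
      _ = _ := by rw [lintegral_smul_measure, smul_eq_mul]

theorem integral_chart_le {n : ℕ} {ψ : Rn n → Rn n} (hψ : Measurable ψ)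
    {e : OpenPartialHomeomorph (Rn n) (Rn n)} (he : (e : Rn n → Rn n) = ψ) {L : ℝ≥0}
    (h1 : LipschitzOnWith L ψ e.source) (h2 : LipschitzOnWith L e.symm e.target) (d : ℕ)
    (Y : Set (Rn n)) {h : Rn n → ℝ} (hh : Measurable h) (h0 : ∀ y, 0 ≤ h y)
    (hint : IntegrableOn h (e.target ∩ Y) (Measure.euclideanHausdorffMeasure d)) :
    IntegrableOn (fun p => h (ψ p)) (e.source ∩ ψ ⁻¹' Y) (Measure.euclideanHausdorffMeasure d) ∧
    ∫ y in e.target ∩ Y, h y ∂(Measure.euclideanHausdorffMeasure d) ≤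
      (L : ℝ) ^ d * ∫ p in e.source ∩ ψ ⁻¹' Y, h (ψ p) ∂(Measure.euclideanHausdorffMeasure d) ∧
    ∫ p in e.source ∩ ψ ⁻¹' Y, h (ψ p) ∂(Measure.euclideanHausdorffMeasure d) ≤
      (L : ℝ) ^ d * ∫ y in e.target ∩ Y, h y ∂(Measure.euclideanHausdorffMeasure d) := by
  obtain ⟨hA, hB⟩ := lintegral_chart_le hψ he h1 h2 d Y hh.ennreal_ofReal
  have hfin : ∫⁻ y in e.target ∩ Y, ENNReal.ofReal (h y) ∂(Measure.euclideanHausdorffMeasure d) ≠ ∞ :=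
    (hasFiniteIntegral_iff_ofReal (Eventually.of_forall h0)).1 hint.2 |>.ne
  have hL : ((L : ℝ≥0∞) ^ d) ≠ ∞ := ENNReal.pow_ne_top ENNReal.coe_ne_top
  have hfin2 := ne_top_of_le_ne_top (ENNReal.mul_ne_top hL hfin) hB
  have e1 := integral_eq_lintegral_of_nonneg_ae (μ := (Measure.euclideanHausdorffMeasure d).restrict (e.target ∩ Y))
    (Eventually.of_forall h0) hh.aestronglyMeasurable
  have e2 := integral_eq_lintegral_of_nonneg_ae
    (μ := (Measure.euclideanHausdorffMeasure d).restrict (e.source ∩ ψ ⁻¹' Y)) (f := fun p => h (ψ p))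
    (Eventually.of_forall fun p => h0 _) (hh.comp hψ).aestronglyMeasurable
  refine ⟨⟨(hh.comp hψ).aestronglyMeasurable, ?_⟩, ?_, ?_⟩
  · exact (hasFiniteIntegral_iff_ofReal (Eventually.of_forall fun p => h0 _)).2 hfin2.lt_top
  · rw [e1, e2]
    have := ENNReal.toReal_mono (ENNReal.mul_ne_top hL hfin2) hA
    rwa [ENNReal.toReal_mul, ENNReal.toReal_pow, ENNReal.coe_toReal] at this
  · rw [e1, e2]
    have := ENNReal.toReal_mono (ENNReal.mul_ne_top hL hfin) hB
    rwa [ENNReal.toReal_mul, ENNReal.toReal_pow, ENNReal.coe_toReal] at this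

theorem exists_one_lt_pow_le {θ : ℝ} (hθ : 1 < θ) (N : ℕ) : ∃ L : ℝ≥0, 1 < L ∧ (L : ℝ) ^ N ≤ θ := by
  have h : ∀ᶠ x : ℝ≥0 in 𝓝 1, (x : ℝ) ^ N < θ := by
    have : Continuous fun x : ℝ≥0 => (x : ℝ) ^ N := by fun_prop
    refine (this.tendsto 1).eventually (gt_mem_nhds ?_)
    simpa using hθ
  have h2 : ∀ᶠ x : ℝ≥0 in 𝓝[>] 1, (x : ℝ) ^ N < θ := nhdsWithin_le_nhds h
  obtain ⟨L, hL, hL'⟩ := (h2.and self_mem_nhdsWithin).exists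
  exact ⟨L, hL', hL.le⟩

theorem gradient_eq_inner {n : ℕ} (P : Rn n → ℝ) (p v : Rn n) :
    fderiv ℝ P p v = ⟪gradient P p, v⟫ := by
  simp [gradient]

theorem norm_gradient {n : ℕ} (P : Rn n → ℝ) (p : Rn n) : ‖gradient P p‖ = ‖fderiv ℝ P p‖ := by
  simp [gradient]

/-- The map `p ↦ p + (P p / a - ⟪ν, p⟫) ν`, which straightens the level sets of `P`. -/
noncomputable def straighten {n : ℕ} (P : Rn n → ℝ) (a : ℝ) (ν p : Rn n) : Rn n := p + (P p / a - ⟪ν, p⟫) • ν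

theorem inner_straighten {n : ℕ} (P : Rn n → ℝ) (a : ℝ) {ν : Rn n} (hν : ‖ν‖ = 1) (p : Rn n) :
    ⟪ν, straighten P a ν p⟫ = P p / a := by
  rw [straighten, inner_add_right, inner_smul_right, real_inner_self_eq_norm_sq, hν]
  ring

/-- The map replaces the coordinate ⟪ν, p⟫ by P p / a. For a the length and ν the direction of the
gradient at p₀, these two functions have the same derivative there, so the correction is of
first-order size zero. -/
theorem hasStrictFDerivAt_straighten {n : ℕ} {P : Rn n → ℝ} {p₀ : Rn n} (hP : ContDiffAt ℝ 1 P p₀)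
    (h0 : gradient P p₀ ≠ 0) :
    HasStrictFDerivAt (straighten P ‖gradient P p₀‖ (‖gradient P p₀‖⁻¹ • gradient P p₀))
      (ContinuousLinearMap.id ℝ (Rn n)) p₀ := by
  have h1 := hP.hasStrictFDerivAt one_ne_zero
  set a := ‖gradient P p₀‖ with ha
  set ν := a⁻¹ • gradient P p₀ with hν
  have ha0 : a ≠ 0 := norm_ne_zero_iff.2 h0
  have h2 : HasStrictFDerivAt (fun p => (P p / a - ⟪ν, p⟫) • ν)
      ((a⁻¹ • fderiv ℝ P p₀ - innerSL ℝ ν).smulRight ν) p₀ := by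
    have h3 := ((h1.const_mul a⁻¹).sub (innerSL ℝ ν).hasStrictFDerivAt).smul_const ν
    refine h3.congr_of_eventuallyEq (Eventually.of_forall fun p => ?_)
    simp [div_eq_inv_mul]
  have h4 := (hasStrictFDerivAt_id p₀).add h2
  have h5 : (a⁻¹ • fderiv ℝ P p₀ - innerSL ℝ ν) = 0 := by
    ext v
    simp only [sub_apply, smul_apply, smul_eq_mul,
      gradient_eq_inner, innerSL_apply_apply, hν, inner_smul_left, zero_apply]
    simp
  rw [h5] at h4
  simpa [straighten] using! h4

/-- Extension by zero stays continuous because the image of the support is compact, hence closed,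
inside the target. -/
theorem continuous_of_chart {n : ℕ} (e : OpenPartialHomeomorph (Rn n) (Rn n)) {w : Rn n → ℝ}
    (hw : Continuous w) (hc : HasCompactSupport w) (hs : tsupport w ⊆ e.source) :
    Continuous (e.target.indicator (fun y => w (e.symm y))) ∧
      HasCompactSupport (e.target.indicator (fun y => w (e.symm y))) := by
  have hK : IsCompact (e '' tsupport w) :=
    hc.isCompact.image_of_continuousOn (e.continuousOn.mono hs)
  have hKt : e '' tsupport w ⊆ e.target := by
    rintro _ ⟨x, hx, rfl⟩
    exact e.map_source (hs hx)
  have hzero : ∀ y, y ∉ e '' tsupport w → e.target.indicator (fun y => w (e.symm y)) y = 0 := by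
    intro y hy
    by_cases hyt : y ∈ e.target
    · rw [indicator_of_mem hyt]
      by_contra hne
      exact hy ⟨e.symm y, subset_tsupport _ hne, e.right_inv hyt⟩
    · rw [indicator_of_notMem hyt]
  refine ⟨continuous_iff_continuousAt.2 fun y => ?_, HasCompactSupport.intro hK hzero⟩
  by_cases hy : y ∈ e.target
  · have : ContinuousAt (fun y => w (e.symm y)) y :=
      hw.continuousAt.comp (e.continuousAt_symm hy)
    refine this.congr ?_
    filter_upwards [e.open_target.mem_nhds hy] with z hz
    rw [indicator_of_mem hz]
  · have : y ∈ (e '' tsupport w)ᶜ := fun h => hy (hKt h)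
    refine (continuousAt_const (y := (0 : ℝ))).congr ?_
    filter_upwards [hK.isClosed.isOpen_compl.mem_nhds this] with z hz
    rw [hzero z hz]

theorem integrable_hyperplane {n : ℕ} {ν : Rn n} (hν : ‖ν‖ = 1) {w : Rn n → ℝ} (hw : Continuous w)
    (hc : HasCompactSupport w) :
    IntegrableOn w {y | ⟪ν, y⟫ = 0} (Measure.euclideanHausdorffMeasure (n - 1)) := by
  rw [IntegrableOn, ← map_subtype_orthogonal_eq_euclideanHausdorffMeasure ν hν,
    integrable_map_measure hw.aestronglyMeasurable (by fun_prop)]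
  refine (hw.comp continuous_subtype_val).integrable_of_hasCompactSupport ?_
  exact hc.comp_isClosedEmbedding ((ℝ ∙ ν)ᗮ.closed_of_finiteDimensional.isClosedEmbedding_subtypeVal)

/-! ### Cauchy means converge to surface integrals -/

/-- `∫ τ / (τ² + P²) w`, a smooth approximation of the integral of `π w / |∇P|` over `{P = 0}`. -/
noncomputable def cauchyMean {n : ℕ} (P w : Rn n → ℝ) (τ : ℝ) : ℝ := ∫ p, τ / (τ ^ 2 + P p ^ 2) * w p

/-- The integral of `π w / |∇P|` over `{P = 0}`. -/
noncomputable def levelIntegral {n : ℕ} (P w : Rn n → ℝ) : ℝ :=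
  ∫ p in {p | P p = 0}, Real.pi / ‖gradient P p‖ * w p ∂(Measure.euclideanHausdorffMeasure (n - 1))

/-- The chart turns P into a⟪ν,·⟫, for which the limit is known. The price is a factor L^n for
volumes, L^(n-1) for surface measure and L for the oscillation of |∇P| around its value at p₀; their
product is kept below θ. -/
theorem exists_local_comparison {n : ℕ} {P : Rn n → ℝ} (hPm : Measurable P) {U : Set (Rn n)}
    (hU : IsOpen U) (hP : ContDiffOn ℝ 1 P U) (hg : ∀ p ∈ U, gradient P p ≠ 0) {p₀ : Rn n}
    (hp₀ : p₀ ∈ U) {θ : ℝ} (hθ : 1 < θ) :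
    ∃ B : Set (Rn n), IsOpen B ∧ p₀ ∈ B ∧ B ⊆ U ∧ ∀ w : Rn n → ℝ, Continuous w →
      HasCompactSupport w → tsupport w ⊆ B → (∀ p, 0 ≤ w p) →
      IntegrableOn w {p | P p = 0} (Measure.euclideanHausdorffMeasure (n - 1)) ∧
      ∀ η > 0, ∀ᶠ τ in 𝓝[>] 0, cauchyMean P w τ ≤ θ * levelIntegral P w + η ∧
        levelIntegral P w ≤ θ * cauchyMean P w τ + η := by
  have hPat : ContDiffAt ℝ 1 P p₀ := hP.contDiffAt (hU.mem_nhds hp₀)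
  obtain ⟨L, hL, hLθ⟩ := exists_one_lt_pow_le hθ (n + (n - 1) + 1)
  have hL1 : (1 : ℝ) < L := hL
  have hL0 : (0 : ℝ) < L := by linarith
  set a := ‖gradient P p₀‖ with ha
  have ha0 : 0 < a := norm_pos_iff.2 (hg p₀ hp₀)
  set ν := a⁻¹ • gradient P p₀ with hνdef
  have hν : ‖ν‖ = 1 := by
    rw [hνdef, norm_smul, norm_inv, ha, norm_norm, inv_mul_cancel₀ ha0.ne']
  have hstrict := hasStrictFDerivAt_straighten hPat (hg p₀ hp₀)
  rw [← ha, ← hνdef] at hstrict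
  have hgc : ContinuousAt (fun p => ‖gradient P p‖) p₀ := by
    simp only [norm_gradient]
    exact ((hPat.fderiv_right (m := 0) (by norm_num)).continuousAt).norm
  have hN : {p | ‖gradient P p‖ < L * a ∧ a < L * ‖gradient P p‖} ∩ U ∈ 𝓝 p₀ := by
    refine inter_mem (Filter.inter_mem ?_ ?_) (hU.mem_nhds hp₀)
    · exact hgc.eventually_lt continuousAt_const (by rw [← ha]; nlinarith)
    · exact continuousAt_const.eventually_lt (continuousAt_const.mul hgc)
        (by change a < L * a; nlinarith)
  obtain ⟨e, he, hpe, hes, hl1, hl2⟩ := exists_bilipschitz_chart hstrict hL hN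
  have hψm : Measurable (straighten P a ν) := by
    unfold straighten
    fun_prop
  refine ⟨e.source, e.open_source, hpe, fun p hp => (hes hp).2, fun w hw hc hsw hw0 => ?_⟩
  obtain ⟨hWc, hWs⟩ := continuous_of_chart e hw hc hsw
  set W := e.target.indicator (fun y => w (e.symm y)) with hW
  have hW0 : ∀ y, 0 ≤ W y := fun y => indicator_nonneg (fun _ _ => hw0 _) _
  have hWψ : ∀ p ∈ e.source, W (straighten P a ν p) = w p := by
    intro p hp
    rw [← he, hW, indicator_of_mem (e.map_source hp), e.left_inv hp]
  have hWt : ∀ y, y ∉ e.target → W y = 0 := fun y hy => indicator_of_notMem hy _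
  have hpre : straighten P a ν ⁻¹' {y | ⟪ν, y⟫ = 0} = {p | P p = 0} := by
    ext p
    simp [inner_straighten P a hν p, ha0.ne']
  -- the surface integrals
  obtain ⟨s1, s2, s3⟩ := integral_chart_le hψm he hl1 hl2 (n - 1) {y | ⟪ν, y⟫ = 0}
    hWc.measurable hW0 ((integrable_hyperplane hν hWc hWs).mono_set inter_subset_right)
  rw [hpre] at s1 s2 s3
  have t1 : ∫ y in e.target ∩ {y | ⟪ν, y⟫ = 0}, W y ∂(Measure.euclideanHausdorffMeasure (n - 1)) =
      ∫ y in {y | ⟪ν, y⟫ = 0}, W y ∂(Measure.euclideanHausdorffMeasure (n - 1)) :=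
    (setIntegral_eq_of_subset_of_forall_sdiff_eq_zero
      (isClosed_eq (by fun_prop) continuous_const).measurableSet inter_subset_right
      fun y hy => hWt y fun h => hy.2 ⟨h, hy.1⟩).symm
  have hZ : MeasurableSet {p | P p = 0} := hPm (measurableSet_singleton 0)
  have hwoff : ∀ p ∈ {p | P p = 0} \ (e.source ∩ {p | P p = 0}), w p = 0 := fun p hp =>
    image_eq_zero_of_notMem_tsupport fun h => hp.2 ⟨hsw h, hp.1⟩
  have hsZ : MeasurableSet (e.source ∩ {p | P p = 0}) := e.open_source.measurableSet.inter hZ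
  have s1' : IntegrableOn w (e.source ∩ {p | P p = 0}) (Measure.euclideanHausdorffMeasure (n - 1)) :=
    s1.congr_fun (fun p hp => hWψ p hp.1) hsZ
  have t2 : ∫ p in e.source ∩ {p | P p = 0}, W (straighten P a ν p) ∂(Measure.euclideanHausdorffMeasure (n - 1)) =
      ∫ p in {p | P p = 0}, w p ∂(Measure.euclideanHausdorffMeasure (n - 1)) := by
    rw [setIntegral_congr_fun hsZ (fun p hp => hWψ p hp.1)]
    exact (setIntegral_eq_of_subset_of_forall_sdiff_eq_zero hZ inter_subset_right hwoff).symm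
  rw [t1, t2] at s2 s3
  have hint : IntegrableOn w {p | P p = 0} (Measure.euclideanHausdorffMeasure (n - 1)) :=
    s1'.of_forall_sdiff_eq_zero hZ hwoff
  refine ⟨hint, fun η hη => ?_⟩
  -- comparison of the weights
  have hcw : ∀ p, p ∈ {p | P p = 0} → Real.pi / (L * a) * w p ≤ Real.pi / ‖gradient P p‖ * w p ∧
      Real.pi / ‖gradient P p‖ * w p ≤ L * (Real.pi / a) * w p := by
    intro p _
    by_cases hp : p ∈ e.source
    · obtain ⟨⟨g1, g2⟩, -⟩ := hes hp
      have g0 : 0 < ‖gradient P p‖ := by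
        by_contra h
        nlinarith [norm_nonneg (gradient P p)]
      constructor
      · gcongr
        exact hw0 p
      · gcongr
        · exact hw0 p
        · rw [mul_div_assoc', div_le_div_iff₀ g0 ha0]
          nlinarith [Real.pi_pos]
    · have : w p = 0 := image_eq_zero_of_notMem_tsupport fun h => hp (hsw h)
      simp [this]
  have hgm : Measurable fun p => Real.pi / ‖gradient P p‖ := by
    simp only [norm_gradient]
    exact measurable_const.div (measurable_fderiv ℝ P).norm
  have hlint : IntegrableOn (fun p => Real.pi / ‖gradient P p‖ * w p) {p | P p = 0}
      (Measure.euclideanHausdorffMeasure (n - 1)) := by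
    refine Integrable.mono' (hint.const_mul (L * (Real.pi / a)))
      (hgm.mul hw.measurable).aestronglyMeasurable ?_
    filter_upwards [ae_restrict_mem hZ] with p hp
    rw [Real.norm_of_nonneg (mul_nonneg (by positivity) (hw0 p))]
    exact (hcw p hp).2
  have c1 : Real.pi / (L * a) * ∫ p in {p | P p = 0}, w p ∂(Measure.euclideanHausdorffMeasure (n - 1)) ≤
      levelIntegral P w := by
    rw [← integral_const_mul]
    exact setIntegral_mono_on (hint.const_mul _) hlint hZ fun p hp => (hcw p hp).1
  have c2 : levelIntegral P w ≤
      L * (Real.pi / a) * ∫ p in {p | P p = 0}, w p ∂(Measure.euclideanHausdorffMeasure (n - 1)) := by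
    rw [← integral_const_mul]
    exact setIntegral_mono_on hlint (hint.const_mul _) hZ fun p hp => (hcw p hp).2
  set I := ∫ p in {p | P p = 0}, w p ∂(Measure.euclideanHausdorffMeasure (n - 1)) with hI
  have hI0 : 0 ≤ I := integral_nonneg hw0
  set J := ∫ y in {y | ⟪ν, y⟫ = 0}, W y ∂(Measure.euclideanHausdorffMeasure (n - 1)) with hJ
  have hJ0 : 0 ≤ J := integral_nonneg hW0
  -- the volume integrals
  have hvol : ∀ τ : ℝ, 0 < τ →
      (∫ y, τ / (τ ^ 2 + (a * ⟪ν, y⟫) ^ 2) * W y) ≤ L ^ n * cauchyMean P w τ ∧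
      cauchyMean P w τ ≤ L ^ n * ∫ y, τ / (τ ^ 2 + (a * ⟪ν, y⟫) ^ 2) * W y := by
    intro τ hτ
    have hcont : Continuous fun y : Rn n => τ / (τ ^ 2 + (a * ⟪ν, y⟫) ^ 2) * W y := by
      refine Continuous.mul ?_ hWc
      exact continuous_const.div (by fun_prop) fun y => by positivity
    have hint' : Integrable (fun y : Rn n => τ / (τ ^ 2 + (a * ⟪ν, y⟫) ^ 2) * W y) :=
      hcont.integrable_of_hasCompactSupport hWs.mul_left
    have := integral_chart_le hψm he hl1 hl2 n univ hcont.measurable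
      (fun y => mul_nonneg (by positivity) (hW0 y))
      (by rw [EuclideanSpace.euclideanHausdorffMeasure_eq_volume]; exact hint'.integrableOn)
    rw [EuclideanSpace.euclideanHausdorffMeasure_eq_volume, preimage_univ, inter_univ, inter_univ] at this
    obtain ⟨-, v2, v3⟩ := this
    have u1 : ∫ y in e.target, τ / (τ ^ 2 + (a * ⟪ν, y⟫) ^ 2) * W y =
        ∫ y, τ / (τ ^ 2 + (a * ⟪ν, y⟫) ^ 2) * W y :=
      setIntegral_eq_integral_of_forall_compl_eq_zero fun y hy => by rw [hWt y hy, mul_zero]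
    have u2 : ∫ p in e.source, τ / (τ ^ 2 + (a * ⟪ν, straighten P a ν p⟫) ^ 2) * W (straighten P a ν p) =
        cauchyMean P w τ := by
      have u0 : ∫ p in e.source, τ / (τ ^ 2 + P p ^ 2) * w p = cauchyMean P w τ :=
        setIntegral_eq_integral_of_forall_compl_eq_zero fun p hp => by
          rw [image_eq_zero_of_notMem_tsupport fun h => hp (hsw h), mul_zero]
      rw [← u0]
      refine setIntegral_congr_fun e.open_source.measurableSet fun p hp => ?_
      simp only [inner_straighten P a hν p, hWψ p hp, mul_div_cancel₀ _ ha0.ne']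
    rw [u1, u2] at v2 v3
    exact ⟨v2, v3⟩
  have hlim := tendsto_integral_cauchy_hyperplane ν hν ha0 hWc hWs
  rw [← hJ] at hlim
  set Q := fun τ : ℝ => ∫ y, τ / (τ ^ 2 + (a * ⟪ν, y⟫) ^ 2) * W y with hQ
  have hLn : (0 : ℝ) < L ^ n := by positivity
  -- The two slacks are η divided by the factors that multiply Q in the final chains, L^n and
  -- L·L^(n-1).
  have e1 : ∀ᶠ τ in 𝓝[>] 0, Q τ < Real.pi / a * J + η / L ^ n :=
    hlim.eventually (gt_mem_nhds (by linarith [div_pos hη hLn]))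
  have hd : 0 < η / (L * L ^ (n - 1)) := by positivity
  have e2 : ∀ᶠ τ in 𝓝[>] 0, Real.pi / a * J - η / (L * L ^ (n - 1)) < Q τ :=
    hlim.eventually (lt_mem_nhds (by linarith))
  have hpa : 0 < Real.pi / a := by positivity
  filter_upwards [e1, e2, self_mem_nhdsWithin] with τ e1 e2 (hτ : 0 < τ)
  obtain ⟨v2, v3⟩ := hvol τ hτ
  have hm0 : 0 ≤ cauchyMean P w τ := by
    have : 0 ≤ Q τ := integral_nonneg fun y => mul_nonneg (by positivity) (hW0 y)
    by_contra h
    nlinarith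
  have hl0 : 0 ≤ levelIntegral P w := integral_nonneg fun p => mul_nonneg (by positivity) (hw0 p)
  have hc1' : Real.pi / a * I ≤ L * levelIntegral P w := by
    calc Real.pi / a * I = L * (Real.pi / (L * a) * I) := by field_simp
      _ ≤ _ := by gcongr
  constructor
  · calc cauchyMean P w τ ≤ L ^ n * Q τ := v3
      _ ≤ L ^ n * (Real.pi / a * J + η / L ^ n) := by gcongr
      _ = L ^ n * (Real.pi / a * J) + η := by field_simp
      _ ≤ L ^ n * (Real.pi / a * (L ^ (n - 1) * I)) + η := by gcongr
      _ = L ^ n * L ^ (n - 1) * (Real.pi / a * I) + η := by ring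
      _ ≤ L ^ n * L ^ (n - 1) * (L * levelIntegral P w) + η := by gcongr
      _ = L ^ (n + (n - 1) + 1) * levelIntegral P w + η := by ring
      _ ≤ _ := by gcongr
  · calc levelIntegral P w ≤ L * (Real.pi / a) * I := c2
      _ ≤ L * (Real.pi / a) * (L ^ (n - 1) * J) := by gcongr
      _ = L * L ^ (n - 1) * (Real.pi / a * J) := by ring
      _ ≤ L * L ^ (n - 1) * (Q τ + η / (L * L ^ (n - 1))) := by gcongr; linarith
      _ = L * L ^ (n - 1) * Q τ + η := by field_simp
      _ ≤ L * L ^ (n - 1) * (L ^ n * cauchyMean P w τ) + η := by gcongr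
      _ = L ^ (n + (n - 1) + 1) * cauchyMean P w τ + η := by ring
      _ ≤ _ := by gcongr

theorem continuous_mul_of_tsupport_subset {n : ℕ} {U : Set (Rn n)} (hU : IsOpen U) {k w : Rn n → ℝ}
    (hk : ContinuousOn k U) (hw : Continuous w) (hs : tsupport w ⊆ U) :
    Continuous fun p => k p * w p :=
  (hk.mul hw.continuousOn).continuous_of_tsupport_subset hU
    ((tsupport_mul_subset_right (f := k) (g := w)).trans hs)

section LevelSet

variable {n : ℕ} {P : Rn n → ℝ} {U : Set (Rn n)}

theorem continuousOn_div_norm_gradient (hU : IsOpen U)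
    (hP : ContDiffOn ℝ 1 P U) (hg : ∀ p ∈ U, gradient P p ≠ 0) :
    ContinuousOn (fun p => Real.pi / ‖gradient P p‖) U := by
  refine ContinuousOn.div continuousOn_const ?_ fun p hp => norm_ne_zero_iff.2 (hg p hp)
  simp only [norm_gradient]
  exact (hP.continuousOn_fderiv_of_isOpen hU le_rfl).norm

/-- Local finiteness comes from `exists_local_comparison` applied to a bump function equal to 1 near
the point: its integrability over the level set bounds the measure there. -/
theorem measure_levelSet_inter_lt_top (hPm : Measurable P)
    (hU : IsOpen U) (hP : ContDiffOn ℝ 1 P U) (hg : ∀ p ∈ U, gradient P p ≠ 0) {C : Set (Rn n)}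
    (hC : IsCompact C) (hCU : C ⊆ U) :
    (Measure.euclideanHausdorffMeasure (n - 1)).restrict {p | P p = 0} C < ∞ := by
  refine hC.measure_lt_top_of_nhdsWithin fun p hp => ?_
  obtain ⟨B, hB, hpB, -, h⟩ := exists_local_comparison hPm hU hP hg (hCU hp) one_lt_two
  obtain ⟨r, hr, hrB⟩ := Metric.nhds_basis_closedBall.mem_iff.1 (hB.mem_nhds hpB)
  let b : ContDiffBump p := ⟨r / 2, r, by positivity, by linarith⟩
  have hi := (h b b.continuous b.hasCompactSupport (by rw [b.tsupport_eq]; exact hrB)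
    (fun _ => b.nonneg)).1
  refine ⟨Metric.closedBall p (r / 2), mem_nhdsWithin_of_mem_nhds (Metric.closedBall_mem_nhds p (by positivity)), ?_⟩
  have h1 : IntegrableOn (fun _ => (1 : ℝ)) (Metric.closedBall p (r / 2))
      ((Measure.euclideanHausdorffMeasure (n - 1)).restrict {p | P p = 0}) := by
    refine (IntegrableOn.congr_fun (f := b) (Integrable.integrableOn hi) (fun q hq => ?_) measurableSet_closedBall)
    exact b.one_of_mem_closedBall hq
  rw [integrableOn_const_iff] at h1
  simpa using h1

theorem integrableOn_levelSet (hPm : Measurable P)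
    (hU : IsOpen U) (hP : ContDiffOn ℝ 1 P U) (hg : ∀ p ∈ U, gradient P p ≠ 0) {w : Rn n → ℝ}
    (hw : Continuous w) (hc : HasCompactSupport w) (hs : tsupport w ⊆ U) :
    IntegrableOn (fun p => Real.pi / ‖gradient P p‖ * w p) {p | P p = 0}
      (Measure.euclideanHausdorffMeasure (n - 1)) := by
  have hcont := continuous_mul_of_tsupport_subset hU (continuousOn_div_norm_gradient hU hP hg) hw hs
  obtain ⟨M, hM⟩ := hcont.bounded_above_of_compact_support hc.mul_left
  have hfin := measure_levelSet_inter_lt_top hPm hU hP hg hc.isCompact hs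
  have h1 : IntegrableOn (fun p => Real.pi / ‖gradient P p‖ * w p) (tsupport w)
      ((Measure.euclideanHausdorffMeasure (n - 1)).restrict {p | P p = 0}) :=
    Measure.integrableOn_of_bounded hfin.ne hcont.aestronglyMeasurable
      (Eventually.of_forall hM)
  refine (integrableOn_iff_integrable_of_support_subset ?_).1 h1
  exact (Function.support_mul_subset_right _ _).trans (subset_tsupport w)

theorem integrable_cauchyMean (hU : IsOpen U) (hP : ContDiffOn ℝ 1 P U) {w : Rn n → ℝ}
    (hw : Continuous w) (hc : HasCompactSupport w) (hs : tsupport w ⊆ U) {τ : ℝ} (hτ : 0 < τ) :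
    Integrable fun p => τ / (τ ^ 2 + P p ^ 2) * w p := by
  refine (continuous_mul_of_tsupport_subset hU ?_ hw hs).integrable_of_hasCompactSupport hc.mul_left
  exact continuousOn_const.div (continuousOn_const.add (hP.continuousOn.pow 2))
    fun p _ => by positivity

/-- On the compact support P² is bounded below, so the Cauchy kernel is O(τ). -/
theorem tendsto_cauchyMean_of_forall_ne (hP : ContDiffOn ℝ 1 P U) {w : Rn n → ℝ}
    (hw : Continuous w) (hc : HasCompactSupport w) (hs : tsupport w ⊆ U)
    (h0 : ∀ p ∈ tsupport w, P p ≠ 0) : Tendsto (cauchyMean P w) (𝓝[>] 0) (𝓝 0) := by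
  have hcont : ContinuousOn (fun p => (P p ^ 2)⁻¹) (tsupport w) :=
    ((hP.continuousOn.mono hs).pow 2).inv₀ fun p hp => pow_ne_zero 2 (h0 p hp)
  obtain ⟨M, hM⟩ := hc.isCompact.exists_bound_of_continuousOn hcont
  have hint : Integrable fun p => ‖w p‖ := (hw.integrable_of_hasCompactSupport hc).norm
  have hlim : Tendsto (fun τ : ℝ => τ * (M * ∫ p, ‖w p‖)) (𝓝[>] 0) (𝓝 0) := by
    have : Tendsto (fun τ : ℝ => τ * (M * ∫ p, ‖w p‖)) (𝓝 0) (𝓝 (0 * (M * ∫ p, ‖w p‖))) :=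
      (continuous_id.mul continuous_const).tendsto 0
    rw [zero_mul] at this
    exact this.mono_left nhdsWithin_le_nhds
  refine squeeze_zero_norm' ?_ hlim
  filter_upwards [self_mem_nhdsWithin] with τ (hτ : 0 < τ)
  rw [← mul_assoc, ← integral_const_mul]
  refine norm_integral_le_of_norm_le (hint.const_mul _) (Eventually.of_forall fun p => ?_)
  by_cases hp : p ∈ tsupport w
  · rw [norm_mul, Real.norm_of_nonneg (by positivity), div_eq_mul_inv]
    have h1 := hM p hp
    have h2 : 0 < P p ^ 2 := by have := h0 p hp; positivity
    rw [Real.norm_of_nonneg (by positivity)] at h1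
    gcongr
    refine le_trans ?_ h1
    gcongr
    nlinarith [sq_nonneg τ]
  · rw [image_eq_zero_of_notMem_tsupport hp]
    simp

/-- A partition of unity subordinate to the neighbourhoods of `exists_local_comparison`, near the
compact set {P = 0} ∩ supp w, splits w into local pieces and a remainder supported away from the
level set. -/
theorem eventually_comparison (hPm : Measurable P)
    (hU : IsOpen U) (hP : ContDiffOn ℝ 1 P U) (hg : ∀ p ∈ U, gradient P p ≠ 0) {w : Rn n → ℝ}
    (hw : Continuous w) (hc : HasCompactSupport w) (hs : tsupport w ⊆ U) (hw0 : ∀ p, 0 ≤ w p)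
    {θ η : ℝ} (hθ : 1 < θ) (hη : 0 < η) :
    ∀ᶠ τ in 𝓝[>] 0, cauchyMean P w τ ≤ θ * levelIntegral P w + η ∧
        levelIntegral P w ≤ θ * cauchyMean P w τ + η := by
  have hloc : ∀ p ∈ U, ∃ B : Set (Rn n), IsOpen B ∧ p ∈ B ∧ B ⊆ U ∧ ∀ w : Rn n → ℝ, Continuous w →
      HasCompactSupport w → tsupport w ⊆ B → (∀ p, 0 ≤ w p) →
      IntegrableOn w {p | P p = 0} (Measure.euclideanHausdorffMeasure (n - 1)) ∧
      ∀ η > 0, ∀ᶠ τ in 𝓝[>] 0, cauchyMean P w τ ≤ θ * levelIntegral P w + η ∧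
        levelIntegral P w ≤ θ * cauchyMean P w τ + η :=
    fun p hp => exists_local_comparison hPm hU hP hg hp hθ
  choose! B hBo hpB hBU hB using hloc
  set C := {p | P p = 0} ∩ tsupport w with hCdef
  have hCc : IsCompact C := by
    have : C = tsupport w ∩ P ⁻¹' {0} := by ext; simp [hCdef, and_comm]
    rw [this]
    exact hc.isCompact.of_isClosed_subset
      ((hP.continuousOn.mono hs).preimage_isClosed_of_isClosed (isClosed_tsupport w) isClosed_singleton)
      inter_subset_left
  have hCU : C ⊆ U := inter_subset_right.trans hs
  obtain ⟨t, htC, hCt⟩ := hCc.elim_nhds_subcover B fun p hp => (hBo p (hCU hp)).mem_nhds (hpB p (hCU hp))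
  have hVo : IsOpen (⋃ p ∈ t, B p) := isOpen_biUnion fun p hp => hBo p (hCU (htC p hp))
  -- The partition sums to 1 on a closed thickening of C, not merely on C, so that the remainder
  -- `w₀` vanishes near C and even the closure of its support avoids {P = 0}.
  obtain ⟨δ, hδ, hδV⟩ := hCc.exists_cthickening_subset_open hVo hCt
  let b : Fin t.card → Rn n := fun i => t.equivFin.symm i
  have hbt : ∀ i, b i ∈ t := fun i => (t.equivFin.symm i).2
  have hbU : ∀ i, b i ∈ U := fun i => hCU (htC _ (hbt i))
  obtain ⟨f, hfs, hf1, hf01, hfc⟩ := exists_continuous_sum_one_of_isOpen_isCompact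
    (s := fun i => B (b i)) (fun i => hBo _ (hbU i)) (hCc.cthickening (r := δ)) (by
      refine hδV.trans fun x hx => ?_
      simp only [mem_iUnion] at hx ⊢
      obtain ⟨p, hp, hx⟩ := hx
      exact ⟨t.equivFin ⟨p, hp⟩, by simpa [b] using hx⟩)
  set w₀ : Rn n → ℝ := fun p => w p - ∑ i, f i p * w p with hw₀
  have hw₀c : Continuous w₀ := by
    refine hw.sub (continuous_finsetSum _ fun i _ => (f i).continuous.mul hw)
  have hw₀zero : ∀ p ∈ Metric.cthickening δ C, w₀ p = 0 := by
    intro p hp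
    have := hf1 hp
    simp only [Finset.sum_apply, Pi.one_apply] at this
    simp only [hw₀, ← Finset.sum_mul, this]
    ring
  have hw₀ts : tsupport w₀ ⊆ tsupport w := by
    refine closure_mono fun p hp => ?_
    intro h0
    apply hp
    simp [hw₀, h0]
  have hw₀cs : HasCompactSupport w₀ := hc.isCompact.of_isClosed_subset (isClosed_tsupport _) hw₀ts
  have hw₀ne : ∀ p ∈ tsupport w₀, P p ≠ 0 := by
    intro p hp h0
    have hpC : p ∈ C := ⟨h0, hw₀ts hp⟩
    have hnh : Metric.cthickening δ C ∈ 𝓝 p :=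
      mem_of_superset (Metric.isOpen_thickening.mem_nhds (Metric.self_subset_thickening hδ C hpC))
        (Metric.thickening_subset_cthickening δ C)
    obtain ⟨q, hq1, hq2⟩ := mem_closure_iff_nhds.1 hp _ hnh
    exact hq2 (hw₀zero q hq1)
  have hm0 := tendsto_cauchyMean_of_forall_ne hP hw₀c hw₀cs (hw₀ts.trans hs) hw₀ne
  have hfw : ∀ i, Continuous (fun p => f i p * w p) := fun i => (f i).continuous.mul hw
  have hfwc : ∀ i, HasCompactSupport (fun p => f i p * w p) := fun i => hc.mul_left
  have hfwsB : ∀ i, tsupport (fun p => f i p * w p) ⊆ B (b i) := fun i =>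
    (tsupport_mul_subset_left (f := f i) (g := w)).trans (hfs i)
  have hfwsU : ∀ i, tsupport (fun p => f i p * w p) ⊆ U := fun i =>
    (tsupport_mul_subset_right (f := f i) (g := w)).trans hs
  have hθ0 : 0 < θ := by linarith
  -- One share of the error for each of the `t.card` pieces and one for `w₀`, whose share is
  -- multiplied by θ in the second inequality.
  set η' : ℝ := η / (θ * (t.card + 1)) with hη'
  have hη'0 : 0 < η' := by positivity
  have hall : ∀ᶠ τ in 𝓝[>] (0 : ℝ), ∀ i,
      cauchyMean P (fun p => f i p * w p) τ ≤ θ * levelIntegral P (fun p => f i p * w p) + η' ∧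
      levelIntegral P (fun p => f i p * w p) ≤ θ * cauchyMean P (fun p => f i p * w p) τ + η' :=
    eventually_all.2 fun i => (hB _ (hbU i) _ (hfw i) (hfwc i) (hfwsB i)
      fun p => mul_nonneg (hf01 i p).1 (hw0 p)).2 η' hη'0
  have hm0' : ∀ᶠ τ in 𝓝[>] (0 : ℝ), |cauchyMean P w₀ τ| < η' := by
    have := hm0.abs
    rw [abs_zero] at this
    exact this.eventually (gt_mem_nhds hη'0)
  have hc : levelIntegral P w = ∑ i, levelIntegral P (fun p => f i p * w p) := by
    simp only [levelIntegral]
    rw [← integral_finsetSum _ fun i _ => integrableOn_levelSet hPm hU hP hg (hfw i) (hfwc i) (hfwsU i)]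
    refine setIntegral_congr_fun (hPm (measurableSet_singleton 0)) fun p hp => ?_
    have : w₀ p = 0 := by
      by_contra h
      exact hw₀ne p (subset_tsupport _ h) hp
    rw [← Finset.mul_sum, ← sub_eq_zero, ← mul_sub]
    simp only [hw₀] at this
    rw [this, mul_zero]
  filter_upwards [hall, hm0', self_mem_nhdsWithin] with τ hall hm0' (hτ : 0 < τ)
  have hm : cauchyMean P w τ = ∑ i, cauchyMean P (fun p => f i p * w p) τ + cauchyMean P w₀ τ := by
    simp only [cauchyMean]
    rw [← integral_finsetSum _ fun i _ => integrable_cauchyMean hU hP (hfw i) (hfwc i) (hfwsU i) hτ,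
      ← integral_add (integrable_finsetSum _ fun i _ => integrable_cauchyMean hU hP (hfw i) (hfwc i) (hfwsU i) hτ)
        (integrable_cauchyMean hU hP hw₀c hw₀cs (hw₀ts.trans hs) hτ)]
    congr 1
    ext p
    simp only [hw₀]
    rw [← Finset.mul_sum]
    ring
  rw [abs_lt] at hm0'
  have hcard : (t.card : ℝ) * η' + θ * η' ≤ η := by
    calc (t.card : ℝ) * η' + θ * η' ≤ (t.card : ℝ) * (θ * η') + θ * η' := by
          gcongr; nlinarith
      _ = η := by rw [hη']; field_simp
  have hθη : η' ≤ θ * η' := by nlinarith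
  have hs1 := Finset.sum_le_sum fun i (_ : i ∈ Finset.univ) => (hall i).1
  have hs2 := Finset.sum_le_sum fun i (_ : i ∈ Finset.univ) => (hall i).2
  rw [Finset.sum_add_distrib, ← Finset.mul_sum, Finset.sum_const, Finset.card_univ, Fintype.card_fin,
    nsmul_eq_mul] at hs1 hs2
  rw [hm, hc]
  constructor
  · linarith
  · nlinarith

theorem tendsto_cauchyMean_of_nonneg (hPm : Measurable P)
    (hU : IsOpen U) (hP : ContDiffOn ℝ 1 P U) (hg : ∀ p ∈ U, gradient P p ≠ 0) {w : Rn n → ℝ}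
    (hw : Continuous w) (hc : HasCompactSupport w) (hs : tsupport w ⊆ U) (hw0 : ∀ p, 0 ≤ w p) :
    Tendsto (cauchyMean P w) (𝓝[>] 0) (𝓝 (levelIntegral P w)) := by
  rw [Metric.tendsto_nhds]
  intro δ hδ
  set c := levelIntegral P w with hcdef
  have hc0 : 0 ≤ c := integral_nonneg fun p => mul_nonneg (by positivity) (hw0 p)
  -- With κ and the additive error at most 1, the mean is at most 2c + 1, so multiplying by 1 + κ
  -- moves it by no more than κ(2c + 1) ≤ δ/4.
  set κ := min 1 (δ / (4 * (2 * c + 1))) with hκ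
  have hκ0 : 0 < κ := lt_min one_pos (by positivity)
  have hκ1 : κ ≤ 1 := min_le_left _ _
  have hκ2 : κ * (2 * c + 1) ≤ δ / 4 := by
    calc κ * (2 * c + 1) ≤ δ / (4 * (2 * c + 1)) * (2 * c + 1) := by gcongr; exact min_le_right _ _
      _ = δ / 4 := by field_simp
  have hη : 0 < min 1 (δ / 4) := lt_min one_pos (by positivity)
  filter_upwards [eventually_comparison hPm hU hP hg hw hc hs hw0 (θ := 1 + κ) (by linarith) hη]
    with τ ⟨h1, h2⟩
  have e1 : min 1 (δ / 4) ≤ 1 := min_le_left _ _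
  have e2 : min 1 (δ / 4) ≤ δ / 4 := min_le_right _ _
  rw [← hcdef] at h1 h2
  rw [Real.dist_eq, abs_lt]
  have h3 : κ * cauchyMean P w τ ≤ κ * (2 * c + 1) := by
    gcongr
    nlinarith
  constructor <;> nlinarith

/-- Positive and negative parts reduce a signed weight to the nonnegative case. This limit takes the
place of the coarea formula: later surface integrals over S are reached through it. -/
theorem tendsto_cauchyMean (hPm : Measurable P)
    (hU : IsOpen U) (hP : ContDiffOn ℝ 1 P U) (hg : ∀ p ∈ U, gradient P p ≠ 0) {w : Rn n → ℝ}
    (hw : Continuous w) (hc : HasCompactSupport w) (hs : tsupport w ⊆ U) :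
    Tendsto (cauchyMean P w) (𝓝[>] 0) (𝓝 (levelIntegral P w)) := by
  have hpos : ∀ v : Rn n → ℝ, Continuous v → HasCompactSupport v → tsupport v ⊆ U →
      Continuous (fun p => max (v p) 0) ∧ HasCompactSupport (fun p => max (v p) 0) ∧
        tsupport (fun p => max (v p) 0) ⊆ U := by
    intro v hv hvc hvs
    have hsub : Function.support (fun p => max (v p) 0) ⊆ Function.support v := by
      intro p hp h
      apply hp
      simp [h]
    exact ⟨hv.max continuous_const, hvc.mono hsub, (closure_mono hsub).trans hvs⟩
  obtain ⟨a1, a2, a3⟩ := hpos w hw hc hs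
  obtain ⟨b1, b2, b3⟩ := hpos (fun p => - w p) hw.neg hc.neg (by rwa [show (fun p => - w p) = -w from rfl, tsupport_neg])
  have hdec : ∀ p, w p = max (w p) 0 - max (- w p) 0 := fun p => (max_zero_sub_max_neg_zero_eq_self _).symm
  have hA := tendsto_cauchyMean_of_nonneg hPm hU hP hg a1 a2 a3 fun p => le_max_right _ _
  have hB := tendsto_cauchyMean_of_nonneg hPm hU hP hg b1 b2 b3 fun p => le_max_right _ _
  have hl : levelIntegral P w =
      levelIntegral P (fun p => max (w p) 0) - levelIntegral P (fun p => max (- w p) 0) := by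
    simp only [levelIntegral]
    rw [← integral_sub (integrableOn_levelSet hPm hU hP hg a1 a2 a3)
      (integrableOn_levelSet hPm hU hP hg b1 b2 b3)]
    congr 1
    ext p
    rw [← mul_sub, ← hdec]
  rw [hl]
  refine (hA.sub hB).congr' ?_
  filter_upwards [self_mem_nhdsWithin] with τ (hτ : 0 < τ)
  simp only [cauchyMean]
  rw [← integral_sub (integrable_cauchyMean hU hP a1 a2 a3 hτ) (integrable_cauchyMean hU hP b1 b2 b3 hτ)]
  congr 1
  ext p
  rw [← mul_sub, ← hdec]

end LevelSet

/-! ### One-dimensional integrals behind f and g -/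

theorem setIntegral_Ioi_eq_of_lintegral {f : ℝ → ℝ} {c : ℝ} (hf : Measurable f)
    (h0 : ∀ u ∈ Ioi (0 : ℝ), 0 ≤ f u) (hc : 0 ≤ c)
    (h : ∫⁻ u in Ioi 0, ENNReal.ofReal (f u) = ENNReal.ofReal c) :
    IntegrableOn f (Ioi 0) ∧ ∫ u in Ioi 0, f u = c := by
  have h0' : 0 ≤ᵐ[volume.restrict (Ioi 0)] f := by
    filter_upwards [ae_restrict_mem measurableSet_Ioi] with u hu using h0 u hu
  refine ⟨⟨hf.aestronglyMeasurable, (hasFiniteIntegral_iff_ofReal h0').2 ?_⟩, ?_⟩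
  · rw [h]; exact ENNReal.ofReal_lt_top
  · rw [integral_eq_lintegral_of_nonneg_ae h0' hf.aestronglyMeasurable, h, ENNReal.toReal_ofReal hc]

theorem lintegral_Ioi_ofReal_of_integral_ne_zero {f : ℝ → ℝ} (h0 : ∀ u ∈ Ioi (0 : ℝ), 0 ≤ f u)
    (h : ∫ u in Ioi 0, f u ≠ 0) :
    ∫⁻ u in Ioi 0, ENNReal.ofReal (f u) = ENNReal.ofReal (∫ u in Ioi 0, f u) := by
  refine (ofReal_integral_eq_lintegral_ofReal (not_imp_comm.1 integral_undef h) ?_).symm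
  filter_upwards [ae_restrict_mem measurableSet_Ioi] with u hu using h0 u hu

/-- Write (u^r + e)⁻¹ as ∫_0^∞ exp(-(u^r+e)s) ds and exchange by Tonelli. Two Gamma integrals
remain, and Γ(1/r) Γ(1 - 1/r) is the reflection formula. Nonnegative integrals give integrability
together with the value. -/
theorem integral_Ioi_inv_rpow_add {r e : ℝ} (hr : 1 < r) (he : 0 < e) :
    IntegrableOn (fun u : ℝ => (u ^ r + e)⁻¹) (Ioi 0) ∧
    ∫ u in Ioi (0 : ℝ), (u ^ r + e)⁻¹ =
      Real.pi / (r * Real.sin (Real.pi / r)) * (1 / e ^ ((r - 1) / r)) := by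
  have hr0 : 0 < r := by linarith
  have hri : r⁻¹ < 1 := inv_lt_one_of_one_lt₀ hr
  have hsin : 0 < Real.sin (Real.pi / r) :=
    Real.sin_pos_of_pos_of_lt_pi (by positivity) (div_lt_self Real.pi_pos hr)
  refine setIntegral_Ioi_eq_of_lintegral (by fun_prop) (fun u (hu : 0 < u) => by positivity)
    (by positivity) ?_
  have step1 : ∀ u ∈ Ioi (0 : ℝ), ENNReal.ofReal ((u ^ r + e)⁻¹) =
      ∫⁻ s in Ioi (0 : ℝ), ENNReal.ofReal (Real.exp (-(u ^ r + e) * s)) := by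
    intro u (hu : 0 < u)
    have hpos : 0 < u ^ r + e := by positivity
    have hi := integral_exp_mul_Ioi (a := -(u ^ r + e)) (by linarith) 0
    rw [mul_zero, Real.exp_zero] at hi
    rw [lintegral_Ioi_ofReal_of_integral_ne_zero (fun _ _ => by positivity)]
    · rw [hi]; congr 1; field_simp
    · rw [hi]; exact (div_pos_of_neg_of_neg (by norm_num) (by linarith)).ne'
  have step2 : ∀ s ∈ Ioi (0 : ℝ), ∫⁻ u in Ioi (0 : ℝ), ENNReal.ofReal (Real.exp (-(u ^ r + e) * s)) =
      ENNReal.ofReal (Real.Gamma (1 / r + 1) * (s ^ ((1 - 1 / r) - 1) * Real.exp (-(e * s)))) := by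
    intro s (hs : 0 < s)
    have hi := integral_exp_neg_mul_rpow hr0 hs
    have hG : 0 < Real.Gamma (1 / r + 1) := Real.Gamma_pos_of_pos (by positivity)
    have h1 : ∀ u : ℝ, ENNReal.ofReal (Real.exp (-(u ^ r + e) * s)) =
        ENNReal.ofReal (Real.exp (-(e * s))) * ENNReal.ofReal (Real.exp (-s * u ^ r)) := by
      intro u
      rw [← ENNReal.ofReal_mul (by positivity), ← Real.exp_add]
      congr 2; ring
    simp_rw [h1]
    rw [lintegral_const_mul' _ _ ENNReal.ofReal_ne_top,
      lintegral_Ioi_ofReal_of_integral_ne_zero (fun _ _ => by positivity), hi,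
      ← ENNReal.ofReal_mul (by positivity)]
    · congr 1
      rw [show (1 - 1 / r) - 1 = -1 / r by ring]; ring
    · rw [hi]; positivity
  have ha : 0 < 1 - 1 / r := by rw [one_div]; linarith
  have hi := Real.integral_rpow_mul_exp_neg_mul_Ioi ha he
  have hG1 : 0 < Real.Gamma (1 / r + 1) := Real.Gamma_pos_of_pos (by positivity)
  have hG2 : 0 < Real.Gamma (1 - 1 / r) := Real.Gamma_pos_of_pos ha
  rw [setLIntegral_congr_fun measurableSet_Ioi step1, lintegral_lintegral_swap,
    setLIntegral_congr_fun measurableSet_Ioi step2]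
  · have hi' : ∫ s in Ioi (0 : ℝ), Real.Gamma (1 / r + 1) * (s ^ ((1 - 1 / r) - 1) * Real.exp (-(e * s))) =
        Real.pi / (r * Real.sin (Real.pi / r)) * (1 / e ^ ((r - 1) / r)) := by
      rw [integral_const_mul, hi, Real.Gamma_add_one (by positivity)]
      have hrefl := Real.Gamma_mul_Gamma_one_sub (1 / r)
      rw [show (1 / e) ^ (1 - 1 / r) = 1 / e ^ ((r - 1) / r) by
        rw [Real.div_rpow zero_le_one he.le, Real.one_rpow]; congr 2; field_simp]
      rw [show Real.pi * (1 / r) = Real.pi / r by ring] at hrefl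
      calc _ = 1 / r * (Real.Gamma (1 / r) * Real.Gamma (1 - 1 / r)) * (1 / e ^ ((r - 1) / r)) := by ring
        _ = _ := by rw [hrefl]; field_simp
    rw [lintegral_Ioi_ofReal_of_integral_ne_zero, hi']
    · intro s (hs : 0 < s); positivity
    · rw [hi']; positivity
  · fun_prop

theorem intervalIntegrable_inv_rpow_add {r e : ℝ} (hr : 1 ≤ r) (he : 0 < e) (a b : ℝ) :
    IntervalIntegrable (fun u : ℝ => (|u| ^ r + e)⁻¹) volume a b := by
  apply Continuous.intervalIntegrable
  have h1 : Continuous fun u : ℝ => |u| ^ r := continuous_abs.rpow_const fun _ => Or.inr (by linarith)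
  exact (h1.add continuous_const).inv₀ fun u => (by positivity : 0 < |u| ^ r + e).ne'

namespace KineticSymbol

variable {n : ℕ} (K : KineticSymbol n)

/-- For r > 1, f(e)/2 is the integral over the whole half-line, and the part beyond 1 is at most
∫_1^∞ u^(-r) du = 1/(r-1). For r = 1 the half-line integral diverges, but the logarithm is exactly
the integral over [0,1]. -/
theorem exists_abs_f_sub_le : ∃ C, 0 ≤ C ∧ ∀ e > 0,
    |K.f e / 2 - ∫ u in (0 : ℝ)..1, (|u| ^ K.r + e)⁻¹| ≤ C := by
  rcases K.one_le_r.eq_or_lt with hr | hr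
  · refine ⟨0, le_rfl, fun e he => ?_⟩
    have h1 : ∫ u in (0 : ℝ)..1, (|u| ^ K.r + e)⁻¹ = ∫ u in (0 : ℝ)..1, (u + e)⁻¹ := by
      refine intervalIntegral.integral_congr fun u hu => ?_
      rw [uIcc_of_le zero_le_one] at hu
      simp only [← hr, Real.rpow_one, abs_of_nonneg hu.1]
    rw [h1, intervalIntegral.integral_comp_add_right (fun u => u⁻¹), integral_inv_of_pos (by linarith) (by linarith)]
    rw [f, if_pos hr.symm, show (1 + e) / (0 + e) = 1 + 1 / e by field_simp; ring]
    simp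
  · refine ⟨1 / (K.r - 1), by have := sub_pos.2 hr; positivity, fun e he => ?_⟩
    obtain ⟨hint, hval⟩ := integral_Ioi_inv_rpow_add hr he
    have hf : K.f e / 2 = ∫ u in Ioi (0 : ℝ), (u ^ K.r + e)⁻¹ := by
      rw [hval, f, if_neg hr.ne']; ring
    have h1 : ∫ u in (0 : ℝ)..1, (|u| ^ K.r + e)⁻¹ = ∫ u in Ioc (0 : ℝ) 1, (u ^ K.r + e)⁻¹ := by
      rw [intervalIntegral.integral_of_le zero_le_one]
      refine setIntegral_congr_fun measurableSet_Ioc fun u hu => ?_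
      simp only [abs_of_pos hu.1]
    have h2 : ∫ u in Ioi (0 : ℝ), (u ^ K.r + e)⁻¹ =
        (∫ u in Ioc (0 : ℝ) 1, (u ^ K.r + e)⁻¹) + ∫ u in Ioi (1 : ℝ), (u ^ K.r + e)⁻¹ := by
      rw [← Ioc_union_Ioi_eq_Ioi (zero_le_one' ℝ)] at hint ⊢
      exact setIntegral_union (Ioc_disjoint_Ioi le_rfl) measurableSet_Ioi hint.left_of_union hint.right_of_union
    rw [hf, h1, h2, add_sub_cancel_left]
    have hpos : ∀ u ∈ Ioi (1 : ℝ), (0 : ℝ) ≤ (u ^ K.r + e)⁻¹ := fun u (hu : 1 < u) => by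
      have : 0 < u := by linarith
      positivity
    rw [abs_of_nonneg (setIntegral_nonneg measurableSet_Ioi hpos)]
    have h3 := integral_Ioi_rpow_of_lt (a := -K.r) (by linarith) one_pos
    have h4 : ∫ u in Ioi (1 : ℝ), (u ^ K.r + e)⁻¹ ≤ ∫ u in Ioi (1 : ℝ), u ^ (-K.r) := by
      refine setIntegral_mono_on (hint.mono_set (Ioi_subset_Ioi zero_le_one))
        (integrableOn_Ioi_rpow_of_lt (by linarith) one_pos) measurableSet_Ioi fun u (hu : 1 < u) => ?_
      have : 0 < u := by linarith
      rw [Real.rpow_neg this.le]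
      gcongr
      linarith
    rw [h3, Real.one_rpow] at h4
    refine h4.trans_eq ?_
    rw [neg_div, ← div_neg]; congr 1; ring

theorem one_le_g {e : ℝ} (he : 0 < e) : 1 ≤ K.g e := by
  unfold g
  split_ifs
  · exact le_rfl
  · have := Real.log_nonneg (x := 1 + 1 / e) (by have : 0 < 1 / e := by positivity
                                                 linarith)
    linarith
  · have := Real.rpow_pos_of_pos he (2 - K.r)
    linarith

theorem setIntegral_div_rpow_add_eq (e : ℝ) :
    ∫ u in (0 : ℝ)..1, u * (|u| ^ K.r + e)⁻¹ = ∫ u in Ioc (0 : ℝ) 1, u * (u ^ K.r + e)⁻¹ := by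
  rw [intervalIntegral.integral_of_le zero_le_one]
  refine setIntegral_congr_fun measurableSet_Ioc fun u hu => ?_
  simp only [abs_of_pos hu.1]

theorem mul_inv_rpow_add_le {e u r : ℝ} (he : 0 < e) (hu : 0 < u) :
    u * (u ^ r + e)⁻¹ ≤ u ^ (1 - r) := by
  rw [Real.rpow_sub hu, Real.rpow_one, div_eq_mul_inv]
  gcongr
  linarith

/-- For r < 2 the majorant u^(1-r) is integrable at 0. For r ≥ 2 and e < 1 the interval is cut at u
= e: below, the integrand is at most u/e; above, it is at most u^(1-r). This cut is cruder than the
natural scale e^(1/r) but already gives the growth allowed by g. -/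
theorem exists_integral_le_g : ∃ C, 0 ≤ C ∧ ∀ e > 0,
    ∫ u in (0 : ℝ)..1, u * (|u| ^ K.r + e)⁻¹ ≤ C * K.g e := by
  have hr1 := K.one_le_r
  have hii : ∀ e > 0, ∀ a b, IntervalIntegrable (fun u : ℝ => u * (|u| ^ K.r + e)⁻¹) volume a b :=
    fun e he a b => (intervalIntegrable_inv_rpow_add K.one_le_r he a b).continuousOn_mul continuousOn_id
  have hbound : ∀ e > 0, ∀ a b, 0 < a → a ≤ b →
      ∫ u in a..b, u * (|u| ^ K.r + e)⁻¹ ≤ ∫ u in a..b, u ^ (1 - K.r) := by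
    intro e he a b ha hab
    refine intervalIntegral.integral_mono_on hab (hii e he a b)
      (intervalIntegral.intervalIntegrable_rpow (Or.inr ?_)) fun u hu => ?_
    · rw [uIcc_of_le hab]; exact fun h => absurd h.1 (not_le.2 ha)
    · have : 0 < u := ha.trans_le hu.1
      rw [abs_of_pos this]
      exact mul_inv_rpow_add_le he this
  have hsmall : ∀ e > 0, ∀ b, 0 ≤ b → ∫ u in (0 : ℝ)..b, u * (|u| ^ K.r + e)⁻¹ ≤ b * (b / e) := by
    intro e he b hb
    have := intervalIntegral.integral_mono_on (μ := volume) hb (hii e he 0 b)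
      (intervalIntegrable_const (c := b / e)) fun u hu => by
        rw [div_eq_mul_inv]
        have : 0 ≤ |u| ^ K.r := by positivity
        gcongr
        · exact hu.2
        · linarith
    rwa [intervalIntegral.integral_const, sub_zero, smul_eq_mul] at this
  have hbig : ∀ e, 1 ≤ e → ∫ u in (0 : ℝ)..1, u * (|u| ^ K.r + e)⁻¹ ≤ 1 := by
    intro e he
    refine (hsmall e (by linarith) 1 zero_le_one).trans ?_
    rw [one_mul]
    exact div_le_one_of_le₀ he (by linarith)
  rcases lt_trichotomy K.r 2 with hr | hr | hr
  · refine ⟨1 / (2 - K.r), by have := sub_pos.2 hr; positivity, fun e he => ?_⟩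
    rw [setIntegral_div_rpow_add_eq, g, if_pos hr, mul_one]
    have h1 : IntegrableOn (fun u : ℝ => u ^ (1 - K.r)) (Ioc 0 1) :=
      (intervalIntegrable_iff_integrableOn_Ioc_of_le zero_le_one).1
        (intervalIntegral.intervalIntegrable_rpow' (by linarith))
    have h2 : IntegrableOn (fun u : ℝ => u * (u ^ K.r + e)⁻¹) (Ioc 0 1) := by
      refine ((intervalIntegrable_iff_integrableOn_Ioc_of_le zero_le_one).1 (hii e he 0 1)).congr_fun
        (fun u hu => ?_) measurableSet_Ioc
      simp only [abs_of_pos hu.1]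
    refine (setIntegral_mono_on h2 h1 measurableSet_Ioc fun u hu => mul_inv_rpow_add_le he hu.1).trans ?_
    rw [← intervalIntegral.integral_of_le zero_le_one, integral_rpow (Or.inl (by linarith)),
      Real.one_rpow, Real.zero_rpow (by linarith)]
    rw [show 1 - K.r + 1 = 2 - K.r by ring]; simp
  · refine ⟨2, by norm_num, fun e he => ?_⟩
    have hg := K.one_le_g he
    rcases le_or_gt 1 e with h1 | h1
    · linarith [hbig e h1]
    · have h2 : ∫ u in (0 : ℝ)..1, u * (|u| ^ K.r + e)⁻¹ ≤ e * (e / e) + ∫ u in e..1, u ^ (1 - K.r) := by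
        rw [← intervalIntegral.integral_add_adjacent_intervals (hii e he 0 e) (hii e he e 1)]
        exact add_le_add (hsmall e he e he.le) (hbound e he e 1 he h1.le)
      have h3 : ∫ u in e..1, u ^ (1 - K.r) = Real.log (1 / e) := by
        rw [hr, ← integral_inv_of_pos he one_pos]
        refine intervalIntegral.integral_congr fun u hu => ?_
        rw [show (1 - 2 : ℝ) = -1 by norm_num, Real.rpow_neg_one]
      rw [h3, div_self he.ne', mul_one] at h2
      have h4 : Real.log (1 / e) ≤ Real.log (1 + 1 / e) := Real.log_le_log (by positivity) (by linarith)
      rw [g, if_neg (by linarith), if_pos hr] at hg ⊢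
      linarith
  · refine ⟨1 + 1 / (K.r - 2), by have := sub_pos.2 hr; positivity, fun e he => ?_⟩
    have hg := K.one_le_g he
    have hr2 := sub_pos.2 hr
    have hr2' : 0 < 1 / (K.r - 2) := by positivity
    rcases le_or_gt 1 e with h1 | h1
    · have := hbig e h1
      nlinarith
    · have h2 : ∫ u in (0 : ℝ)..1, u * (|u| ^ K.r + e)⁻¹ ≤ e * (e / e) + ∫ u in e..1, u ^ (1 - K.r) := by
        rw [← intervalIntegral.integral_add_adjacent_intervals (hii e he 0 e) (hii e he e 1)]
        exact add_le_add (hsmall e he e he.le) (hbound e he e 1 he h1.le)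
      have h3 : ∫ u in e..1, u ^ (1 - K.r) ≤ 1 / (K.r - 2) * e ^ (2 - K.r) := by
        rw [integral_rpow (Or.inr ⟨by linarith, by
          rw [uIcc_of_le h1.le]; exact fun h => absurd h.1 (not_le.2 he)⟩), Real.one_rpow,
          show 1 - K.r + 1 = 2 - K.r by ring, div_eq_mul_one_div, mul_comm,
          show (2 - K.r) = -(K.r - 2) by ring, one_div_neg_eq_neg_one_div]
        nlinarith [Real.rpow_pos_of_pos he (-(K.r - 2))]
      rw [div_self he.ne', mul_one] at h2
      rw [g, if_neg (by linarith), if_neg (by linarith)] at hg ⊢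
      have := Real.rpow_pos_of_pos he (2 - K.r)
      nlinarith

end KineticSymbol

/-! ### Transverse fields and integration by parts -/

open scoped Manifold in
theorem exists_contDiff_cutoff {E : Type*} [NormedAddCommGroup E] [NormedSpace ℝ E]
    [FiniteDimensional ℝ E] {C U : Set E} (hC : IsCompact C) (hU : IsOpen U)
    (hCU : C ⊆ U) : ∃ χ : E → ℝ, ContDiff ℝ 1 χ ∧ HasCompactSupport χ ∧ tsupport χ ⊆ U ∧
      (∀ᶠ p in 𝓝ˢ C, χ p = 1) ∧ ∀ p, χ p ∈ Icc (0 : ℝ) 1 := by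
  have := FiniteDimensional.proper_real E
  obtain ⟨V, hV, hCV, hVU, hVc⟩ := exists_open_between_and_isCompact_closure hC hU hCU
  obtain ⟨f, hf0, hf1, hf⟩ := exists_contMDiffMap_zero_one_nhds_of_isClosed (n := 1) 𝓘(ℝ, E)
    hV.isClosed_compl hC.isClosed (disjoint_left.2 fun x hx hx' => hx (hCV hx'))
  have hts : tsupport f ⊆ V := by
    intro x hx
    by_contra hxV
    exact (notMem_tsupport_iff_eventuallyEq.2 (hf0.filter_mono (nhds_le_nhdsSet hxV))) hx
  exact ⟨f, f.contMDiff.contDiff, hVc.of_isClosed_subset (isClosed_tsupport _) (hts.trans subset_closure),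
    hts.trans (subset_closure.trans hVU), hf1, hf⟩

theorem contDiff_mul_of_tsupport_subset {n : ℕ} {U : Set (Rn n)} (hU : IsOpen U) {k w : Rn n → ℝ}
    (hk : ContDiffOn ℝ 1 k U) (hw : ContDiff ℝ 1 w) (hs : tsupport w ⊆ U) :
    ContDiff ℝ 1 fun p => k p * w p := by
  refine contDiff_iff_contDiffAt.2 fun p => ?_
  by_cases hp : p ∈ tsupport w
  · exact (hk.contDiffAt (hU.mem_nhds (hs hp))).mul hw.contDiffAt
  · refine (contDiffAt_const (c := (0 : ℝ))).congr_of_eventuallyEq ?_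
    filter_upwards [notMem_tsupport_iff_eventuallyEq.1 hp] with q hq
    rw [hq]; simp

/-- The `i`-th vector of the standard basis. -/
noncomputable abbrev stdVec {n : ℕ} (i : Fin n) : Rn n := EuclideanSpace.single i 1

/-- A `C¹` vector field `a`, supported in the support of `χ`, with `a · ∇P = χ`. -/
structure IsTransverse {n : ℕ} (P χ : Rn n → ℝ) (a : Fin n → Rn n → ℝ) : Prop where
  contDiff : ∀ i, ContDiff ℝ 1 (a i)
  tsupport_subset : ∀ i, tsupport (a i) ⊆ tsupport χ
  sum_eq : ∀ p, ∑ i, a i p * fderiv ℝ P p (stdVec i) = χ p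

/-- The divergence of the vector field `F a`. -/
noncomputable def divMul {n : ℕ} (a : Fin n → Rn n → ℝ) (F : Rn n → ℂ) (p : Rn n) : ℂ :=
  ∑ i, (a i p • fderiv ℝ F p (stdVec i) + fderiv ℝ (a i) p (stdVec i) • F p)

section Transverse

variable {n : ℕ} {P χ : Rn n → ℝ} {U : Set (Rn n)}

/-- The field is χ∇P/|∇P|². It has to be C¹ for its divergence to make sense, and this is where P
must be C² and not only C¹. -/
theorem exists_isTransverse (hU : IsOpen U) (hP : ContDiffOn ℝ 2 P U)
    (hg : ∀ p ∈ U, gradient P p ≠ 0) (hχ : ContDiff ℝ 1 χ) (hs : tsupport χ ⊆ U) :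
    ∃ a, IsTransverse P χ a := by
  have hfd : ContDiffOn ℝ 1 (fderiv ℝ P) U := hP.fderiv_of_isOpen hU (by norm_num)
  have hfi : ∀ i : Fin n, ContDiffOn ℝ 1 (fun p => fderiv ℝ P p (stdVec i)) U := fun i =>
    hfd.clm_apply contDiffOn_const
  have hsum : ∀ p, ∑ i, fderiv ℝ P p (stdVec i) ^ 2 = ‖gradient P p‖ ^ 2 := by
    intro p
    rw [EuclideanSpace.norm_sq_eq]
    refine Finset.sum_congr rfl fun i _ => ?_
    rw [gradient_eq_inner, stdVec, EuclideanSpace.inner_single_right]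
    simp
  have hk : ∀ i : Fin n, ContDiffOn ℝ 1
      (fun p => fderiv ℝ P p (stdVec i) / ∑ j, fderiv ℝ P p (stdVec j) ^ 2) U := fun i =>
    (hfi i).div (ContDiffOn.sum fun j _ => (hfi j).pow 2) fun p hp => by
      rw [hsum]; exact pow_ne_zero 2 (norm_ne_zero_iff.2 (hg p hp))
  refine ⟨fun i p => (fderiv ℝ P p (stdVec i) / ∑ j, fderiv ℝ P p (stdVec j) ^ 2) * χ p,
    fun i => contDiff_mul_of_tsupport_subset hU (hk i) hχ hs, fun i => tsupport_mul_subset_right, fun p => ?_⟩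
  by_cases hp : p ∈ tsupport χ
  · have h0 : ∑ j, fderiv ℝ P p (stdVec j) ^ 2 ≠ 0 := by
      rw [hsum]; exact pow_ne_zero 2 (norm_ne_zero_iff.2 (hg p (hs hp)))
    have h1 : ∀ i : Fin n, fderiv ℝ P p (stdVec i) / (∑ j, fderiv ℝ P p (stdVec j) ^ 2) * χ p *
        fderiv ℝ P p (stdVec i) = fderiv ℝ P p (stdVec i) ^ 2 * (χ p / ∑ j, fderiv ℝ P p (stdVec j) ^ 2) := by
      intro i; ring
    simp_rw [h1]
    rw [← Finset.sum_mul, mul_div_cancel₀ _ h0]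
  · simp [image_eq_zero_of_notMem_tsupport hp]

variable {a : Fin n → Rn n → ℝ}

theorem IsTransverse.continuous_divMul (ha : IsTransverse P χ a) {F : Rn n → ℂ} (hF : ContDiff ℝ 1 F) :
    Continuous (divMul a F) := by
  have h1 := hF.continuous_fderiv one_ne_zero
  have h2 := fun i => (ha.contDiff i).continuous_fderiv one_ne_zero
  have h3 := fun i => (ha.contDiff i).continuous
  have h4 := hF.continuous
  unfold divMul
  fun_prop

theorem IsTransverse.divMul_eq_zero (ha : IsTransverse P χ a) (F : Rn n → ℂ) {p : Rn n}
    (hp : p ∉ tsupport χ) : divMul a F p = 0 := by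
  refine Finset.sum_eq_zero fun i _ => ?_
  have h1 : p ∉ tsupport (a i) := fun h => hp (ha.tsupport_subset i h)
  have h2 : fderiv ℝ (a i) p = 0 := image_eq_zero_of_notMem_tsupport fun h =>
    h1 (tsupport_fderiv_subset ℝ h)
  rw [h2, image_eq_zero_of_notMem_tsupport h1]
  simp

theorem IsTransverse.exists_norm_divMul_le (ha : IsTransverse P χ a) (hc : HasCompactSupport χ) :
    ∃ C, 0 ≤ C ∧ ∀ (F : Rn n → ℂ) (A : ℝ), (∀ p ∈ tsupport χ, ‖F p‖ ≤ A ∧ ‖fderiv ℝ F p‖ ≤ A) →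
      ∀ p ∈ tsupport χ, ‖divMul a F p‖ ≤ C * A := by
  have h1 : ∀ i, ∃ C, ∀ p ∈ tsupport χ, ‖a i p‖ ≤ C := fun i =>
    hc.isCompact.exists_bound_of_continuousOn (ha.contDiff i).continuous.continuousOn
  have h2 : ∀ i, ∃ C, ∀ p ∈ tsupport χ, ‖fderiv ℝ (a i) p‖ ≤ C := fun i =>
    hc.isCompact.exists_bound_of_continuousOn ((ha.contDiff i).continuous_fderiv one_ne_zero).continuousOn
  choose C1 hC1 using h1
  choose C2 hC2 using h2
  refine ⟨∑ i, (|C1 i| + |C2 i|), by positivity, fun F A hA p hp => ?_⟩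
  have hA0 : 0 ≤ A := (norm_nonneg _).trans (hA p hp).1
  rw [Finset.sum_mul]
  refine (norm_sum_le _ _).trans (Finset.sum_le_sum fun i _ => ?_)
  have he : ‖stdVec i‖ = 1 := by simp
  have k1 : ‖fderiv ℝ F p (stdVec i)‖ ≤ A := by
    have := (fderiv ℝ F p).le_opNorm (stdVec i)
    rw [he, mul_one] at this
    exact this.trans (hA p hp).2
  have k2 : ‖fderiv ℝ (a i) p (stdVec i)‖ ≤ |C2 i| := by
    have := (fderiv ℝ (a i) p).le_opNorm (stdVec i)
    rw [he, mul_one] at this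
    exact this.trans ((hC2 i p hp).trans (le_abs_self _))
  refine (norm_add_le _ _).trans ?_
  rw [norm_smul, norm_smul, add_mul]
  have k3 := (hC1 i p hp).trans (le_abs_self _)
  gcongr
  exact (hA p hp).1

theorem IsTransverse.hasCompactSupport (ha : IsTransverse P χ a) (hc : HasCompactSupport χ) (i : Fin n) :
    HasCompactSupport (a i) :=
  hc.isCompact.of_isClosed_subset (isClosed_tsupport _) (ha.tsupport_subset i)

/-- Integration by parts along a transverse field. -/
theorem IsTransverse.integral_deriv_comp_smul (ha : IsTransverse P χ a) (hU : IsOpen U)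
    (hP : ContDiffOn ℝ 1 P U) (hc : HasCompactSupport χ) (hs : tsupport χ ⊆ U)
    {φ : ℝ → ℝ} (hφ : ContDiff ℝ 1 φ) {F : Rn n → ℂ} (hF : ContDiff ℝ 1 F) :
    ∫ p, (deriv φ (P p) * χ p) • F p = - ∫ p, φ (P p) • divMul a F p := by
  have hcs := ha.hasCompactSupport hc
  have hasU : ∀ i, tsupport (a i) ⊆ U := fun i => (ha.tsupport_subset i).trans hs
  have hφP : ContDiffOn ℝ 1 (fun p => φ (P p)) U := hφ.comp_contDiffOn hP
  have hf : ∀ i, ContDiff ℝ 1 fun p => φ (P p) * a i p := fun i =>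
    contDiff_mul_of_tsupport_subset hU hφP (ha.contDiff i) (hasU i)
  -- The products φ(P)aᵢ are C¹ on all of ℝⁿ with compact support, although P is C¹ on U only; no
  -- boundary term arises.
  have hfc : ∀ i, HasCompactSupport fun p => φ (P p) * a i p := fun i => (hcs i).mul_left
  have hfd : ∀ i p, fderiv ℝ (fun p => φ (P p) * a i p) p (stdVec i) =
      deriv φ (P p) * (a i p * fderiv ℝ P p (stdVec i)) + φ (P p) * fderiv ℝ (a i) p (stdVec i) := by
    intro i p
    by_cases hp : p ∈ tsupport (a i)
    · have h1 : HasFDerivAt P (fderiv ℝ P p) p :=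
        ((hP.contDiffAt (hU.mem_nhds (hasU i hp))).differentiableAt one_ne_zero).hasFDerivAt
      have h2 := ((hφ.differentiable one_ne_zero) (P p)).hasDerivAt.comp_hasFDerivAt p h1
      have h3 := h2.mul (((ha.contDiff i).differentiable one_ne_zero) p).hasFDerivAt
      change fderiv ℝ ((φ ∘ P) * a i) p (stdVec i) = _
      rw [h3.fderiv]
      simp only [add_apply, smul_apply, smul_eq_mul, Function.comp]
      ring
    · have h1 : p ∉ tsupport fun p => φ (P p) * a i p := fun h => hp (tsupport_mul_subset_right h)
      have h2 : fderiv ℝ (a i) p = 0 := image_eq_zero_of_notMem_tsupport fun h =>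
        hp (tsupport_fderiv_subset ℝ h)
      have h3 : fderiv ℝ (fun p => φ (P p) * a i p) p = 0 := image_eq_zero_of_notMem_tsupport fun h =>
        h1 (tsupport_fderiv_subset ℝ h)
      rw [h2, h3, image_eq_zero_of_notMem_tsupport hp]
      simp
  have hcd : ∀ i, Continuous fun p => fderiv ℝ (fun p => φ (P p) * a i p) p (stdVec i) := fun i =>
    ((hf i).continuous_fderiv one_ne_zero).clm_apply continuous_const
  have hFd : ∀ i : Fin n, Continuous fun p => fderiv ℝ F p (stdVec i) := fun i =>
    (hF.continuous_fderiv one_ne_zero).clm_apply continuous_const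
  have I1 : ∀ i, Integrable fun p => fderiv ℝ (fun p => φ (P p) * a i p) p (stdVec i) • F p := fun i =>
    ((hcd i).smul hF.continuous).integrable_of_hasCompactSupport ((hfc i).fderiv_apply ℝ _).smul_right
  have I2 : ∀ i, Integrable fun p => (φ (P p) * a i p) • fderiv ℝ F p (stdVec i) := fun i =>
    ((hf i).continuous.smul (hFd i)).integrable_of_hasCompactSupport (hfc i).smul_right
  have I3 : ∀ i, Integrable fun p => (φ (P p) * a i p) • F p := fun i =>
    ((hf i).continuous.smul hF.continuous).integrable_of_hasCompactSupport (hfc i).smul_right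
  have hibp : ∀ i, ∫ p, ((φ (P p) * a i p) • fderiv ℝ F p (stdVec i) +
      fderiv ℝ (fun p => φ (P p) * a i p) p (stdVec i) • F p) = 0 := by
    intro i
    rw [integral_add (I2 i) (I1 i), integral_smul_fderiv_eq_neg_fderiv_smul_of_integrable (I1 i) (I2 i) (I3 i)
      (fun p _ => (hf i).differentiable one_ne_zero p) (fun p _ => hF.differentiable one_ne_zero p)]
    simp
  have I12 : ∀ i, Integrable fun p => (φ (P p) * a i p) • fderiv ℝ F p (stdVec i) +
      fderiv ℝ (fun p => φ (P p) * a i p) p (stdVec i) • F p := fun i => (I2 i).add (I1 i)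
  have hsum : ∀ p, (∑ i, ((φ (P p) * a i p) • fderiv ℝ F p (stdVec i) +
      fderiv ℝ (fun p => φ (P p) * a i p) p (stdVec i) • F p)) =
      (deriv φ (P p) * χ p) • F p + φ (P p) • divMul a F p := by
    intro p
    simp_rw [hfd]
    rw [← ha.sum_eq p, divMul, Finset.mul_sum, Finset.sum_smul, Finset.smul_sum, ← Finset.sum_add_distrib]
    refine Finset.sum_congr rfl fun i _ => ?_
    rw [smul_add, smul_smul, smul_smul, add_smul]
    abel
  have htot : ∫ p, ((deriv φ (P p) * χ p) • F p + φ (P p) • divMul a F p) = 0 := by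
    simp_rw [← hsum]
    rw [integral_finsetSum _ fun i _ => I12 i]
    exact Finset.sum_eq_zero fun i _ => hibp i
  have hint2 : Integrable fun p => φ (P p) • divMul a F p := by
    have : Continuous fun p => φ (P p) • divMul a F p := by
      refine ContinuousOn.continuous_of_tsupport_subset
        (hφP.continuousOn.smul (ha.continuous_divMul hF).continuousOn) hU ?_
      refine (closure_minimal ?_ (isClosed_tsupport χ)).trans hs
      intro p hp
      by_contra h
      exact hp (by simp [ha.divMul_eq_zero F h])
    refine this.integrable_of_hasCompactSupport (HasCompactSupport.intro hc.isCompact fun p hp => ?_)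
    rw [ha.divMul_eq_zero F hp, smul_zero]
  -- Integrability of the left side follows from the pointwise divergence identity by subtraction.
  have hint1 : Integrable fun p => (deriv φ (P p) * χ p) • F p := by
    have h := (integrable_finsetSum (Finset.univ) fun i _ => I12 i).sub hint2
    refine h.congr (Eventually.of_forall fun p => ?_)
    have := hsum p
    simp only [Pi.sub_apply] at this ⊢
    rw [this]; abel
  rw [integral_add hint1 hint2] at htot
  exact eq_neg_of_add_eq_zero_left htot

end Transverse

/-! ### Volume of sublevel sets and the surface integral over S -/

namespace KineticSymbol

variable {n : ℕ} (K : KineticSymbol n)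

/-- A `C¹` cutoff function around the minimum set `S`. -/
structure IsCutoff (χ : Rn n → ℝ) : Prop where
  contDiff : ContDiff ℝ 1 χ
  hasCompactSupport : HasCompactSupport χ
  tsupport_subset : tsupport χ ⊆ interior K.Ω
  eventually_eq_one : ∀ᶠ p in 𝓝ˢ K.S, χ p = 1
  mem_Icc : ∀ p, χ p ∈ Icc (0 : ℝ) 1

theorem r_pos : 0 < K.r := zero_lt_one.trans_le K.one_le_r

theorem S_eq : K.S = {p | K.P p = 0} := by
  ext p
  simp [S, T, Real.rpow_eq_zero (abs_nonneg _) K.r_pos.ne']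

theorem measurableSet_S : MeasurableSet K.S := by
  rw [S_eq]; exact K.measurable_P (measurableSet_singleton 0)

theorem S_subset_interior : K.S ⊆ interior K.Ω := fun p hp =>
  mem_interior.2 ⟨_, K.ball_subset_Ω p hp, Metric.isOpen_ball, Metric.mem_ball_self K.σ_pos⟩

theorem isCompact_S : IsCompact K.S := by
  have : K.S = K.Ω ∩ K.P ⁻¹' {0} := by
    ext p
    constructor
    · intro hp
      exact ⟨interior_subset (K.S_subset_interior hp), by rw [S_eq] at hp; exact hp⟩
    · intro hp
      rw [S_eq]; exact hp.2
  rw [this]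
  exact K.isCompact_Ω.of_isClosed_subset
    (K.continuousOn_P.preimage_isClosed_of_isClosed K.isCompact_Ω.isClosed isClosed_singleton)
    inter_subset_left

theorem contDiffOn_one : ContDiffOn ℝ 1 K.P (interior K.Ω) := K.contDiffOn_P.of_le one_le_two

theorem exists_isCutoff : ∃ χ, K.IsCutoff χ := by
  obtain ⟨χ, h1, h2, h3, h4, h5⟩ := exists_contDiff_cutoff K.isCompact_S isOpen_interior K.S_subset_interior
  exact ⟨χ, h1, h2, h3, h4, h5⟩

variable {K} {χ : Rn n → ℝ}

theorem IsCutoff.eq_one (hχ : K.IsCutoff χ) {p : Rn n} (hp : p ∈ K.S) : χ p = 1 :=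
  hχ.eventually_eq_one.self_of_nhdsSet p hp

theorem IsCutoff.exists_isTransverse (hχ : K.IsCutoff χ) : ∃ a, IsTransverse K.P χ a :=
  _root_.exists_isTransverse isOpen_interior K.contDiffOn_P K.gradient_ne_zero hχ.contDiff hχ.tsupport_subset

/-- The function φ(s) = τ arctan(s/τ) is bounded by πτ/2, while φ' ≥ 1/2 where |s| ≤ τ. Integration
by parts with F = 1 therefore bounds half the volume by a constant times τ. -/
theorem exists_measure_sublevel_le {C : Set (Rn n)} (hC : IsCompact C) (hCΩ : C ⊆ interior K.Ω) :
    ∃ B, 0 ≤ B ∧ ∀ τ > 0, volume.real (C ∩ {p | |K.P p| < τ}) ≤ B * τ := by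
  obtain ⟨χ, h1, h2, h3, h4, h5⟩ := exists_contDiff_cutoff hC isOpen_interior hCΩ
  obtain ⟨a, ha⟩ := exists_isTransverse isOpen_interior K.contDiffOn_P K.gradient_ne_zero h1 h3
  have hDc := ha.continuous_divMul (F := fun _ => 1) contDiff_const
  have hDi : Integrable (divMul a fun _ => 1) := hDc.integrable_of_hasCompactSupport
    (HasCompactSupport.intro h2.isCompact fun p hp => ha.divMul_eq_zero _ hp)
  refine ⟨Real.pi * ∫ p, ‖divMul a (fun _ => 1) p‖, by positivity, fun τ hτ => ?_⟩
  have hφ : ContDiff ℝ 1 fun s : ℝ => τ * Real.arctan (s / τ) :=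
    contDiff_const.mul (Real.contDiff_arctan.comp (contDiff_id.div_const τ))
  have hd : ∀ s, deriv (fun s : ℝ => τ * Real.arctan (s / τ)) s = (1 + (s / τ) ^ 2)⁻¹ := by
    intro s
    have := ((Real.hasDerivAt_arctan (s / τ)).comp s ((hasDerivAt_id s).div_const τ)).const_mul τ
    refine this.deriv.trans ?_
    field_simp
  have hibp := ha.integral_deriv_comp_smul isOpen_interior K.contDiffOn_one h2 h3 hφ
    (F := fun _ => 1) contDiff_const
  have hu : ‖∫ p, (τ * Real.arctan (K.P p / τ)) • divMul a (fun _ => 1) p‖ ≤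
      (τ * (Real.pi / 2)) * ∫ p, ‖divMul a (fun _ => 1) p‖ := by
    rw [← integral_const_mul]
    refine norm_integral_le_of_norm_le (hDi.norm.const_mul _) (Eventually.of_forall fun p => ?_)
    rw [norm_smul, norm_mul, Real.norm_of_nonneg hτ.le, Real.norm_eq_abs]
    have := abs_le.2 ⟨(Real.neg_pi_div_two_lt_arctan (K.P p / τ)).le, (Real.arctan_lt_pi_div_two (K.P p / τ)).le⟩
    gcongr
  have hl : (∫ p, (deriv (fun s : ℝ => τ * Real.arctan (s / τ)) (K.P p) * χ p) • (1 : ℂ)) =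
      ((∫ p, (1 + (K.P p / τ) ^ 2)⁻¹ * χ p : ℝ) : ℂ) := by
    rw [← integral_complex_ofReal]
    congr 1
    ext p
    rw [hd]
    simp
  rw [hl] at hibp
  have hint : Integrable fun p => (1 + (K.P p / τ) ^ 2)⁻¹ * χ p := by
    refine (continuous_mul_of_tsupport_subset isOpen_interior ?_ h1.continuous h3).integrable_of_hasCompactSupport
      h2.mul_left
    refine ContinuousOn.inv₀ ?_ fun p _ => by positivity
    exact continuousOn_const.add ((K.contDiffOn_one.continuousOn.div_const τ).pow 2)
  have h0 : ∀ p, 0 ≤ (1 + (K.P p / τ) ^ 2)⁻¹ * χ p := fun p => mul_nonneg (by positivity) (h5 p).1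
  have hm : MeasurableSet (C ∩ {p | |K.P p| < τ}) :=
    hC.measurableSet.inter (measurableSet_lt K.measurable_P.abs measurable_const)
  have hfin : volume (C ∩ {p | |K.P p| < τ}) ≠ ∞ :=
    ((measure_mono inter_subset_left).trans_lt hC.measure_lt_top).ne
  have hlow : (1 / 2) * volume.real (C ∩ {p | |K.P p| < τ}) ≤ ∫ p, (1 + (K.P p / τ) ^ 2)⁻¹ * χ p := by
    calc (1 / 2) * volume.real (C ∩ {p | |K.P p| < τ})
        = ∫ p in C ∩ {p | |K.P p| < τ}, (1 / 2 : ℝ) := by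
          rw [setIntegral_const, smul_eq_mul, mul_comm]
      _ ≤ ∫ p in C ∩ {p | |K.P p| < τ}, (1 + (K.P p / τ) ^ 2)⁻¹ * χ p := by
          refine setIntegral_mono_on (integrableOn_const hfin) hint.integrableOn hm fun p hp => ?_
          rw [h4.self_of_nhdsSet p hp.1, mul_one, one_div]
          have h6 : |K.P p / τ| ≤ 1 := by
            rw [abs_div, abs_of_pos hτ]
            exact div_le_one_of_le₀ (le_of_lt hp.2) hτ.le
          have h7 : (K.P p / τ) ^ 2 ≤ 1 := by rw [← sq_abs]; exact pow_le_one₀ (abs_nonneg _) h6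
          gcongr
          linarith
      _ ≤ _ := setIntegral_le_integral hint (Eventually.of_forall h0)
  have hn : ‖((∫ p, (1 + (K.P p / τ) ^ 2)⁻¹ * χ p : ℝ) : ℂ)‖ = ∫ p, (1 + (K.P p / τ) ^ 2)⁻¹ * χ p := by
    rw [Complex.norm_real, Real.norm_of_nonneg (integral_nonneg h0)]
  rw [← hn, hibp, norm_neg] at hlow
  linarith

/-- Real and imaginary parts of F are treated separately with weight χF; the cutoff disappears in
the limit because χ = 1 on S. -/
theorem IsCutoff.tendsto_integral_smul (hχ : K.IsCutoff χ) {F : Rn n → ℂ} (hF : Continuous F) :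
    Tendsto (fun τ : ℝ => ∫ p, (τ / (τ ^ 2 + K.P p ^ 2) * χ p) • F p) (𝓝[>] 0)
      (𝓝 (Real.pi * ∫ p, (‖gradient K.P p‖⁻¹ : ℝ) • F p ∂K.surface)) := by
  have hre : Continuous fun p => χ p * (F p).re := hχ.contDiff.continuous.mul (Complex.continuous_re.comp hF)
  have him : Continuous fun p => χ p * (F p).im := hχ.contDiff.continuous.mul (Complex.continuous_im.comp hF)
  have hrc : HasCompactSupport fun p => χ p * (F p).re := hχ.hasCompactSupport.mul_right
  have hic : HasCompactSupport fun p => χ p * (F p).im := hχ.hasCompactSupport.mul_right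
  have hrs : tsupport (fun p => χ p * (F p).re) ⊆ interior K.Ω :=
    tsupport_mul_subset_left.trans hχ.tsupport_subset
  have his : tsupport (fun p => χ p * (F p).im) ⊆ interior K.Ω :=
    tsupport_mul_subset_left.trans hχ.tsupport_subset
  have h1 := tendsto_cauchyMean K.measurable_P isOpen_interior K.contDiffOn_one K.gradient_ne_zero hre hrc hrs
  have h2 := tendsto_cauchyMean K.measurable_P isOpen_interior K.contDiffOn_one K.gradient_ne_zero him hic his
  have i1 := integrableOn_levelSet K.measurable_P isOpen_interior K.contDiffOn_one K.gradient_ne_zero hre hrc hrs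
  have i2 := integrableOn_levelSet K.measurable_P isOpen_interior K.contDiffOn_one K.gradient_ne_zero him hic his
  have h3 := ((Complex.continuous_ofReal.tendsto _).comp h1).add
    (((Complex.continuous_ofReal.tendsto _).comp h2).mul_const Complex.I)
  have key : ∀ c : ℝ, ∀ z : ℂ, c • z = ((c * z.re : ℝ) : ℂ) + ((c * z.im : ℝ) : ℂ) * Complex.I := by
    intro c z
    apply Complex.ext <;> simp
  have hlim : (levelIntegral K.P (fun p => χ p * (F p).re) : ℂ) +
      (levelIntegral K.P (fun p => χ p * (F p).im) : ℂ) * Complex.I =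
      Real.pi * ∫ p, (‖gradient K.P p‖⁻¹ : ℝ) • F p ∂K.surface := by
    simp only [levelIntegral]
    rw [← integral_complex_ofReal, ← integral_complex_ofReal, ← integral_mul_const, ← integral_add i1.ofReal
      (i2.ofReal.mul_const _), ← integral_const_mul, surface, S_eq]
    refine setIntegral_congr_fun (K.measurable_P (measurableSet_singleton 0)) fun p hp => ?_
    have hp1 : χ p = 1 := hχ.eq_one (by rw [S_eq]; exact hp)
    simp only [hp1, one_mul]
    rw [← key, div_eq_mul_inv, mul_smul, Complex.real_smul]
  rw [hlim] at h3
  refine h3.congr' ?_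
  filter_upwards [self_mem_nhdsWithin] with τ (hτ : 0 < τ)
  have j1 := integrable_cauchyMean isOpen_interior K.contDiffOn_one hre hrc hrs hτ
  have j2 := integrable_cauchyMean isOpen_interior K.contDiffOn_one him hic his hτ
  simp only [cauchyMean, Function.comp]
  rw [← integral_complex_ofReal, ← integral_complex_ofReal, ← integral_mul_const, ← integral_add j1.ofReal
      (j2.ofReal.mul_const _)]
  congr 1
  ext p
  rw [key, mul_assoc, mul_assoc]

/-- The Gauss–Green formula for the surface integral over `S`. -/
theorem IsCutoff.surface_integral_eq (hχ : K.IsCutoff χ) {a : Fin n → Rn n → ℝ}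
    (ha : IsTransverse K.P χ a) {F : Rn n → ℂ} (hF : ContDiff ℝ 1 F) :
    ∫ p, (‖gradient K.P p‖⁻¹ : ℝ) • F p ∂K.surface =
      - ∫ p, (SignType.sign (K.P p) / 2 : ℝ) • divMul a F p := by
  have hDc := ha.continuous_divMul hF
  have hDi : Integrable (divMul a F) := hDc.integrable_of_hasCompactSupport
    (HasCompactSupport.intro hχ.hasCompactSupport.isCompact fun p hp => ha.divMul_eq_zero _ hp)
  have h1 := hχ.tendsto_integral_smul hF.continuous
  -- The primitive arctan(s/τ) of the Cauchy kernel stays bounded by π/2 and tends to (π/2) sgn(s),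
  -- with value 0 at s = 0; this is how the sign of P enters.
  have h2 : Tendsto (fun τ : ℝ => - ∫ p, Real.arctan (K.P p / τ) • divMul a F p) (𝓝[>] 0)
      (𝓝 (- ∫ p, (Real.pi / 2 * SignType.sign (K.P p) : ℝ) • divMul a F p)) := by
    refine Tendsto.neg ?_
    refine tendsto_integral_filter_of_dominated_convergence (fun p => Real.pi / 2 * ‖divMul a F p‖)
      (Eventually.of_forall fun τ => ?_) (Eventually.of_forall fun τ => Eventually.of_forall fun p => ?_)
      (hDi.norm.const_mul _) (Eventually.of_forall fun p => ?_)
    · exact (Real.measurable_arctan.comp (K.measurable_P.div_const τ)).aestronglyMeasurable.smul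
        hDc.aestronglyMeasurable
    · rw [norm_smul, Real.norm_eq_abs]
      have := abs_le.2 ⟨(Real.neg_pi_div_two_lt_arctan (K.P p / τ)).le, (Real.arctan_lt_pi_div_two (K.P p / τ)).le⟩
      gcongr
    · refine Tendsto.smul_const ?_ _
      have hinv : Tendsto (fun τ : ℝ => τ⁻¹) (𝓝[>] 0) atTop := tendsto_inv_nhdsGT_zero
      simp only [div_eq_mul_inv]
      rcases lt_trichotomy (K.P p) 0 with h | h | h
      · have := (Real.tendsto_arctan_atBot.mono_right nhdsWithin_le_nhds).comp (hinv.const_mul_atTop_of_neg h)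
        simpa [h, div_eq_mul_inv] using! this
      · simp [h]
      · have := (Real.tendsto_arctan_atTop.mono_right nhdsWithin_le_nhds).comp (hinv.const_mul_atTop h)
        simpa [h, div_eq_mul_inv] using! this
  have h3 : Real.pi * ∫ p, (‖gradient K.P p‖⁻¹ : ℝ) • F p ∂K.surface =
      - ∫ p, (Real.pi / 2 * SignType.sign (K.P p) : ℝ) • divMul a F p := by
    refine tendsto_nhds_unique (h1.congr' ?_) h2
    filter_upwards [self_mem_nhdsWithin] with τ (hτ : 0 < τ)
    have hφ : ContDiff ℝ 1 fun s : ℝ => Real.arctan (s / τ) :=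
      Real.contDiff_arctan.comp (contDiff_id.div_const τ)
    have hd : ∀ s, deriv (fun s : ℝ => Real.arctan (s / τ)) s = τ / (τ ^ 2 + s ^ 2) := by
      intro s
      have := (Real.hasDerivAt_arctan (s / τ)).comp s ((hasDerivAt_id s).div_const τ)
      refine this.deriv.trans ?_
      field_simp
    rw [← ha.integral_deriv_comp_smul isOpen_interior K.contDiffOn_one hχ.hasCompactSupport
      hχ.tsupport_subset hφ hF]
    simp_rw [hd]
  have hpi : (Real.pi : ℂ) ≠ 0 := by exact_mod_cast Real.pi_ne_zero
  have h4 : ∫ p, (Real.pi / 2 * SignType.sign (K.P p) : ℝ) • divMul a F p =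
      Real.pi * ∫ p, (SignType.sign (K.P p) / 2 : ℝ) • divMul a F p := by
    rw [← integral_const_mul]
    congr 1
    ext p
    rw [← Complex.real_smul, smul_smul]
    congr 1
    ring
  rw [h4, ← mul_neg] at h3
  exact mul_left_cancel₀ hpi h3

end KineticSymbol

/-! ### The kernel estimate near S -/

namespace KineticSymbol

variable {n : ℕ} (K : KineticSymbol n)

/-- The primitive `∫₀ᵗ du / (|u|^r + e)`. -/
noncomputable def primitive (e t : ℝ) : ℝ := ∫ u in (0 : ℝ)..t, (|u| ^ K.r + e)⁻¹

theorem continuous_inv_rpow_add {e : ℝ} (he : 0 < e) : Continuous fun u : ℝ => (|u| ^ K.r + e)⁻¹ := by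
  have h1 : Continuous fun u : ℝ => |u| ^ K.r := continuous_abs.rpow_const fun _ => Or.inr K.r_pos.le
  exact (h1.add continuous_const).inv₀ fun u => (by positivity : 0 < |u| ^ K.r + e).ne'

theorem deriv_primitive {e : ℝ} (he : 0 < e) (t : ℝ) : deriv (K.primitive e) t = (|t| ^ K.r + e)⁻¹ :=
  (K.continuous_inv_rpow_add he).deriv_integral _ 0 t

theorem contDiff_primitive {e : ℝ} (he : 0 < e) : ContDiff ℝ 1 (K.primitive e) := by
  refine contDiff_one_iff_deriv.2 ⟨fun t => ?_, ?_⟩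
  · exact (intervalIntegral.integral_hasDerivAt_right ((K.continuous_inv_rpow_add he).intervalIntegrable 0 t)
      (K.continuous_inv_rpow_add he).stronglyMeasurable.stronglyMeasurableAtFilter
      (K.continuous_inv_rpow_add he).continuousAt).differentiableAt
  · rw [funext (K.deriv_primitive he)]; exact K.continuous_inv_rpow_add he

theorem primitive_neg (e t : ℝ) : K.primitive e (-t) = - K.primitive e t := by
  have := intervalIntegral.integral_comp_neg (a := 0) (b := t) fun u : ℝ => (|u| ^ K.r + e)⁻¹
  simp only [abs_neg, neg_zero] at this
  rw [primitive, primitive, this, intervalIntegral.integral_symm]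

/-- The tail `∫ du / (u^r + e)` over `t < u ≤ 1`. -/
noncomputable def tail (e t : ℝ) : ℝ := ∫ u in Ioc (0 : ℝ) 1, (Ioi t).indicator (fun u => (|u| ^ K.r + e)⁻¹) u

theorem tail_nonneg {e : ℝ} (he : 0 < e) (t : ℝ) : 0 ≤ K.tail e t :=
  integral_nonneg fun u => indicator_nonneg (fun u _ => by positivity) u

/-- By oddness take t > 0. If t ≤ 1, the primitive falls short of the integral over [0,1] by exactly
the tail; if t ≥ 1, it exceeds it by at most t - 1, the integrand being at most 1 there. -/
theorem abs_primitive_sub_le {C : ℝ} (hC : ∀ e > 0,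
    |K.f e / 2 - ∫ u in (0 : ℝ)..1, (|u| ^ K.r + e)⁻¹| ≤ C) {e : ℝ} (he : 0 < e) (t : ℝ) :
    |K.primitive e t - K.f e * (SignType.sign t / 2)| ≤
      if t = 0 then 0 else C + |t| + K.tail e |t| := by
  have hi := fun a b => (K.continuous_inv_rpow_add he).intervalIntegrable (μ := volume) a b
  have hpos : ∀ t > 0, |K.primitive e t - K.f e / 2| ≤ C + t + K.tail e t := by
    intro t ht
    have h0 := hC e he
    have htail := K.tail_nonneg he t
    rcases le_total t 1 with h1 | h1
    · have h2 : K.tail e t = ∫ u in t..1, (|u| ^ K.r + e)⁻¹ := by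
        rw [tail, setIntegral_indicator measurableSet_Ioi, intervalIntegral.integral_of_le h1]
        congr 2
        ext u
        simp only [mem_inter_iff, mem_Ioc, mem_Ioi]
        constructor
        · rintro ⟨⟨_, a⟩, b⟩; exact ⟨b, a⟩
        · rintro ⟨a, b⟩; exact ⟨⟨ht.trans a, b⟩, a⟩
      have h3 : K.primitive e t = (∫ u in (0 : ℝ)..1, (|u| ^ K.r + e)⁻¹) - K.tail e t := by
        rw [h2, primitive, ← intervalIntegral.integral_add_adjacent_intervals (hi 0 t) (hi t 1)]
        ring
      rw [h3]
      rw [abs_le] at h0 ⊢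
      constructor <;> linarith
    · have h2 : K.primitive e t = (∫ u in (0 : ℝ)..1, (|u| ^ K.r + e)⁻¹) + ∫ u in (1 : ℝ)..t, (|u| ^ K.r + e)⁻¹ :=
        (intervalIntegral.integral_add_adjacent_intervals (hi 0 1) (hi 1 t)).symm
      have h3 : ∫ u in (1 : ℝ)..t, (|u| ^ K.r + e)⁻¹ ≤ t - 1 := by
        have := intervalIntegral.integral_mono_on (μ := volume) h1 (hi 1 t) (intervalIntegrable_const (c := (1 : ℝ)))
          fun u hu => by
            have h4 : 1 ≤ |u| ^ K.r := Real.one_le_rpow (by rw [abs_of_pos (by linarith [hu.1])]; exact hu.1) K.r_pos.le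
            exact inv_le_one_of_one_le₀ (by linarith)
        simpa using this
      have h4 : 0 ≤ ∫ u in (1 : ℝ)..t, (|u| ^ K.r + e)⁻¹ :=
        intervalIntegral.integral_nonneg h1 fun u _ => by positivity
      rw [h2]
      rw [abs_le] at h0 ⊢
      constructor <;> linarith
  rcases lt_trichotomy t 0 with h | h | h
  · rw [if_neg h.ne, sign_neg h, abs_of_neg h]
    have := hpos (-t) (by linarith)
    rw [primitive_neg] at this
    rw [← abs_neg]
    convert this using 2
    simp only [SignType.coe_neg, SignType.coe_one]
    ring
  · subst h; simp [primitive]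
  · rw [if_neg h.ne', sign_pos h, abs_of_pos h]
    convert hpos t h using 2
    simp only [SignType.coe_one]
    ring

theorem measurable_tail_kernel {e : ℝ} (he : 0 < e) :
    Measurable fun z : Rn n × ℝ => (Ioi |K.P z.1|).indicator (fun u => (|u| ^ K.r + e)⁻¹) z.2 := by
  have h1 : Measurable fun z : Rn n × ℝ => (|z.2| ^ K.r + e)⁻¹ :=
    (K.continuous_inv_rpow_add he).measurable.comp measurable_snd
  have h2 : MeasurableSet {z : Rn n × ℝ | |K.P z.1| < z.2} :=
    measurableSet_lt (K.measurable_P.comp measurable_fst).abs measurable_snd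
  exact h1.indicator h2

/-- After exchanging the integrals, each u carries the volume of C ∩ {|P| < u}, which is O(u). What
remains is ∫_0^1 u/(u^r+e) du, the integral that g dominates. -/
theorem exists_integral_tail_le {C : Set (Rn n)} (hC : IsCompact C) (hCΩ : C ⊆ interior K.Ω) :
    ∃ B, 0 ≤ B ∧ ∀ e > 0, IntegrableOn (fun p => K.tail e |K.P p|) C ∧
      ∫ p in C, K.tail e |K.P p| ≤ B * K.g e := by
  obtain ⟨B₁, hB₁, hvol⟩ := exists_measure_sublevel_le hC hCΩ
  obtain ⟨B₂, hB₂, hg⟩ := K.exists_integral_le_g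
  refine ⟨B₁ * B₂, by positivity, fun e he => ?_⟩
  have hfin : volume C ≠ ∞ := hC.measure_lt_top.ne
  have : IsFiniteMeasure ((volume : Measure (Rn n)).restrict C) := ⟨by simpa using hfin.lt_top⟩
  have hint : Integrable (fun z : Rn n × ℝ => (Ioi |K.P z.1|).indicator (fun u => (|u| ^ K.r + e)⁻¹) z.2)
      (((volume : Measure (Rn n)).restrict C).prod (volume.restrict (Ioc (0 : ℝ) 1))) := by
    refine Integrable.of_bound (K.measurable_tail_kernel he).aestronglyMeasurable e⁻¹
      (Eventually.of_forall fun z => ?_)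
    rw [Real.norm_of_nonneg (indicator_nonneg (fun u _ => by positivity) _)]
    refine indicator_apply_le' (fun _ => ?_) (fun _ => by positivity)
    have : 0 ≤ |z.2| ^ K.r := by positivity
    gcongr
    linarith
  refine ⟨hint.integral_prod_left, ?_⟩
  simp only [tail]
  rw [integral_integral_swap hint]
  have h1 : ∀ u ∈ Ioc (0 : ℝ) 1, ∫ p in C, (Ioi |K.P p|).indicator (fun u => (|u| ^ K.r + e)⁻¹) u ≤
      B₁ * (u * (|u| ^ K.r + e)⁻¹) := by
    intro u hu
    have h2 : ∀ p, (Ioi |K.P p|).indicator (fun u => (|u| ^ K.r + e)⁻¹) u =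
        {p | |K.P p| < u}.indicator (fun _ => (|u| ^ K.r + e)⁻¹) p := fun p => by
      simp only [indicator, mem_Ioi, mem_ofPred_eq]
    simp_rw [h2]
    rw [setIntegral_indicator (measurableSet_lt K.measurable_P.abs measurable_const), setIntegral_const,
      smul_eq_mul, ← mul_assoc]
    gcongr
    exact hvol u hu.1
  have hii : IntegrableOn (fun u : ℝ => B₁ * (u * (|u| ^ K.r + e)⁻¹)) (Ioc 0 1) := by
    refine (intervalIntegrable_iff_integrableOn_Ioc_of_le zero_le_one).1 (Continuous.intervalIntegrable ?_ _ _)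
    exact continuous_const.mul (continuous_id.mul (K.continuous_inv_rpow_add he))
  refine (setIntegral_mono_on hint.integral_prod_right hii measurableSet_Ioc h1).trans ?_
  rw [integral_const_mul, ← intervalIntegral.integral_of_le zero_le_one, mul_assoc]
  gcongr
  exact hg e he

variable {K} {χ : Rn n → ℝ}

/-- Both terms are integrals of div(Fa), one with weight Φ_e(P), the other with weight f(e)
sgn(P)/2. The singular behaviour in e cancels between the weights up to the tail, whose integral is
O(g(e)), and div(Fa) is bounded by a constant times A. -/
theorem IsCutoff.exists_kernel_bound (hχ : K.IsCutoff χ) :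
    ∃ C, 0 ≤ C ∧ ∀ e > 0, ∀ (F : Rn n → ℂ) (A : ℝ), ContDiff ℝ 1 F →
      (∀ p ∈ tsupport χ, ‖F p‖ ≤ A ∧ ‖fderiv ℝ F p‖ ≤ A) → 0 ≤ A →
      ‖(∫ p, (χ p / (K.T p + e)) • F p) -
        K.f e * ∫ p, (‖gradient K.P p‖⁻¹ : ℝ) • F p ∂K.surface‖ ≤ C * A * K.g e := by
  obtain ⟨a, ha⟩ := hχ.exists_isTransverse
  have hcc := hχ.hasCompactSupport.isCompact
  obtain ⟨C₁, hC₁, hD⟩ := ha.exists_norm_divMul_le hχ.hasCompactSupport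
  obtain ⟨C₂, hC₂, hf⟩ := K.exists_abs_f_sub_le
  obtain ⟨C₃, hC₃, htail⟩ := K.exists_integral_tail_le hcc hχ.tsupport_subset
  obtain ⟨M, hM⟩ := hcc.exists_bound_of_continuousOn (K.contDiffOn_one.continuousOn.mono hχ.tsupport_subset)
  set v := volume.real (tsupport χ) with hv
  refine ⟨C₁ * ((C₂ + |M|) * v + C₃), by positivity, fun e he F A hF hA hA0 => ?_⟩
  have hg := K.one_le_g he
  have hDc := ha.continuous_divMul hF
  have hDi : Integrable (divMul a F) := hDc.integrable_of_hasCompactSupport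
    (HasCompactSupport.intro hcc fun p hp => ha.divMul_eq_zero _ hp)
  have h1 : ∫ p, (χ p / (K.T p + e)) • F p = - ∫ p, K.primitive e (K.P p) • divMul a F p := by
    rw [← ha.integral_deriv_comp_smul isOpen_interior K.contDiffOn_one hχ.hasCompactSupport
      hχ.tsupport_subset (K.contDiff_primitive he) hF]
    congr 1
    ext p
    rw [K.deriv_primitive he, T, div_eq_inv_mul]
  have hcont : Continuous fun p => K.primitive e (K.P p) • divMul a F p := by
    refine ContinuousOn.continuous_of_tsupport_subset
      (((K.contDiff_primitive he).continuous.comp_continuousOn K.contDiffOn_one.continuousOn).smul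
        (ha.continuous_divMul hF).continuousOn) isOpen_interior ?_
    refine (closure_minimal ?_ (isClosed_tsupport χ)).trans hχ.tsupport_subset
    intro p hp
    by_contra h
    exact hp (by simp [ha.divMul_eq_zero F h])
  have hi1 : Integrable fun p => K.primitive e (K.P p) • divMul a F p :=
    hcont.integrable_of_hasCompactSupport (HasCompactSupport.intro hcc fun p hp => by
      rw [ha.divMul_eq_zero F hp, smul_zero])
  have hsm : Measurable fun p => (SignType.sign (K.P p) / 2 : ℝ) := by
    have : Measurable fun x : ℝ => ((SignType.sign x : SignType) : ℝ) := by
      have h : (fun x : ℝ => ((SignType.sign x : SignType) : ℝ)) =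
          fun x => if 0 < x then 1 else if x < 0 then -1 else 0 := by
        ext x
        rw [sign_apply]
        split_ifs <;> simp
      rw [h]
      exact Measurable.ite measurableSet_Ioi measurable_const
        (Measurable.ite measurableSet_Iio measurable_const measurable_const)
    exact (this.comp K.measurable_P).div_const 2
  have hi2 : Integrable fun p => (K.f e : ℂ) * ((SignType.sign (K.P p) / 2 : ℝ) • divMul a F p) := by
    refine Integrable.const_mul ?_ _
    refine hDi.bdd_smul 1 hsm.aestronglyMeasurable (Eventually.of_forall fun p => ?_)
    rw [Real.norm_eq_abs]
    rcases lt_trichotomy (K.P p) 0 with h | h | h <;> simp [h] <;> norm_num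
  rw [h1, hχ.surface_integral_eq ha hF, mul_neg, sub_neg_eq_add, ← integral_const_mul, neg_add_eq_sub,
    ← integral_sub hi2 hi1]
  have hbd : ∀ p, ‖(K.f e : ℂ) * ((SignType.sign (K.P p) / 2 : ℝ) • divMul a F p) -
      K.primitive e (K.P p) • divMul a F p‖ ≤
      (tsupport χ).indicator (fun p => (C₂ + |M| + K.tail e |K.P p|) * (C₁ * A)) p := by
    intro p
    by_cases hp : p ∈ tsupport χ
    · rw [indicator_of_mem hp, ← Complex.real_smul, smul_smul, ← sub_smul, norm_smul, Real.norm_eq_abs, abs_sub_comm]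
      have k1 := K.abs_primitive_sub_le hf he (K.P p)
      have k2 : (if K.P p = 0 then 0 else C₂ + |K.P p| + K.tail e |K.P p|) ≤ C₂ + |M| + K.tail e |K.P p| := by
        have := K.tail_nonneg he |K.P p|
        have h3 : |K.P p| ≤ |M| := (hM p hp).trans (le_abs_self M)
        split_ifs
        · positivity
        · linarith
      exact mul_le_mul (k1.trans k2) (hD F A hA p hp) (norm_nonneg _)
        (by have := K.tail_nonneg he |K.P p|; positivity)
    · rw [indicator_of_notMem hp, ha.divMul_eq_zero F hp]
      simp
  obtain ⟨ht1, ht2⟩ := htail e he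
  have hci : IntegrableOn (fun _ : Rn n => C₂ + |M|) (tsupport χ) := integrableOn_const hcc.measure_lt_top.ne
  have hbi : IntegrableOn (fun p => (C₂ + |M| + K.tail e |K.P p|) * (C₁ * A)) (tsupport χ) :=
    (hci.add ht1).mul_const _
  refine (norm_integral_le_of_norm_le (hbi.integrable_indicator (isClosed_tsupport χ).measurableSet)
    (Eventually.of_forall hbd)).trans ?_
  rw [integral_indicator (isClosed_tsupport χ).measurableSet, integral_mul_const, integral_add hci ht1,
    setIntegral_const, ← hv, smul_eq_mul]
  -- The bounded contributions are absorbed through g(e) ≥ 1.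
  calc (v * (C₂ + |M|) + ∫ p in tsupport χ, K.tail e |K.P p|) * (C₁ * A)
      ≤ (v * (C₂ + |M|) * K.g e + C₃ * K.g e) * (C₁ * A) := by
        gcongr ?_ * _
        exact add_le_add (le_mul_of_one_le_right (by positivity) hg) ht2
    _ = _ := by ring

end KineticSymbol

/-! ### Spherical means of plane waves and their decay -/

/-- The integral of `cos ⟪ω/‖ω‖, q⟫` over the unit ball: a multiple of the spherical mean of plane waves. -/
noncomputable def sphericalWave {n : ℕ} (q : Rn n) : ℝ :=
  ∫ ω in Metric.ball (0 : Rn n) 1, Real.cos ⟪‖ω‖⁻¹ • ω, q⟫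

section SphericalWave

variable {n : ℕ}

theorem norm_direction_le (ω : Rn n) : ‖‖ω‖⁻¹ • ω‖ ≤ 1 := by
  rw [norm_smul, norm_inv, norm_norm]
  exact inv_mul_le_one

theorem measurable_direction : Measurable fun ω : Rn n => ‖ω‖⁻¹ • ω :=
  measurable_norm.inv.smul measurable_id

instance isFiniteMeasure_restrict_ball :
    IsFiniteMeasure ((volume : Measure (Rn n)).restrict (Metric.ball 0 1)) :=
  ⟨by simpa using measure_ball_lt_top⟩

theorem exists_linearIsometryEquiv_apply_eq {q q' : Rn n} (h : ‖q‖ = ‖q'‖) :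
    ∃ R : Rn n ≃ₗᵢ[ℝ] Rn n, R q = q' :=
  ⟨_, Submodule.reflection_sub h⟩

theorem sphericalWave_eq_of_norm_eq {q q' : Rn n} (h : ‖q‖ = ‖q'‖) : sphericalWave q = sphericalWave q' := by
  obtain ⟨R, rfl⟩ := exists_linearIsometryEquiv_apply_eq h
  have hpre : R ⁻¹' Metric.ball (0 : Rn n) 1 = Metric.ball 0 1 := by
    ext x; simp
  have := R.measurePreserving.setIntegral_preimage_emb R.toHomeomorph.measurableEmbedding
    (fun ω => Real.cos ⟪‖ω‖⁻¹ • ω, R q⟫) (Metric.ball 0 1)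
  rw [sphericalWave, sphericalWave, ← this, hpre]
  congr 1
  ext ω
  rw [R.norm_map, ← R.map_smul, R.inner_map_map]

/-- The phase a and the direction b are free so that axial derivatives (a = 0) and transverse ones
come from the same statement; shifting a by π/2 gives the sine version. -/
theorem hasDerivAt_integral_cos {w a b : Rn n → ℝ} (hw : Measurable w) (ha : Measurable a)
    (hb : Measurable b) (hw1 : ∀ ω, |w ω| ≤ 1) (hb1 : ∀ ω, |b ω| ≤ 1) (t : ℝ) :
    HasDerivAt (fun t : ℝ => ∫ ω in Metric.ball (0 : Rn n) 1, w ω * Real.cos (a ω + t * b ω))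
      (-∫ ω in Metric.ball (0 : Rn n) 1, w ω * b ω * Real.sin (a ω + t * b ω)) t := by
  rw [← integral_neg]
  refine (hasDerivAt_integral_of_dominated_loc_of_deriv_le (F := fun t ω => w ω * Real.cos (a ω + t * b ω))
    (F' := fun t ω => -(w ω * b ω * Real.sin (a ω + t * b ω))) (s := univ)
    (bound := fun _ => 1) univ_mem ?_ ?_ ?_ ?_ ?_ ?_).2
  · exact Eventually.of_forall fun t => by fun_prop
  · refine Integrable.of_bound (by fun_prop) 1 (Eventually.of_forall fun ω => ?_)
    rw [norm_mul]
    exact mul_le_one₀ (hw1 ω) (norm_nonneg _) (Real.abs_cos_le_one _)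
  · fun_prop
  · refine Eventually.of_forall fun ω t _ => ?_
    rw [norm_neg, norm_mul, norm_mul]
    exact mul_le_one₀ (mul_le_one₀ (hw1 ω) (norm_nonneg _) (hb1 ω)) (norm_nonneg _) (Real.abs_sin_le_one _)
  · exact integrable_const _
  · refine Eventually.of_forall fun ω t _ => ?_
    have h1 : HasDerivAt (fun t => a ω + t * b ω) (b ω) t := by
      simpa using ((hasDerivAt_id t).mul_const (b ω)).const_add (a ω)
    convert! (h1.cos.const_mul (w ω)) using 1
    ring

theorem hasDerivAt_integral_sin {w a b : Rn n → ℝ} (hw : Measurable w) (ha : Measurable a)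
    (hb : Measurable b) (hw1 : ∀ ω, |w ω| ≤ 1) (hb1 : ∀ ω, |b ω| ≤ 1) (t : ℝ) :
    HasDerivAt (fun t : ℝ => ∫ ω in Metric.ball (0 : Rn n) 1, w ω * Real.sin (a ω + t * b ω))
      (∫ ω in Metric.ball (0 : Rn n) 1, w ω * b ω * Real.cos (a ω + t * b ω)) t := by
  have h := hasDerivAt_integral_cos hw (ha.sub_const (Real.pi / 2)) hb hw1 hb1 t
  have e1 : ∀ ω t, a ω - Real.pi / 2 + t * b ω = (a ω + t * b ω) - Real.pi / 2 := fun ω t => by ring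
  simp_rw [e1, Real.cos_sub_pi_div_two, Real.sin_sub_pi_div_two, mul_neg, integral_neg, neg_neg] at h
  exact h

theorem abs_direction_apply_le (ω : Rn n) (i : Fin n) : |(‖ω‖⁻¹ • ω) i| ≤ 1 :=
  (PiLp.norm_apply_le (‖ω‖⁻¹ • ω) i).trans (norm_direction_le ω)

theorem measurable_direction_apply (i : Fin n) : Measurable fun ω : Rn n => (‖ω‖⁻¹ • ω) i := by
  have h : Measurable fun x : Rn n => x i := by fun_prop
  exact h.comp measurable_direction

theorem inner_direction_stdVec (ω : Rn n) (i : Fin n) : ⟪‖ω‖⁻¹ • ω, stdVec i⟫ = (‖ω‖⁻¹ • ω) i := by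
  rw [stdVec, EuclideanSpace.inner_single_right]
  simp

/-- The profile of the spherical wave along the `i`-th axis, and its first two derivatives. -/
noncomputable def waveProfile (i : Fin n) (ρ : ℝ) : ℝ :=
  ∫ ω in Metric.ball (0 : Rn n) 1, Real.cos (ρ * (‖ω‖⁻¹ • ω) i)

noncomputable def waveProfileDeriv (i : Fin n) (ρ : ℝ) : ℝ :=
  -∫ ω in Metric.ball (0 : Rn n) 1, (‖ω‖⁻¹ • ω) i * Real.sin (ρ * (‖ω‖⁻¹ • ω) i)

noncomputable def waveProfileDeriv2 (i : Fin n) (ρ : ℝ) : ℝ :=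
  -∫ ω in Metric.ball (0 : Rn n) 1, (‖ω‖⁻¹ • ω) i ^ 2 * Real.cos (ρ * (‖ω‖⁻¹ • ω) i)

theorem hasDerivAt_waveProfile (i : Fin n) (ρ : ℝ) :
    HasDerivAt (waveProfile i) (waveProfileDeriv i ρ) ρ := by
  have := hasDerivAt_integral_cos (n := n) (w := fun _ => 1) (a := fun _ => 0) measurable_const
    measurable_const (measurable_direction_apply i) (by simp) (fun ω => abs_direction_apply_le ω i) ρ
  simpa only [one_mul, zero_add] using! this

theorem hasDerivAt_waveProfileDeriv (i : Fin n) (ρ : ℝ) :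
    HasDerivAt (waveProfileDeriv i) (waveProfileDeriv2 i ρ) ρ := by
  have := (hasDerivAt_integral_sin (n := n) (a := fun _ => 0) (measurable_direction_apply i)
    measurable_const (measurable_direction_apply i) (fun ω => abs_direction_apply_le ω i)
    (fun ω => abs_direction_apply_le ω i) ρ).neg
  simp only [zero_add, ← pow_two] at this
  exact this

theorem sphericalWave_eq_waveProfile (i : Fin n) (q : Rn n) : sphericalWave q = waveProfile i ‖q‖ := by
  have h : ‖q‖ = ‖‖q‖ • stdVec i‖ := by simp [norm_smul]
  rw [sphericalWave_eq_of_norm_eq h, sphericalWave, waveProfile]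
  congr 1
  ext ω
  rw [inner_smul_right, inner_direction_stdVec]

/-- By rotation invariance the wave at ρeᵢ + teⱼ is the profile at √(ρ² + t²). Its second derivative
in t at 0, computed once under the integral and once by the chain rule, gives both sides. -/
theorem integral_transverse_eq {i j : Fin n} (hij : i ≠ j) {ρ : ℝ} (hρ : 0 < ρ) :
    ∫ ω in Metric.ball (0 : Rn n) 1, (‖ω‖⁻¹ • ω) j ^ 2 * Real.cos (ρ * (‖ω‖⁻¹ • ω) i) =
      -(waveProfileDeriv i ρ / ρ) := by
  have hs : ∀ t : ℝ, ‖ρ • stdVec i + t • stdVec j‖ = √(ρ ^ 2 + t ^ 2) := by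
    intro t
    have h0 : ⟪ρ • stdVec i, t • stdVec j⟫ = 0 := by
      rw [inner_smul_left, inner_smul_right, stdVec, stdVec, EuclideanSpace.inner_single_right]
      simp [hij.symm]
    have := norm_add_sq_eq_norm_sq_add_norm_sq_of_inner_eq_zero _ _ h0
    rw [← Real.sqrt_sq (norm_nonneg (ρ • stdVec i + t • stdVec j)), pow_two, this]
    congr 1
    simp [norm_smul, ← pow_two]
  have hΦ : ∀ t : ℝ, ∫ ω in Metric.ball (0 : Rn n) 1, 1 * Real.cos (ρ * (‖ω‖⁻¹ • ω) i + t * (‖ω‖⁻¹ • ω) j) =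
      waveProfile i √(ρ ^ 2 + t ^ 2) := by
    intro t
    rw [← hs, ← sphericalWave_eq_waveProfile, sphericalWave]
    congr 1
    ext ω
    rw [inner_add_right, inner_smul_right, inner_smul_right, inner_direction_stdVec, inner_direction_stdVec, one_mul]
  have hpos : ∀ t : ℝ, 0 < ρ ^ 2 + t ^ 2 := fun t => by positivity
  have hmi : Measurable fun ω : Rn n => ρ * (‖ω‖⁻¹ • ω) i := (measurable_direction_apply i).const_mul ρ
  have h1 : ∀ t : ℝ, -∫ ω in Metric.ball (0 : Rn n) 1, 1 * (‖ω‖⁻¹ • ω) j *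
      Real.sin (ρ * (‖ω‖⁻¹ • ω) i + t * (‖ω‖⁻¹ • ω) j) =
      t * (waveProfileDeriv i √(ρ ^ 2 + t ^ 2) / √(ρ ^ 2 + t ^ 2)) := by
    intro t
    have d1 := hasDerivAt_integral_cos (n := n) (w := fun _ => 1) measurable_const hmi
      (measurable_direction_apply j) (by simp) (fun ω => abs_direction_apply_le ω j) t
    simp_rw [hΦ] at d1
    have d2 : HasDerivAt (fun t : ℝ => √(ρ ^ 2 + t ^ 2)) (t / √(ρ ^ 2 + t ^ 2)) t := by
      have := (((hasDerivAt_id t).pow 2).const_add (ρ ^ 2)).sqrt (hpos t).ne'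
      convert! this using 1
      simp
      field_simp
    have d3 := (hasDerivAt_waveProfile i √(ρ ^ 2 + t ^ 2)).comp t d2
    rw [d1.unique d3]
    ring
  have h2 := (hasDerivAt_integral_sin (n := n) (w := fun ω => 1 * (‖ω‖⁻¹ • ω) j)
    (by simpa using measurable_direction_apply j) hmi
    (measurable_direction_apply j) (fun ω => by simpa using abs_direction_apply_le ω j)
    (fun ω => abs_direction_apply_le ω j) 0).neg
  -- A function t·m(t) has derivative m(0) at 0 as soon as m is continuous, so no further derivative
  -- of the quotient is needed.
  have h3 : HasDerivAt (fun t : ℝ => t * (waveProfileDeriv i √(ρ ^ 2 + t ^ 2) / √(ρ ^ 2 + t ^ 2)))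
      (waveProfileDeriv i ρ / ρ) 0 := by
    have hc : Continuous (waveProfileDeriv i) :=
      continuous_iff_continuousAt.2 fun x => (hasDerivAt_waveProfileDeriv i x).continuousAt
    have hm : Continuous fun t : ℝ => waveProfileDeriv i √(ρ ^ 2 + t ^ 2) / √(ρ ^ 2 + t ^ 2) :=
      Continuous.div (by fun_prop) (by fun_prop) fun t => (Real.sqrt_pos.2 (hpos t)).ne'
    rw [hasDerivAt_iff_tendsto_slope]
    have h4 := hm.tendsto 0
    simp only [ne_eq, OfNat.ofNat_ne_zero, not_false_eq_true, zero_pow, add_zero, Real.sqrt_sq hρ.le] at h4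
    refine (h4.mono_left nhdsWithin_le_nhds).congr' ?_
    filter_upwards [self_mem_nhdsWithin] with t (ht : t ≠ 0)
    simp [slope, ht]
  have h4 : HasDerivAt (fun t : ℝ => t * (waveProfileDeriv i √(ρ ^ 2 + t ^ 2) / √(ρ ^ 2 + t ^ 2)))
      (-∫ ω in Metric.ball (0 : Rn n) 1, 1 * (‖ω‖⁻¹ • ω) j * (‖ω‖⁻¹ • ω) j *
        Real.cos (ρ * (‖ω‖⁻¹ • ω) i + 0 * (‖ω‖⁻¹ • ω) j)) 0 := by
    refine h2.congr_of_eventuallyEq (Eventually.of_forall fun t => ?_)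
    exact (h1 t).symm
  have := h4.unique h3
  rw [← this, neg_neg]
  congr 1
  ext ω
  rw [zero_mul, add_zero]
  ring

/-- The Bessel-type differential equation of the profile. -/
theorem waveProfile_ode (i : Fin n) {ρ : ℝ} (hρ : 0 < ρ) :
    waveProfileDeriv2 i ρ = - waveProfile i ρ - (n - 1) / ρ * waveProfileDeriv i ρ := by
  have hint : ∀ j : Fin n, IntegrableOn (fun ω : Rn n => (‖ω‖⁻¹ • ω) j ^ 2 * Real.cos (ρ * (‖ω‖⁻¹ • ω) i))
      (Metric.ball 0 1) := fun j => by
    refine Integrable.of_bound (Measurable.aestronglyMeasurable ?_) 1 (Eventually.of_forall fun ω => ?_)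
    · exact ((measurable_direction_apply j).pow_const 2).mul
        (Real.measurable_cos.comp ((measurable_direction_apply i).const_mul ρ))
    · rw [norm_mul, norm_pow]
      exact mul_le_one₀ (pow_le_one₀ (norm_nonneg _) (abs_direction_apply_le ω j)) (norm_nonneg _)
        (Real.abs_cos_le_one _)
  have h0 : ∀ᵐ ω ∂(volume : Measure (Rn n)).restrict (Metric.ball 0 1), ω ≠ 0 := by
    have : Nontrivial (Rn n) := ⟨stdVec i, 0, by simp⟩
    refine ae_restrict_of_ae ?_
    exact (measure_singleton (μ := (volume : Measure (Rn n))) 0) |> compl_mem_ae_iff.2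
  -- The squared components of a unit vector sum to 1. The i-th one produces the second derivative
  -- of the profile, each of the n-1 others a first-order term.
  have hsum : waveProfile i ρ = ∑ j, ∫ ω in Metric.ball (0 : Rn n) 1,
      (‖ω‖⁻¹ • ω) j ^ 2 * Real.cos (ρ * (‖ω‖⁻¹ • ω) i) := by
    rw [← integral_finsetSum _ fun j _ => hint j, waveProfile]
    refine integral_congr_ae ?_
    filter_upwards [h0] with ω hω
    have h1 : ∑ j, (‖ω‖⁻¹ • ω) j ^ 2 = 1 := by
      have := EuclideanSpace.real_norm_sq_eq (‖ω‖⁻¹ • ω)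
      rw [← this, norm_smul, norm_inv, norm_norm, inv_mul_cancel₀ (norm_ne_zero_iff.2 hω), one_pow]
    rw [← Finset.sum_mul, h1, one_mul]
  rw [← Finset.add_sum_erase _ _ (Finset.mem_univ i), Finset.sum_congr rfl
    (fun j hj => integral_transverse_eq (Finset.ne_of_mem_erase hj).symm hρ), Finset.sum_const,
    Finset.card_erase_of_mem (Finset.mem_univ i), Finset.card_univ, Fintype.card_fin, nsmul_eq_mul,
    Nat.cast_sub (Fin.pos i), Nat.cast_one] at hsum
  rw [waveProfileDeriv2, hsum]
  field_simp
  ring_nf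

theorem abs_waveProfileDeriv_le (i : Fin n) (ρ : ℝ) :
    |waveProfileDeriv i ρ| ≤ volume.real (Metric.ball (0 : Rn n) 1) := by
  rw [waveProfileDeriv, abs_neg, ← Real.norm_eq_abs]
  have := norm_setIntegral_le_of_norm_le_const (μ := volume) (s := Metric.ball (0 : Rn n) 1) (C := 1)
    (f := fun ω => (‖ω‖⁻¹ • ω) i * Real.sin (ρ * (‖ω‖⁻¹ • ω) i)) measure_ball_lt_top fun ω _ => by
      rw [norm_mul]
      exact mul_le_one₀ (abs_direction_apply_le ω i) (norm_nonneg _) (Real.abs_sin_le_one _)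
  simpa using this

end SphericalWave

/-- Grönwall's argument with the rate c/ρ², integrable at infinity: U(ρ) exp(c/ρ) is nonincreasing,
and exp(c/2) is the value of the exponential at ρ = 2. -/
theorem le_mul_exp_of_deriv_le {U U' : ℝ → ℝ} {c : ℝ} (hc : 0 ≤ c)
    (hd : ∀ ρ ≥ 2, HasDerivAt U (U' ρ) ρ) (h : ∀ ρ ≥ 2, U' ρ ≤ c / ρ ^ 2 * U ρ)
    (h0 : ∀ ρ ≥ 2, 0 ≤ U ρ) : ∀ ρ ≥ 2, U ρ ≤ U 2 * Real.exp (c / 2) := by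
  intro ρ hρ
  have hW : ∀ ρ ≥ 2, HasDerivAt (fun ρ => U ρ * Real.exp (c / ρ))
      (U' ρ * Real.exp (c / ρ) + U ρ * (Real.exp (c / ρ) * (-c / ρ ^ 2))) ρ := by
    intro ρ hρ
    have hρ0 : ρ ≠ 0 := by linarith
    refine (hd ρ hρ).mul (HasDerivAt.exp ?_)
    have := (hasDerivAt_inv hρ0).const_mul c
    convert! this using 1
    ring
  have hanti : AntitoneOn (fun ρ => U ρ * Real.exp (c / ρ)) (Ici 2) := by
    refine antitoneOn_of_hasDerivWithinAt_nonpos (convex_Ici 2)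
      (fun x hx => (hW x hx).continuousAt.continuousWithinAt)
      (fun x hx => (hW x (interior_subset hx)).hasDerivWithinAt) fun x hx => ?_
    have hx2 := h x (interior_subset hx)
    have : U' x * Real.exp (c / x) + U x * (Real.exp (c / x) * (-c / x ^ 2)) =
        (U' x - c / x ^ 2 * U x) * Real.exp (c / x) := by ring
    rw [this]
    exact mul_nonpos_of_nonpos_of_nonneg (by linarith) (Real.exp_nonneg _)
  have h1 := hanti (self_mem_Ici) (mem_Ici.2 hρ) hρ
  simp only at h1
  have h2 : 1 ≤ Real.exp (c / ρ) := Real.one_le_exp (div_nonneg hc (by linarith))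
  nlinarith [h0 ρ hρ]

/-- Decay of solutions of `J'' + m/ρ J' + J = 0`. -/
theorem exists_decay_of_ode {J J' J'' : ℝ → ℝ} {m : ℝ} {N : ℕ} (hN : N = 1 ∨ N = 2) (hm : N ≤ m)
    (h1 : ∀ ρ, HasDerivAt J (J' ρ) ρ) (h2 : ∀ ρ, HasDerivAt J' (J'' ρ) ρ)
    (ode : ∀ ρ > 0, J'' ρ = - J ρ - m / ρ * J' ρ) :
    ∃ C, ∀ ρ ≥ 2, ρ ^ N * J' ρ ^ 2 ≤ C := by
  rcases hN with rfl | rfl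
  · have hm1 : 1 ≤ m := by simpa using hm
    -- The cross term JJ' cancels J² in the derivative of the energy ρ(J² + J'²) and leaves the
    -- coefficient -2(m-1) ≤ 0 in front of J'². For ρ ≥ 2 it is at most half of the energy.
    set U : ℝ → ℝ := fun ρ => ρ * (J ρ ^ 2 + J' ρ ^ 2) + J ρ * J' ρ with hU
    have hlow : ∀ ρ ≥ 2, ρ * (J ρ ^ 2 + J' ρ ^ 2) ≤ 2 * U ρ := fun ρ hρ => by
      simp only [hU]
      nlinarith [sq_nonneg (J ρ + J' ρ), sq_nonneg (J ρ), sq_nonneg (J' ρ)]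
    have h0 : ∀ ρ ≥ 2, 0 ≤ U ρ := fun ρ hρ => by
      have := hlow ρ hρ
      have : 0 ≤ ρ * (J ρ ^ 2 + J' ρ ^ 2) := mul_nonneg (by linarith) (by positivity)
      linarith
    have key := le_mul_exp_of_deriv_le (U := U)
      (U' := fun ρ => 1 * (J ρ ^ 2 + J' ρ ^ 2) + ρ * (2 * J ρ * J' ρ + 2 * J' ρ * J'' ρ) +
        (J' ρ * J' ρ + J ρ * J'' ρ)) (c := m) (by linarith) (fun ρ _ => ?_) (fun ρ hρ => ?_) h0
    · refine ⟨2 * (U 2 * Real.exp (m / 2)), fun ρ hρ => ?_⟩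
      have a1 := key ρ hρ
      have a2 := hlow ρ hρ
      nlinarith [sq_nonneg (J ρ)]
    · have a := ((hasDerivAt_id ρ).mul (((h1 ρ).pow 2).add ((h2 ρ).pow 2))).add ((h1 ρ).mul (h2 ρ))
      convert! a using 1
      simp
    · have hρ0 : 0 < ρ := by linarith
      rw [ode ρ hρ0]
      have e : 1 * (J ρ ^ 2 + J' ρ ^ 2) + ρ * (2 * J ρ * J' ρ + 2 * J' ρ * (- J ρ - m / ρ * J' ρ)) +
        (J' ρ * J' ρ + J ρ * (- J ρ - m / ρ * J' ρ)) =
          -(2 * (m - 1)) * J' ρ ^ 2 - m / ρ * (J ρ * J' ρ) := by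
        field_simp; ring
      rw [e]
      have b1 : m / ρ ^ 2 * U ρ ≥ m / ρ ^ 2 * (ρ * (J ρ ^ 2 + J' ρ ^ 2) / 2) := by
        gcongr
        linarith [hlow ρ hρ]
      have b2 : m / ρ ^ 2 * (ρ * (J ρ ^ 2 + J' ρ ^ 2) / 2) = m / ρ * ((J ρ ^ 2 + J' ρ ^ 2) / 2) := by
        field_simp
      have b3 : 0 ≤ m / ρ * ((J ρ ^ 2 + J' ρ ^ 2) / 2 + J ρ * J' ρ) :=
        mul_nonneg (by positivity) (by nlinarith [sq_nonneg (J ρ + J' ρ)])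
      nlinarith [sq_nonneg (J' ρ)]
  · have hm1 : 2 ≤ m := by simpa using hm
    -- The cross term now carries the weight 2ρ, and the coefficient of J'² becomes -2(m-2)ρ, which
    -- is nonpositive because m ≥ 2.
    set U : ℝ → ℝ := fun ρ => ρ ^ 2 * (J ρ ^ 2 + J' ρ ^ 2) + 2 * ρ * (J ρ * J' ρ) with hU
    have hlow : ∀ ρ ≥ 2, ρ ^ 2 * (J ρ ^ 2 + J' ρ ^ 2) ≤ 2 * U ρ := fun ρ hρ => by
      simp only [hU]
      have : 0 ≤ ρ * (ρ * (J ρ ^ 2 + J' ρ ^ 2) + 4 * (J ρ * J' ρ)) := by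
        refine mul_nonneg (by linarith) ?_
        nlinarith [sq_nonneg (J ρ + J' ρ), sq_nonneg (J ρ), sq_nonneg (J' ρ)]
      nlinarith
    have h0 : ∀ ρ ≥ 2, 0 ≤ U ρ := fun ρ hρ => by
      have := hlow ρ hρ
      have : 0 ≤ ρ ^ 2 * (J ρ ^ 2 + J' ρ ^ 2) := by positivity
      linarith
    have key := le_mul_exp_of_deriv_le (U := U)
      (U' := fun ρ => 2 * ρ * (J ρ ^ 2 + J' ρ ^ 2) + ρ ^ 2 * (2 * J ρ * J' ρ + 2 * J' ρ * J'' ρ) +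
        (2 * (J ρ * J' ρ) + 2 * ρ * (J' ρ * J' ρ + J ρ * J'' ρ))) (c := 2 * m) (by linarith) (fun ρ _ => ?_)
        (fun ρ hρ => ?_) h0
    · refine ⟨2 * (U 2 * Real.exp (2 * m / 2)), fun ρ hρ => ?_⟩
      have a1 := key ρ hρ
      have a2 := hlow ρ hρ
      nlinarith [mul_nonneg (sq_nonneg ρ) (sq_nonneg (J ρ))]
    · have a := (((hasDerivAt_id ρ).pow 2).mul (((h1 ρ).pow 2).add ((h2 ρ).pow 2))).add
        (((hasDerivAt_id ρ).const_mul 2).mul ((h1 ρ).mul (h2 ρ)))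
      convert! a using 1
      simp
    · have hρ0 : 0 < ρ := by linarith
      rw [ode ρ hρ0]
      have e : 2 * ρ * (J ρ ^ 2 + J' ρ ^ 2) + ρ ^ 2 * (2 * J ρ * J' ρ + 2 * J' ρ * (- J ρ - m / ρ * J' ρ)) +
        (2 * (J ρ * J' ρ) + 2 * ρ * (J' ρ * J' ρ + J ρ * (- J ρ - m / ρ * J' ρ))) =
          -(2 * (m - 2)) * ρ * J' ρ ^ 2 - 2 * (m - 1) * (J ρ * J' ρ) := by
        field_simp; ring
      rw [e]
      have b1 : 2 * m / ρ ^ 2 * U ρ ≥ 2 * m / ρ ^ 2 * (ρ ^ 2 * (J ρ ^ 2 + J' ρ ^ 2) / 2) := by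
        gcongr
        linarith [hlow ρ hρ]
      have b2 : 2 * m / ρ ^ 2 * (ρ ^ 2 * (J ρ ^ 2 + J' ρ ^ 2) / 2) = m * (J ρ ^ 2 + J' ρ ^ 2) := by
        field_simp
      have b3 : 0 ≤ (m - 1) * (J ρ ^ 2 + J' ρ ^ 2 + 2 * (J ρ * J' ρ)) :=
        mul_nonneg (by linarith) (by nlinarith [sq_nonneg (J ρ + J' ρ)])
      have b4 : 0 ≤ 2 * (m - 2) * ρ * J' ρ ^ 2 :=
        mul_nonneg (mul_nonneg (by linarith) hρ0.le) (sq_nonneg _)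
      nlinarith [sq_nonneg (J ρ), sq_nonneg (J' ρ)]

section SphericalWave

variable {n : ℕ}

theorem norm_sin_smul_innerSL_le (ω q : Rn n) :
    ‖-(Real.sin ⟪‖ω‖⁻¹ • ω, q⟫ • innerSL ℝ (‖ω‖⁻¹ • ω))‖ ≤ 1 := by
  rw [norm_neg, norm_smul, innerSL_apply_norm]
  exact mul_le_one₀ (Real.abs_sin_le_one _) (norm_nonneg _) (norm_direction_le ω)

theorem measurable_sin_smul_innerSL (q : Rn n) :
    Measurable fun ω : Rn n => -(Real.sin ⟪‖ω‖⁻¹ • ω, q⟫ • innerSL ℝ (‖ω‖⁻¹ • ω)) := by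
  have h : Continuous fun u : Rn n => -(Real.sin ⟪u, q⟫ • innerSL ℝ u) := by fun_prop
  exact h.measurable.comp measurable_direction

theorem measurable_cos_inner_direction (q : Rn n) :
    Measurable fun ω : Rn n => Real.cos ⟪‖ω‖⁻¹ • ω, q⟫ := by
  have h : Continuous fun u : Rn n => Real.cos ⟪u, q⟫ := by fun_prop
  exact h.measurable.comp measurable_direction

theorem hasFDerivAt_sphericalWave (q : Rn n) :
    HasFDerivAt sphericalWave (∫ ω in Metric.ball (0 : Rn n) 1,
      -(Real.sin ⟪‖ω‖⁻¹ • ω, q⟫ • innerSL ℝ (‖ω‖⁻¹ • ω))) q := by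
  refine hasFDerivAt_integral_of_dominated_of_fderiv_le
    (F := fun q ω => Real.cos ⟪‖ω‖⁻¹ • ω, q⟫)
    (F' := fun q ω => -(Real.sin ⟪‖ω‖⁻¹ • ω, q⟫ • innerSL ℝ (‖ω‖⁻¹ • ω))) (s := univ)
    (bound := fun _ => 1) univ_mem ?_ ?_ ?_ ?_ ?_ ?_
  · exact Eventually.of_forall fun q => (measurable_cos_inner_direction q).aestronglyMeasurable
  · exact Integrable.of_bound (measurable_cos_inner_direction q).aestronglyMeasurable 1
      (Eventually.of_forall fun ω => Real.abs_cos_le_one _)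
  · exact (measurable_sin_smul_innerSL q).aestronglyMeasurable
  · exact Eventually.of_forall fun ω q _ => norm_sin_smul_innerSL_le ω q
  · exact integrable_const _
  · refine Eventually.of_forall fun ω q _ => ?_
    have h := (innerSL ℝ (‖ω‖⁻¹ • ω)).hasFDerivAt (x := q)
    have h2 := h.cos
    convert! h2 using 1
    exact (neg_smul _ _).symm

theorem contDiff_sphericalWave : ContDiff ℝ 1 (sphericalWave : Rn n → ℝ) := by
  refine contDiff_one_iff_fderiv.2 ⟨fun q => (hasFDerivAt_sphericalWave q).differentiableAt, ?_⟩
  have : fderiv ℝ (sphericalWave : Rn n → ℝ) = fun q => ∫ ω in Metric.ball (0 : Rn n) 1,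
      -(Real.sin ⟪‖ω‖⁻¹ • ω, q⟫ • innerSL ℝ (‖ω‖⁻¹ • ω)) :=
    funext fun q => (hasFDerivAt_sphericalWave q).fderiv
  rw [this]
  refine continuous_of_dominated (bound := fun _ => 1)
    (fun q => (measurable_sin_smul_innerSL q).aestronglyMeasurable)
    (fun q => Eventually.of_forall fun ω => norm_sin_smul_innerSL_le ω q) (integrable_const _)
    (Eventually.of_forall fun ω => by fun_prop)

theorem abs_sphericalWave_le (q : Rn n) :
    |sphericalWave q| ≤ volume.real (Metric.ball (0 : Rn n) 1) := by
  have := norm_setIntegral_le_of_norm_le_const (μ := volume) (s := Metric.ball (0 : Rn n) 1) (C := 1)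
    (f := fun ω => Real.cos ⟪‖ω‖⁻¹ • ω, q⟫) measure_ball_lt_top fun ω _ => Real.abs_cos_le_one _
  simpa using! this

theorem norm_fderiv_sphericalWave_le (i : Fin n) {q : Rn n} (hq : q ≠ 0) :
    ‖fderiv ℝ sphericalWave q‖ ≤ |waveProfileDeriv i ‖q‖| := by
  have h1 : (sphericalWave : Rn n → ℝ) = waveProfile i ∘ norm :=
    funext fun q => sphericalWave_eq_waveProfile i q
  have hd : DifferentiableAt ℝ (norm : Rn n → ℝ) q := (contDiffAt_norm ℝ hq (n := 1)).differentiableAt (by simp)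
  rw [h1, ((hasDerivAt_waveProfile i ‖q‖).comp_hasFDerivAt q hd.hasFDerivAt).fderiv, norm_smul,
    Real.norm_eq_abs]
  refine mul_le_of_le_one_right (abs_nonneg _) ?_
  exact norm_fderiv_le_of_lipschitz ℝ lipschitzWith_one_norm |>.trans (by simp)

/-- Here m = n-1, so N = 1 is allowed for n = 2 and N = 2 for n ≥ 3. The decay for large n is
better, but nothing beyond ρ^(-1) for the derivative is needed. For ρ ≤ 2 the trivial bound by the
volume of the ball suffices. -/
theorem exists_waveProfileDeriv_decay (hn : 2 ≤ n) (i : Fin n) {N : ℕ}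
    (hN : (n = 2 ∧ N = 1) ∨ (3 ≤ n ∧ N = 2)) :
    ∃ C, ∀ ρ > 0, ρ ^ N * waveProfileDeriv i ρ ^ 2 ≤ C := by
  obtain ⟨C, hC⟩ := exists_decay_of_ode (J := waveProfile i) (J' := waveProfileDeriv i)
    (J'' := waveProfileDeriv2 i) (m := (n : ℝ) - 1) (N := N) (by omega)
    (by
      rcases hN with ⟨rfl, rfl⟩ | ⟨h, rfl⟩
      · norm_num
      · have : (3 : ℝ) ≤ n := by exact_mod_cast h
        push_cast; linarith) (hasDerivAt_waveProfile i) (hasDerivAt_waveProfileDeriv i)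
    (fun ρ hρ => waveProfile_ode i hρ)
  set V := volume.real (Metric.ball (0 : Rn n) 1)
  refine ⟨max C (2 ^ N * V ^ 2), fun ρ hρ => ?_⟩
  rcases le_total 2 ρ with h | h
  · exact (hC ρ h).trans (le_max_left _ _)
  · refine le_trans ?_ (le_max_right _ _)
    have h1 := abs_waveProfileDeriv_le i ρ
    have h2 : waveProfileDeriv i ρ ^ 2 ≤ V ^ 2 := by
      rw [← sq_abs]; exact pow_le_pow_left₀ (abs_nonneg _) h1 2
    exact mul_le_mul (pow_le_pow_left₀ hρ.le h N) h2 (sq_nonneg _) (by positivity)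

theorem integral_mul_cos_eq_of_norm_eq {G : Rn n → ℝ} (hr : ∀ p q, ‖p‖ = ‖q‖ → G p = G q)
    {z z' : Rn n} (h : ‖z‖ = ‖z'‖) :
    ∫ p, G p * Real.cos ⟪z, p⟫ = ∫ p, G p * Real.cos ⟪z', p⟫ := by
  obtain ⟨R, rfl⟩ := exists_linearIsometryEquiv_apply_eq h
  rw [← R.measurePreserving.integral_comp R.toHomeomorph.measurableEmbedding
    (fun p => G p * Real.cos ⟪R z, p⟫)]
  congr 1
  ext p
  rw [R.inner_map_map, hr (R p) p (R.norm_map p)]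

theorem integral_smul_cexp_eq_cos {G : Rn n → ℝ} (hG : Integrable G) (hr : ∀ p q, ‖p‖ = ‖q‖ → G p = G q)
    (z : Rn n) :
    ∫ p, G p • Complex.exp (Complex.I * (⟪z, p⟫ : ℝ)) = ((∫ p, G p * Real.cos ⟪z, p⟫ : ℝ) : ℂ) := by
  have hint : ∀ z : Rn n, Integrable fun p => G p • Complex.exp (Complex.I * (⟪z, p⟫ : ℝ)) := fun z =>
    hG.ofReal.mul_bdd (c := 1) (by fun_prop) (Eventually.of_forall fun p => by
      rw [mul_comm, Complex.norm_exp_ofReal_mul_I])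
  have h1 : ∫ p, G p • Complex.exp (Complex.I * (⟪z, p⟫ : ℝ)) =
      ∫ p, G p • Complex.exp (Complex.I * (⟪-z, p⟫ : ℝ)) := by
    rw [← integral_neg_eq_self (fun p => G p • Complex.exp (Complex.I * (⟪-z, p⟫ : ℝ)))]
    congr 1
    ext p
    rw [hr (-p) p (norm_neg p), inner_neg_neg]
  have h2 : (2 : ℂ) * ∫ p, G p • Complex.exp (Complex.I * (⟪z, p⟫ : ℝ)) =
      2 * ((∫ p, G p * Real.cos ⟪z, p⟫ : ℝ) : ℂ) := by
    rw [two_mul]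
    nth_rewrite 2 [h1]
    rw [← integral_add (hint z) (hint (-z)), ← integral_complex_ofReal, ← integral_const_mul]
    congr 1
    ext p
    rw [inner_neg_left, Complex.real_smul, Complex.real_smul]
    push_cast
    rw [mul_left_comm 2, Complex.two_cos]
    rw [mul_comm Complex.I, mul_comm Complex.I]
    ring
  exact mul_left_cancel₀ two_ne_zero h2

/-- The integral depends on z only through |z|, so it may be averaged over the vectors |z|ω/|ω| with
ω in the unit ball; Fubini moves the average onto the plane wave. -/
theorem integral_smul_cexp_eq_sphericalWave [NeZero n] {G : Rn n → ℝ} (hG : Integrable G)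
    (hr : ∀ p q, ‖p‖ = ‖q‖ → G p = G q) (z : Rn n) :
    ∫ p, G p • Complex.exp (Complex.I * (⟪z, p⟫ : ℝ)) =
      ∫ p, G p • ((sphericalWave (‖z‖ • p) / volume.real (Metric.ball (0 : Rn n) 1) : ℝ) : ℂ) := by
  set V := volume.real (Metric.ball (0 : Rn n) 1) with hV
  have hV0 : V ≠ 0 := by
    rw [hV, Measure.real, ENNReal.toReal_ne_zero]
    exact ⟨(Metric.measure_ball_pos _ _ one_pos).ne', measure_ball_lt_top.ne⟩
  rw [integral_smul_cexp_eq_cos hG hr]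
  have e1 : ∀ p, G p • ((sphericalWave (‖z‖ • p) / V : ℝ) : ℂ) =
    ((G p * sphericalWave (‖z‖ • p) / V : ℝ) : ℂ) := fun p => by
      rw [Complex.real_smul]; push_cast; ring
  simp_rw [e1]
  rw [integral_complex_ofReal, Complex.ofReal_inj, integral_div, eq_div_iff hV0]
  have h0 : ∀ᵐ ω ∂(volume.restrict (Metric.ball (0 : Rn n) 1)), ω ≠ 0 :=
    ae_restrict_of_ae (by simp [ae_iff])
  have h2 : ∫ ω in Metric.ball (0 : Rn n) 1, ∫ p, G p * Real.cos ⟪‖z‖ • (‖ω‖⁻¹ • ω), p⟫ =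
      ∫ ω in Metric.ball (0 : Rn n) 1, ∫ p, G p * Real.cos ⟪z, p⟫ := by
    refine integral_congr_ae ?_
    filter_upwards [h0] with ω hω
    refine integral_mul_cos_eq_of_norm_eq hr ?_
    rw [norm_smul, norm_smul, norm_norm, norm_inv, norm_norm, inv_mul_cancel₀ (norm_ne_zero_iff.2 hω),
      mul_one]
  rw [setIntegral_const, smul_eq_mul, mul_comm] at h2
  rw [← h2, integral_integral_swap]
  · congr 1
    ext p
    rw [integral_const_mul, sphericalWave]
    simp only [inner_smul_left, inner_smul_right]
    rfl
  · refine (hG.comp_snd _).mul_bdd (c := 1) ?_ (Eventually.of_forall fun p => Real.abs_cos_le_one _)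
    have h : Continuous fun x : Rn n × Rn n => Real.cos ⟪‖z‖ • x.1, x.2⟫ := by fun_prop
    exact (h.measurable.comp ((measurable_direction.comp measurable_fst).prodMk measurable_snd)).aestronglyMeasurable

end SphericalWave

/-- The normalised spherical wave with momentum `p`, as a function of the distance `t`. -/
noncomputable def meanWave {n : ℕ} (t : ℝ) (p : Rn n) : ℂ :=
  ((sphericalWave (t • p) / volume.real (Metric.ball (0 : Rn n) 1) : ℝ) : ℂ)

section MeanWave

variable {n : ℕ}

theorem volume_real_ball_pos [NeZero n] : 0 < volume.real (Metric.ball (0 : Rn n) 1) :=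
  ENNReal.toReal_pos (Metric.measure_ball_pos _ _ one_pos).ne' measure_ball_lt_top.ne

theorem contDiff_meanWave (t : ℝ) : ContDiff ℝ 1 (meanWave t : Rn n → ℂ) :=
  Complex.ofRealCLM.contDiff.comp ((contDiff_sphericalWave.comp (contDiff_const_smul t)).div_const _)

theorem norm_meanWave_le [NeZero n] (t : ℝ) (p : Rn n) : ‖meanWave t p‖ ≤ 1 := by
  rw [meanWave, Complex.norm_real, Real.norm_eq_abs, abs_div, abs_of_pos (volume_real_ball_pos (n := n))]
  exact div_le_one_of_le₀ (abs_sphericalWave_le _) volume_real_ball_pos.le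

theorem norm_fderiv_meanWave_le (i : Fin n) {t : ℝ} (ht : 0 < t) {p : Rn n} (hp : p ≠ 0) :
    ‖fderiv ℝ (meanWave t) p‖ ≤
      t * |waveProfileDeriv i (t * ‖p‖)| / volume.real (Metric.ball (0 : Rn n) 1) := by
  have hq : t • p ≠ 0 := smul_ne_zero ht.ne' hp
  have h1 : HasFDerivAt (fun p : Rn n => sphericalWave (t • p))
      ((fderiv ℝ sphericalWave (t • p)).comp (t • ContinuousLinearMap.id ℝ (Rn n))) p :=
    ((contDiff_sphericalWave.differentiable (by simp)) (t • p)).hasFDerivAt.comp p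
      ((hasFDerivAt_id p).const_smul t)
  have h2 := Complex.ofRealCLM.hasFDerivAt.comp p
    (h1.mul_const ((volume.real (Metric.ball (0 : Rn n) 1))⁻¹))
  have h3 : (meanWave t : Rn n → ℂ) = Complex.ofRealCLM ∘ fun p : Rn n =>
    sphericalWave (t • p) * (volume.real (Metric.ball (0 : Rn n) 1))⁻¹ := by
      ext p; simp [meanWave, div_eq_mul_inv]
  rw [h3, h2.fderiv]
  refine (ContinuousLinearMap.opNorm_comp_le _ _).trans ?_
  rw [Complex.ofRealCLM_norm, one_mul, norm_smul, norm_inv, Real.norm_eq_abs, abs_of_nonneg measureReal_nonneg,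
    inv_mul_eq_div]
  refine div_le_div_of_nonneg_right ?_ measureReal_nonneg
  refine (ContinuousLinearMap.opNorm_comp_le _ _).trans ?_
  rw [mul_comm, norm_smul, Real.norm_eq_abs, abs_of_pos ht]
  have h4 := norm_fderiv_sphericalWave_le i hq
  rw [norm_smul, Real.norm_eq_abs, abs_of_pos ht] at h4
  refine mul_le_mul ?_ h4 (norm_nonneg _) ht.le
  exact mul_le_of_le_one_right ht.le ContinuousLinearMap.norm_id_le

/-- The gradient is controlled by t times the derivative of the profile at t|p|, whose square decays
like (t|p|)^(-N). Keeping p away from the origin turns this into t^(2-N). -/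
theorem exists_sq_norm_fderiv_meanWave_le (hn : 2 ≤ n) {N : ℕ}
    (hN : (n = 2 ∧ N = 1) ∨ (3 ≤ n ∧ N = 2)) {c : ℝ} (hc : 0 < c) :
    ∃ C, 0 ≤ C ∧ ∀ t ≥ 0, ∀ p : Rn n, c ≤ ‖p‖ → ‖fderiv ℝ (meanWave t) p‖ ^ 2 ≤ C * t ^ (2 - N) := by
  have : NeZero n := ⟨by omega⟩
  obtain ⟨C, hC⟩ := exists_waveProfileDeriv_decay hn (0 : Fin n) hN
  have hC0 : 0 ≤ C := (by positivity : (0 : ℝ) ≤ 1 ^ N * waveProfileDeriv (0 : Fin n) 1 ^ 2).trans (hC 1 one_pos)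
  set V := volume.real (Metric.ball (0 : Rn n) 1) with hV
  have hV0 : 0 < V := volume_real_ball_pos
  refine ⟨C / c ^ N / V ^ 2, by positivity, fun t ht p hp => ?_⟩
  rcases ht.eq_or_lt with rfl | ht
  · have : (meanWave 0 : Rn n → ℂ) = fun _ => meanWave 0 (0 : Rn n) := by
      ext p; simp [meanWave]
    rw [this]
    simp only [fderiv_fun_const, Pi.zero_apply, norm_zero, zero_pow two_ne_zero]
    positivity
  have hp0 : 0 < ‖p‖ := hc.trans_le hp
  have h1 := norm_fderiv_meanWave_le (0 : Fin n) ht (norm_pos_iff.1 hp0)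
  have h2 := pow_le_pow_left₀ (norm_nonneg _) h1 2
  refine h2.trans ?_
  have h3 := hC (t * ‖p‖) (by positivity)
  have h4 : (t * c) ^ N * waveProfileDeriv (0 : Fin n) (t * ‖p‖) ^ 2 ≤ C := by
    refine le_trans ?_ h3
    gcongr
  rw [← hV, div_pow, mul_pow, sq_abs, div_mul_eq_mul_div]
  refine div_le_div_of_nonneg_right ?_ (by positivity)
  rw [div_mul_eq_mul_div, le_div_iff₀ (by positivity)]
  have h5 : t ^ 2 = t ^ (2 - N) * t ^ N := by
    rw [← pow_add]; congr 1; omega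
  rw [h5]
  calc t ^ (2 - N) * t ^ N * waveProfileDeriv (0 : Fin n) (t * ‖p‖) ^ 2 * c ^ N
      = t ^ (2 - N) * ((t * c) ^ N * waveProfileDeriv (0 : Fin n) (t * ‖p‖) ^ 2) := by rw [mul_pow]; ring
    _ ≤ t ^ (2 - N) * C := by gcongr
    _ = _ := by ring

end MeanWave

/-! ### Radial symbols and bounds for the kernel -/

namespace KineticSymbol

variable {n : ℕ} {K : KineticSymbol n} {χ : Rn n → ℝ}

theorem IsRadial.abs_P_eq (hK : K.IsRadial) {p q : Rn n} (h : ‖p‖ = ‖q‖) : |K.P p| = |K.P q| :=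
  (Real.rpow_left_inj (abs_nonneg _) (abs_nonneg _) K.r_pos.ne').1 (hK p q h)

/-- If P(0) = 0, then |⟪∇P(0), u⟫| is the limit of |P(tu)|/|t| and depends on |u| only. Every
coordinate of the gradient then has the full length of the gradient, which for n ≥ 2 contradicts
∇P(0) ≠ 0. -/
theorem IsRadial.zero_notMem_S (hK : K.IsRadial) (hn : 2 ≤ n) : (0 : Rn n) ∉ K.S := by
  intro h0
  have hmem := K.S_subset_interior h0
  have hP0 : K.P 0 = 0 := by rw [S_eq] at h0; exact h0
  set a := gradient K.P 0 with ha
  have ha0 : a ≠ 0 := K.gradient_ne_zero 0 hmem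
  have hd : DifferentiableAt ℝ K.P 0 :=
    (K.contDiffOn_one.contDiffAt (isOpen_interior.mem_nhds hmem)).differentiableAt (by simp)
  have hlim : ∀ u : Rn n, Tendsto (fun t : ℝ => |t⁻¹| * |K.P (t • u)|) (𝓝[≠] 0) (𝓝 |⟪a, u⟫|) := by
    intro u
    have h1 : HasDerivAt (fun t : ℝ => K.P (t • u)) ⟪a, u⟫ 0 := by
      have h2 : HasDerivAt (fun t : ℝ => t • u) u 0 := by
        simpa using (hasDerivAt_id (0 : ℝ)).smul_const u
      have h3 : HasFDerivAt K.P (fderiv ℝ K.P 0) ((0 : ℝ) • u) := by rw [zero_smul]; exact hd.hasFDerivAt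
      have := h3.comp_hasDerivAt (0 : ℝ) h2
      rwa [gradient_eq_inner] at this
    have h4 := (hasDerivAt_iff_tendsto_slope.1 h1).abs
    refine h4.congr fun t => ?_
    rw [slope_def_field, zero_smul, hP0, sub_zero, sub_zero, abs_div, abs_inv, div_eq_inv_mul]
  have heq : ∀ u v : Rn n, ‖u‖ = ‖v‖ → |⟪a, u⟫| = |⟪a, v⟫| := fun u v huv =>
    tendsto_nhds_unique (hlim u) ((hlim v).congr fun t => by
      rw [hK.abs_P_eq (p := t • v) (q := t • u) (by rw [norm_smul, norm_smul, huv])])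
  have hi : ∀ i, a i ^ 2 = ‖a‖ ^ 2 := by
    intro i
    have h1 := heq (‖a‖ • stdVec i) a (by simp [norm_smul])
    rw [inner_smul_right, stdVec, EuclideanSpace.inner_single_right, real_inner_self_eq_norm_sq] at h1
    have h2 : ‖a‖ * |a i| = ‖a‖ ^ 2 := by simpa [abs_mul] using h1
    have h3 : |a i| = ‖a‖ := by
      rw [pow_two] at h2; exact mul_left_cancel₀ (norm_ne_zero_iff.2 ha0) h2
    rw [← sq_abs, h3]
  have hs := EuclideanSpace.real_norm_sq_eq a
  simp_rw [hi] at hs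
  rw [Finset.sum_const, Finset.card_univ, Fintype.card_fin, nsmul_eq_mul] at hs
  have h2 : (2 : ℝ) ≤ n := by exact_mod_cast hn
  have h3 : 0 < ‖a‖ ^ 2 := by positivity
  nlinarith

/-- The cutoff is a function of |p|. Its support must avoid the origin, both for smoothness of the
norm and because the gradient of the mean wave is estimated only for |p| ≥ c; this is possible since
S misses 0. -/
theorem IsRadial.exists_isCutoff (hK : K.IsRadial) (hn : 2 ≤ n) :
    ∃ χ, K.IsCutoff χ ∧ (∀ p q, ‖p‖ = ‖q‖ → χ p = χ q) ∧ ∃ c > 0, ∀ p ∈ tsupport χ, c ≤ ‖p‖ := by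
  set R : Set ℝ := norm '' K.S with hR
  set U : Set ℝ := Metric.thickening K.σ R ∩ Ioi 0 with hU
  have hRU : R ⊆ U := by
    rintro _ ⟨p, hp, rfl⟩
    refine ⟨Metric.self_subset_thickening K.σ_pos _ ⟨p, hp, rfl⟩, norm_pos_iff.2 ?_⟩
    rintro rfl
    exact hK.zero_notMem_S hn hp
  obtain ⟨b, hb, hbc, hbU, hb1, hb01⟩ := exists_contDiff_cutoff
    (K.isCompact_S.image continuous_norm) (Metric.isOpen_thickening.inter isOpen_Ioi) hRU
  have h0 : (0 : ℝ) ∉ tsupport b := fun h => lt_irrefl (0 : ℝ) (hbU h).2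
  have hsub : tsupport (fun p : Rn n => b ‖p‖) ⊆ norm ⁻¹' tsupport b :=
    closure_minimal (fun p hp => subset_tsupport b hp)
      ((isClosed_tsupport b).preimage continuous_norm)
  obtain ⟨c, hc, hcb⟩ := Metric.isOpen_iff.1 (isClosed_tsupport b).isOpen_compl 0 h0
  refine ⟨fun p => b ‖p‖, ⟨?_, ?_, ?_, ?_, fun p => hb01 _⟩, fun p q h => by simp only [h], c, hc, fun p hp => ?_⟩
  · refine contDiff_iff_contDiffAt.2 fun p => ?_
    by_cases hp : p = 0
    · subst hp
      have h1 : ∀ᶠ t in 𝓝 (0 : ℝ), b t = 0 := by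
        filter_upwards [(isClosed_tsupport b).isOpen_compl.mem_nhds h0] with t ht
        exact image_eq_zero_of_notMem_tsupport ht
      have h2 : ∀ᶠ p in 𝓝 (0 : Rn n), b ‖p‖ = 0 := by
        have : Tendsto (norm : Rn n → ℝ) (𝓝 0) (𝓝 0) := by
          simpa using (continuous_norm (E := Rn n)).tendsto 0
        exact this.eventually h1
      exact (contDiffAt_const (c := (0 : ℝ))).congr_of_eventuallyEq h2
    · exact (hb.contDiffAt).comp p (contDiffAt_norm ℝ hp)
  · have hcpt : IsCompact (norm ⁻¹' tsupport b : Set (Rn n)) := by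
      refine Metric.isCompact_of_isClosed_isBounded ((isClosed_tsupport b).preimage continuous_norm) ?_
      obtain ⟨r, hr⟩ := hbc.isCompact.isBounded.subset_closedBall 0
      refine (Metric.isBounded_closedBall (x := (0 : Rn n)) (r := r)).subset fun p hp => ?_
      have := hr hp
      simpa using this
    exact hcpt.of_isClosed_subset (isClosed_tsupport _) hsub
  · intro p hp
    obtain ⟨h1, h2⟩ := hbU (hsub hp)
    obtain ⟨_, ⟨q, hq, rfl⟩, hd⟩ := Metric.mem_thickening_iff.1 h1
    have hp0 : 0 < ‖p‖ := h2
    -- Moving p radially to the radius of q lands in S, since T is radial; the distance moved is the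
    -- difference of the radii, which is below σ.
    set q' := (‖q‖ / ‖p‖) • p with hq'
    have hn' : ‖q'‖ = ‖q‖ := by
      rw [hq', norm_smul, norm_div, norm_norm, norm_norm, div_mul_cancel₀ _ hp0.ne']
    have hqS : q' ∈ K.S := by
      have : K.T q' = K.T q := hK _ _ hn'
      exact this.trans hq
    refine mem_interior.2 ⟨_, K.ball_subset_Ω q' hqS, Metric.isOpen_ball, ?_⟩
    rw [Metric.mem_ball, dist_eq_norm]
    have : p - q' = ((‖p‖ - ‖q‖) / ‖p‖) • p := by
      rw [hq', sub_div, div_self hp0.ne', sub_smul, one_smul]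
    rw [this, norm_smul, norm_div, norm_norm, div_mul_cancel₀ _ hp0.ne']
    exact hd
  · have : Tendsto (norm : Rn n → ℝ) (𝓝ˢ K.S) (𝓝ˢ R) :=
      continuous_norm.tendsto_nhdsSet (mapsTo_image _ _)
    exact this.eventually hb1
  · by_contra! hlt
    exact hcb (by simpa using hlt) (hsub hp)

/-- The surface integrals are limits of Cauchy means, and for those the averaging applies to a
radial volume weight. Only P² has to be radial; P itself may change sign between points of equal
norm. -/
theorem IsCutoff.surface_integral_cexp_eq_meanWave [NeZero n] (hK : K.IsRadial) (hχ : K.IsCutoff χ)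
    (hr : ∀ p q, ‖p‖ = ‖q‖ → χ p = χ q) (z : Rn n) :
    ∫ p, (‖gradient K.P p‖⁻¹ : ℝ) • Complex.exp (Complex.I * (⟪z, p⟫ : ℝ)) ∂K.surface =
      ∫ p, (‖gradient K.P p‖⁻¹ : ℝ) • meanWave ‖z‖ p ∂K.surface := by
  have h1 := hχ.tendsto_integral_smul (F := fun p => Complex.exp (Complex.I * (⟪z, p⟫ : ℝ))) (by fun_prop)
  have h2 := hχ.tendsto_integral_smul (F := meanWave ‖z‖) (contDiff_meanWave _).continuous
  have h3 := tendsto_nhds_unique h1 (h2.congr' ?_)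
  · exact mul_left_cancel₀ (by exact_mod_cast Real.pi_ne_zero) h3
  · filter_upwards [self_mem_nhdsWithin] with τ hτ
    have hτ0 : (0 : ℝ) < τ := hτ
    refine (integral_smul_cexp_eq_sphericalWave ?_ ?_ z).symm
    · refine (hχ.contDiff.continuous.integrable_of_hasCompactSupport hχ.hasCompactSupport).bdd_mul (c := τ⁻¹)
        ?_ (Eventually.of_forall fun p => ?_)
      · exact (measurable_const.div (measurable_const.add (K.measurable_P.pow_const 2))).aestronglyMeasurable
      · rw [Real.norm_eq_abs, abs_of_nonneg (by positivity), ← one_div, div_le_div_iff₀ (by positivity) hτ0]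
        nlinarith [sq_nonneg (K.P p)]
    · intro p q h
      rw [hr p q h, ← sq_abs (K.P p), hK.abs_P_eq h, sq_abs]

theorem IsCutoff.integrable_div (hχ : K.IsCutoff χ) {e : ℝ} (he : 0 < e) :
    Integrable fun p => χ p / (K.T p + e) := by
  simp_rw [div_eq_mul_inv]
  refine (hχ.contDiff.continuous.integrable_of_hasCompactSupport hχ.hasCompactSupport).mul_bdd (c := e⁻¹)
    (K.measurable_T.add_const e).inv.aestronglyMeasurable (Eventually.of_forall fun p => ?_)
  have := K.T_nonneg p
  rw [norm_inv, Real.norm_eq_abs, abs_of_nonneg (by positivity)]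
  exact inv_anti₀ he (by linarith)

theorem IsCutoff.integral_cexp_eq_meanWave [NeZero n] (hK : K.IsRadial) (hχ : K.IsCutoff χ)
    (hr : ∀ p q, ‖p‖ = ‖q‖ → χ p = χ q) {e : ℝ} (he : 0 < e) (z : Rn n) :
    ∫ p, (χ p / (K.T p + e)) • Complex.exp (Complex.I * (⟪z, p⟫ : ℝ)) =
      ∫ p, (χ p / (K.T p + e)) • meanWave ‖z‖ p := by
  refine integral_smul_cexp_eq_sphericalWave (hχ.integrable_div he) ?_ z
  intro p q h
  rw [hr p q h, hK p q h]

/-- The Fourier transform of the singular part of the resolvent minus its leading term. -/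
noncomputable def kernel (K : KineticSymbol n) (χ : Rn n → ℝ) (e : ℝ) (z : Rn n) : ℂ :=
  (∫ p, (χ p / (K.T p + e)) • Complex.exp (Complex.I * (⟪z, p⟫ : ℝ))) -
    K.f e * ∫ p, (‖gradient K.P p‖⁻¹ : ℝ) • Complex.exp (Complex.I * (⟪z, p⟫ : ℝ)) ∂K.surface

/-- The plane wave has modulus 1 and gradient of norm at most |z|, so its C¹ size is 1 + |z|. -/
theorem IsCutoff.exists_norm_kernel_le (hχ : K.IsCutoff χ) :
    ∃ C, ∀ e > 0, ∀ z, ‖K.kernel χ e z‖ ^ 2 ≤ C * K.g e ^ 2 * (1 + ‖z‖ ^ (2 : ℝ)) := by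
  obtain ⟨C, hC, h⟩ := hχ.exists_kernel_bound
  refine ⟨2 * C ^ 2, fun e he z => ?_⟩
  have h1 := h e he (fun p => Complex.exp (Complex.I * (⟪z, p⟫ : ℝ))) (1 + ‖z‖)
    (contDiff_const.mul (Complex.ofRealCLM.comp (innerSL ℝ z)).contDiff).cexp
    (fun p _ => ⟨?_, ?_⟩) (by positivity)
  · have hg := K.one_le_g he
    refine (pow_le_pow_left₀ (norm_nonneg _) h1 2).trans ?_
    rw [Real.rpow_two, mul_pow, mul_pow]
    have : (1 + ‖z‖) ^ 2 ≤ 2 * (1 + ‖z‖ ^ 2) := by nlinarith [sq_nonneg (1 - ‖z‖)]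
    calc C ^ 2 * (1 + ‖z‖) ^ 2 * K.g e ^ 2 ≤ C ^ 2 * (2 * (1 + ‖z‖ ^ 2)) * K.g e ^ 2 := by gcongr
      _ = _ := by ring
  · rw [mul_comm, Complex.norm_exp_ofReal_mul_I]
    linarith [norm_nonneg z]
  · have h2 : HasFDerivAt (fun p : Rn n => Complex.exp (Complex.I * (⟪z, p⟫ : ℝ)))
        (Complex.exp (Complex.I * (⟪z, p⟫ : ℝ)) • (Complex.I • (Complex.ofRealCLM.comp (innerSL ℝ z)))) p :=
      ((((Complex.ofRealCLM.comp (innerSL ℝ z)).hasFDerivAt (x := p)).const_mul Complex.I)).cexp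
    rw [h2.fderiv, norm_smul, norm_smul, mul_comm Complex.I, Complex.norm_exp_ofReal_mul_I, Complex.norm_I, one_mul,
      one_mul]
    refine (ContinuousLinearMap.opNorm_comp_le _ _).trans ?_
    rw [Complex.ofRealCLM_norm, one_mul, innerSL_apply_norm]
    linarith

/-- Averaging both integrals replaces the plane wave by the mean wave, of C¹ size at most 1 + √D
with D a multiple of |z|^(2-N). -/
theorem IsRadial.exists_norm_kernel_le (hn : 2 ≤ n) (hK : K.IsRadial) {N : ℕ}
    (hN : (n = 2 ∧ N = 1) ∨ (3 ≤ n ∧ N = 2)) :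
    ∃ χ, K.IsCutoff χ ∧ ∃ C, ∀ e > 0, ∀ z, ‖K.kernel χ e z‖ ^ 2 ≤ C * K.g e ^ 2 * (1 + ‖z‖ ^ (2 - N)) := by
  have : NeZero n := ⟨by omega⟩
  obtain ⟨χ, hχ, hr, c, hc, hcχ⟩ := hK.exists_isCutoff hn
  obtain ⟨C, hC, h⟩ := hχ.exists_kernel_bound
  obtain ⟨C', hC', h'⟩ := exists_sq_norm_fderiv_meanWave_le hn hN hc
  refine ⟨χ, hχ, 2 * C ^ 2 * (1 + C'), fun e he z => ?_⟩
  set D := C' * ‖z‖ ^ (2 - N) with hD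
  have hD0 : 0 ≤ D := by positivity
  have h1 := h e he (meanWave ‖z‖) (1 + √D) (contDiff_meanWave _) (fun p hp => ⟨?_, ?_⟩) (by positivity)
  · have hg := K.one_le_g he
    rw [kernel, hχ.integral_cexp_eq_meanWave hK hr he, hχ.surface_integral_cexp_eq_meanWave hK hr]
    refine (pow_le_pow_left₀ (norm_nonneg _) h1 2).trans ?_
    rw [mul_pow, mul_pow]
    have h2 : (1 + √D) ^ 2 ≤ 2 * (1 + D) := by nlinarith [sq_nonneg (1 - √D), Real.sq_sqrt hD0]
    have h3 : 1 + D ≤ (1 + C') * (1 + ‖z‖ ^ (2 - N)) := by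
      have : 0 ≤ ‖z‖ ^ (2 - N) := by positivity
      nlinarith
    calc C ^ 2 * (1 + √D) ^ 2 * K.g e ^ 2 ≤ C ^ 2 * (2 * ((1 + C') * (1 + ‖z‖ ^ (2 - N)))) * K.g e ^ 2 := by
          gcongr; linarith
      _ = _ := by ring
  · exact (norm_meanWave_le _ _).trans (by linarith [Real.sqrt_nonneg D])
  · have h2 := Real.le_sqrt_of_sq_le (h' ‖z‖ (norm_nonneg _) p (hcχ p hp))
    linarith

theorem exists_norm_kernel_le (K : KineticSymbol n) (hn : 2 ≤ n) {κ : ℝ} (hκ : K.AdmissibleWeight κ) :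
    ∃ χ, K.IsCutoff χ ∧ ∃ C, ∀ e > 0, ∀ z, ‖K.kernel χ e z‖ ^ 2 ≤ C * K.g e ^ 2 * (1 + ‖z‖ ^ κ) := by
  rcases hκ with rfl | ⟨hK, h3, rfl⟩ | ⟨hK, h2, rfl⟩
  · obtain ⟨χ, hχ⟩ := K.exists_isCutoff
    exact ⟨χ, hχ, hχ.exists_norm_kernel_le⟩
  · simpa using hK.exists_norm_kernel_le hn (N := 2) (Or.inr ⟨h3, rfl⟩)
  · simpa using hK.exists_norm_kernel_le hn (N := 1) (Or.inl ⟨h2, rfl⟩)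

end KineticSymbol

/-! ### Fourier transform on L² and operators with L² kernels -/

section FourierCompatibility

variable {n : ℕ}

theorem locallyIntegrable_L2 (u : L2 n) : LocallyIntegrable (u : Rn n → ℂ) :=
  (Lp.memLp u).locallyIntegrable one_le_two

theorem exists_schwartzMap_eq {g : Rn n → ℝ} (hg : ContDiff ℝ (⊤ : ℕ∞) g) (hc : HasCompactSupport g) :
    ∃ G : SchwartzMap (Rn n) ℂ, ∀ x, G x = (g x : ℂ) := by
  have hc' : HasCompactSupport fun x => (g x : ℂ) := hc.comp_left (g := Complex.ofReal) rfl
  exact ⟨hc'.toSchwartzMap (Complex.ofRealCLM.contDiff.comp hg), fun x => rfl⟩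

/-- Against smooth compactly supported test functions, both sides move the transform onto the test
function: the L² transform because it agrees with that of tempered distributions, the integral by
the multiplication formula. -/
theorem fourier_toLp_ae_eq {h : Rn n → ℂ} (h1 : Integrable h) (h2 : MemLp h 2) :
    (𝓕 (h2.toLp h : L2 n) : L2 n) =ᵐ[volume] 𝓕 h := by
  have hcont : Continuous (𝓕 h) := VectorFourier.fourierIntegral_continuous Real.continuous_fourierChar
    (L := innerₗ (Rn n)) continuous_inner h1
  refine ae_eq_of_integral_contDiff_smul_eq (locallyIntegrable_L2 _) hcont.locallyIntegrable
    fun g hg hc => ?_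
  obtain ⟨G, hG⟩ := exists_schwartzMap_eq hg hc
  have e1 := congrArg (fun D => D G) (Lp.fourier_toTemperedDistribution_eq (h2.toLp h : L2 n))
  simp only [TemperedDistribution.fourier_apply, Lp.toTemperedDistribution_apply] at e1
  have e2 : ∫ x, g x • (𝓕 (h2.toLp h : L2 n) : L2 n) x = ∫ x, G x • (𝓕 (h2.toLp h : L2 n) : L2 n) x := by
    congr 1; ext x; rw [hG]; rfl
  have e3 : ∫ x, g x • 𝓕 h x = ∫ x, G x • 𝓕 h x := by
    congr 1; ext x; rw [hG]; rfl
  rw [e2, e3, ← e1]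
  have e4 : ∫ x, (𝓕 G) x • (h2.toLp h : L2 n) x = ∫ x, 𝓕 (G : Rn n → ℂ) x • h x := by
    refine integral_congr_ae ?_
    filter_upwards [h2.coeFn_toLp] with x hx
    rw [hx, SchwartzMap.fourier_coe]
  rw [e4]
  have := VectorFourier.integral_fourierIntegral_smul_eq_flip (L := innerₗ (Rn n)) (μ := volume) (ν := volume)
    Real.continuous_fourierChar continuous_inner G.integrable h1
  rw [flip_innerₗ] at this
  exact this

theorem fourierInv_toLp_ae_eq {h : Rn n → ℂ} (h1 : Integrable h) (h2 : MemLp h 2) :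
    (𝓕⁻ (h2.toLp h : L2 n) : L2 n) =ᵐ[volume] 𝓕⁻ h := by
  have hL : Continuous fun p : Rn n × Rn n => (-innerₗ (Rn n)) p.1 p.2 := by
    simp only [LinearMap.neg_apply, innerₗ_apply_apply]; fun_prop
  have hcont : Continuous (𝓕⁻ h) := VectorFourier.fourierIntegral_continuous Real.continuous_fourierChar
    (L := -innerₗ (Rn n)) hL h1
  refine ae_eq_of_integral_contDiff_smul_eq (locallyIntegrable_L2 _) hcont.locallyIntegrable
    fun g hg hc => ?_
  obtain ⟨G, hG⟩ := exists_schwartzMap_eq hg hc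
  have e1 := congrArg (fun D => D G) (Lp.fourierInv_toTemperedDistribution_eq (h2.toLp h : L2 n))
  simp only [TemperedDistribution.fourierInv_apply, Lp.toTemperedDistribution_apply] at e1
  have e2 : ∫ x, g x • (𝓕⁻ (h2.toLp h : L2 n) : L2 n) x = ∫ x, G x • (𝓕⁻ (h2.toLp h : L2 n) : L2 n) x := by
    congr 1; ext x; rw [hG]; rfl
  have e3 : ∫ x, g x • 𝓕⁻ h x = ∫ x, G x • 𝓕⁻ h x := by
    congr 1; ext x; rw [hG]; rfl
  rw [e2, e3, ← e1]
  have e4 : ∫ x, (𝓕⁻ G) x • (h2.toLp h : L2 n) x = ∫ x, 𝓕⁻ (G : Rn n → ℂ) x • h x := by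
    refine integral_congr_ae ?_
    filter_upwards [h2.coeFn_toLp] with x hx
    rw [hx, SchwartzMap.fourierInv_coe]
  rw [e4]
  have := VectorFourier.integral_fourierIntegral_smul_eq_flip (L := -innerₗ (Rn n)) (μ := volume) (ν := volume)
    Real.continuous_fourierChar hL G.integrable h1
  have hflip : (-innerₗ (Rn n)).flip = -innerₗ (Rn n) := by
    ext x y; simp [real_inner_comm]
  rw [hflip] at this
  exact this

end FourierCompatibility

section SquareIntegrable

variable {α : Type*} [MeasurableSpace α] {μ : Measure α}

theorem eLpNorm_two_sq (f : α → ℂ) : eLpNorm f 2 μ ^ 2 = ∫⁻ y, ‖f y‖ₑ ^ 2 ∂μ := by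
  have h := eLpNorm_nnreal_pow_eq_lintegral (f := f) (μ := μ) (p := 2) (by norm_num)
  simpa using h

theorem memLp_two_iff_lintegral {f : α → ℂ} (hf : AEStronglyMeasurable f μ) :
    MemLp f 2 μ ↔ ∫⁻ y, ‖f y‖ₑ ^ 2 ∂μ < ∞ := by
  rw [← eLpNorm_two_sq, ENNReal.pow_lt_top_iff]
  simp [MemLp, hf]

theorem lintegral_enorm_sq_eq (u : Lp ℂ 2 μ) : ∫⁻ y, ‖u y‖ₑ ^ 2 ∂μ = ENNReal.ofReal (‖u‖ ^ 2) := by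
  rw [← eLpNorm_two_sq, ENNReal.ofReal_pow (norm_nonneg _), ofReal_norm, Lp.enorm_def]

theorem enorm_integral_mul_sq_le {a b : α → ℂ} (ha : AEStronglyMeasurable a μ) (hb : AEStronglyMeasurable b μ) :
    ‖∫ y, a y * b y ∂μ‖ₑ ^ 2 ≤ (∫⁻ y, ‖a y‖ₑ ^ 2 ∂μ) * ∫⁻ y, ‖b y‖ₑ ^ 2 ∂μ := by
  have h1 : ‖∫ y, a y * b y ∂μ‖ₑ ≤ ∫⁻ y, ((fun y => ‖a y‖ₑ) * fun y => ‖b y‖ₑ) y ∂μ := by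
    refine (enorm_integral_le_lintegral_enorm _).trans_eq ?_
    simp [enorm_mul]
  have h2 := ENNReal.lintegral_mul_le_Lp_mul_Lq μ Real.HolderConjugate.two_two ha.enorm hb.enorm
  have h3 := pow_le_pow_left' (h1.trans h2) 2
  refine h3.trans_eq ?_
  simp only [mul_pow, ← ENNReal.rpow_two, ← ENNReal.rpow_mul]
  norm_num

theorem exists_clm_of_ae {T : Lp ℂ 2 μ → α → ℂ} (hm : ∀ u, AEStronglyMeasurable (T u) μ)
    (hadd : ∀ u v, T (u + v) =ᵐ[μ] T u + T v) (hsmul : ∀ (c : ℂ) u, T (c • u) =ᵐ[μ] c • T u)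
    {B : ℝ} (hB : 0 ≤ B) (hb : ∀ u, ∫⁻ x, ‖T u x‖ₑ ^ 2 ∂μ ≤ ENNReal.ofReal (B ^ 2) * ENNReal.ofReal (‖u‖ ^ 2)) :
    ∃ A : Lp ℂ 2 μ →L[ℂ] Lp ℂ 2 μ, ‖A‖ ≤ B ∧ ∀ u, A u =ᵐ[μ] T u := by
  have hT : ∀ u, MemLp (T u) 2 μ := fun u => (memLp_two_iff_lintegral (hm u)).2
    ((hb u).trans_lt (ENNReal.mul_lt_top ENNReal.ofReal_lt_top ENNReal.ofReal_lt_top))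
  let A₀ : Lp ℂ 2 μ →ₗ[ℂ] Lp ℂ 2 μ :=
    { toFun := fun u => (hT u).toLp _
      map_add' := fun u v => by
        rw [← MemLp.toLp_add]
        exact (MemLp.toLp_eq_toLp_iff _ _).2 (hadd u v)
      map_smul' := fun c u => by
        rw [RingHom.id_apply, ← MemLp.toLp_const_smul]
        exact (MemLp.toLp_eq_toLp_iff _ _).2 (hsmul c u) }
  have hA : ∀ u, A₀ u =ᵐ[μ] T u := fun u => (hT u).coeFn_toLp
  have hn : ∀ u, ‖A₀ u‖ ≤ B * ‖u‖ := fun u => by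
    refine (sq_le_sq₀ (norm_nonneg _) (by positivity)).1 ?_
    rw [← ENNReal.ofReal_le_ofReal_iff (by positivity), ← lintegral_enorm_sq_eq, mul_pow,
      ENNReal.ofReal_mul (by positivity)]
    refine le_trans (le_of_eq (lintegral_congr_ae ?_)) (hb u)
    filter_upwards [hA u] with x hx
    rw [hx]
  exact ⟨A₀.mkContinuous B hn, A₀.mkContinuous_norm_le hB hn, hA⟩

/-- An `L²` kernel defines a bounded operator on `L²`. -/
theorem exists_clm_of_kernel [SFinite μ] {k : α × α → ℂ} (hk : AEStronglyMeasurable k (μ.prod μ)) {B : ℝ}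
    (hB : 0 ≤ B) (hkB : ∫⁻ z, ‖k z‖ₑ ^ 2 ∂(μ.prod μ) ≤ ENNReal.ofReal (B ^ 2)) :
    ∃ A : Lp ℂ 2 μ →L[ℂ] Lp ℂ 2 μ, ‖A‖ ≤ B ∧ ∀ u, A u =ᵐ[μ] fun x => ∫ y, k (x, y) * u y ∂μ := by
  have hk2 : AEMeasurable (fun z => ‖k z‖ₑ ^ 2) (μ.prod μ) := hk.enorm.pow_const 2
  have hfin : ∀ᵐ x ∂μ, MemLp (fun y => k (x, y)) 2 μ := by
    have h1 : ∫⁻ x, ∫⁻ y, ‖k (x, y)‖ₑ ^ 2 ∂μ ∂μ ≠ ∞ := by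
      rw [← lintegral_prod _ hk2]
      exact (hkB.trans_lt ENNReal.ofReal_lt_top).ne
    filter_upwards [ae_lt_top' hk2.lintegral_prod_right' h1, hk.prodMk_left] with x hx hx'
    exact (memLp_two_iff_lintegral hx').2 hx
  have hint : ∀ u : Lp ℂ 2 μ, ∀ᵐ x ∂μ, Integrable (fun y => k (x, y) * u y) μ := fun u => by
    filter_upwards [hfin] with x hx
    exact hx.integrable_mul (Lp.memLp u)
  refine exists_clm_of_ae (fun u => ?_) (fun u v => ?_) (fun c u => ?_) hB fun u => ?_
  · exact (hk.mul (Lp.memLp u).1.comp_snd).integral_prod_right'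
  · filter_upwards [hint u, hint v] with x hu hv
    rw [Pi.add_apply, ← integral_add hu hv]
    refine integral_congr_ae ?_
    filter_upwards [Lp.coeFn_add u v] with y hy
    rw [hy, Pi.add_apply, mul_add]
  · refine Eventually.of_forall fun x => ?_
    rw [Pi.smul_apply, smul_eq_mul, ← integral_const_mul]
    refine integral_congr_ae ?_
    filter_upwards [Lp.coeFn_smul c u] with y hy
    rw [hy, Pi.smul_apply, smul_eq_mul, mul_left_comm]
  · have h1 : ∫⁻ x, ‖∫ y, k (x, y) * u y ∂μ‖ₑ ^ 2 ∂μ ≤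
        ∫⁻ x, (∫⁻ y, ‖k (x, y)‖ₑ ^ 2 ∂μ) * ENNReal.ofReal (‖u‖ ^ 2) ∂μ := by
      refine lintegral_mono_ae ?_
      filter_upwards [hk.prodMk_left] with x hx
      rw [← lintegral_enorm_sq_eq]
      exact enorm_integral_mul_sq_le hx (Lp.memLp u).1
    refine h1.trans ?_
    rw [lintegral_mul_const'' _ hk2.lintegral_prod_right', ← lintegral_prod _ hk2]
    gcongr

end SquareIntegrable

/-! ### Fourier multipliers and the critical Sobolev inequality -/

theorem lintegral_ball_norm_rpow_neg {n : ℕ} {t R : ℝ} (ht : t < n) (hn : n ≠ 0) (hR : 0 ≤ R) :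
    ∫⁻ ξ in Metric.ball (0 : Rn n) R, ENNReal.ofReal (‖ξ‖ ^ (-t)) =
      ENNReal.ofReal (n * volume.real (Metric.ball (0 : Rn n) 1) / (n - t) * R ^ ((n : ℝ) - t)) := by
  have : NeZero n := ⟨hn⟩
  have hd : Module.finrank ℝ (Rn n) = n := by simp
  have hcongr : ∀ y ∈ Ioo (0 : ℝ) R, y ^ (n - 1) • y ^ (-t) = y ^ ((n : ℝ) - 1 - t) := fun y hy => by
    rw [smul_eq_mul, ← Real.rpow_natCast, ← Real.rpow_add hy.1, Nat.cast_sub (by omega), Nat.cast_one]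
    congr 1
  have hii : IntervalIntegrable (fun y : ℝ => y ^ ((n : ℝ) - 1 - t)) volume 0 R :=
    intervalIntegral.intervalIntegrable_rpow' (by linarith)
  have hio : IntegrableOn (fun y : ℝ => y ^ ((n : ℝ) - 1 - t)) (Ioo 0 R) :=
    ((intervalIntegrable_iff_integrableOn_Ioo_of_le hR).1 hii)
  have hint : IntegrableOn (fun ξ : Rn n => ‖ξ‖ ^ (-t)) (Metric.ball 0 R) := by
    rw [integrableOn_fun_norm_addHaar volume (f := fun y : ℝ => y ^ (-t)), hd]
    exact hio.congr_fun (fun y hy => (hcongr y hy).symm) measurableSet_Ioo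
  rw [← ofReal_integral_eq_lintegral_ofReal hint (Eventually.of_forall fun ξ => by positivity)]
  congr 1
  rw [← integral_indicator measurableSet_ball]
  have e1 : ∀ ξ : Rn n, (Metric.ball (0 : Rn n) R).indicator (fun ξ => ‖ξ‖ ^ (-t)) ξ =
      (Iio R).indicator (fun y : ℝ => y ^ (-t)) ‖ξ‖ := fun ξ => by
    by_cases h : ‖ξ‖ < R <;> simp [h]
  simp_rw [e1]
  rw [integral_fun_norm_addHaar volume ((Iio R).indicator fun y : ℝ => y ^ (-t)), hd]
  have e2 : ∫ y in Ioi (0 : ℝ), y ^ (n - 1) • (Iio R).indicator (fun y : ℝ => y ^ (-t)) y =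
      R ^ ((n : ℝ) - t) / (n - t) := by
    have : ∫ y in Ioi (0 : ℝ), y ^ (n - 1) • (Iio R).indicator (fun y : ℝ => y ^ (-t)) y =
        ∫ y in Ioi (0 : ℝ), (Iio R).indicator (fun y : ℝ => y ^ (n - 1) • y ^ (-t)) y := by
      congr 1; ext y; by_cases h : y < R <;> simp [h]
    rw [this, setIntegral_indicator measurableSet_Iio, Ioi_inter_Iio,
      setIntegral_congr_fun measurableSet_Ioo hcongr, ← integral_Ioc_eq_integral_Ioo,
      ← intervalIntegral.integral_of_le hR, integral_rpow (Or.inl (by linarith))]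
    rw [Real.zero_rpow (by linarith)]
    congr 1 <;> [skip; ring]
    rw [sub_zero]
    congr 1; ring
  rw [e2, nsmul_eq_mul, smul_eq_mul]
  ring

theorem lintegral_Ioc_rpow {b c : ℝ} (hb : 0 ≤ b) (hc : 0 < c) :
    ∫⁻ l in Ioc 0 b, ENNReal.ofReal (l ^ (c - 1)) = ENNReal.ofReal (b ^ c / c) := by
  have hii : IntervalIntegrable (fun y : ℝ => y ^ (c - 1)) volume 0 b :=
    intervalIntegral.intervalIntegrable_rpow' (by linarith)
  rw [← ofReal_integral_eq_lintegral_ofReal ((intervalIntegrable_iff_integrableOn_Ioc_of_le hb).1 hii)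
    (ae_restrict_of_forall_mem measurableSet_Ioc fun y hy => Real.rpow_nonneg hy.1.le _),
    ← intervalIntegral.integral_of_le hb, integral_rpow (Or.inl (by linarith)), sub_add_cancel,
    Real.zero_rpow hc.ne', sub_zero]

section Multiplier

variable {n : ℕ}

/-- A bounded measurable real multiplier. -/
structure IsMultiplier (a : Rn n → ℝ) : Prop where
  measurable : Measurable a
  exists_bound : ∃ c, ∀ ξ, |a ξ| ≤ c

variable {a : Rn n → ℝ}

theorem IsMultiplier.memLp (ha : IsMultiplier a) (u : L2 n) : MemLp (fun ξ => (a ξ : ℂ) * u ξ) 2 volume := by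
  obtain ⟨c, hc⟩ := ha.exists_bound
  refine (Lp.memLp u).of_le_mul (c := c)
    ((Complex.measurable_ofReal.comp ha.measurable).aestronglyMeasurable.mul (Lp.memLp u).1)
    (Eventually.of_forall fun ξ => ?_)
  rw [norm_mul, Complex.norm_real]
  exact mul_le_mul_of_nonneg_right (hc ξ) (norm_nonneg _)

theorem IsMultiplier.indicator (ha : IsMultiplier a) {s : Set (Rn n)} (hs : MeasurableSet s) :
    IsMultiplier (s.indicator a) := by
  obtain ⟨c, hc⟩ := ha.exists_bound
  refine ⟨ha.measurable.indicator hs, c, fun ξ => ?_⟩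
  rw [← Real.norm_eq_abs]
  exact (norm_indicator_le_norm_self _ _).trans (hc ξ)

/-- The Fourier multiplier acting on functions of momentum, with values in functions of position. -/
noncomputable def IsMultiplier.op (ha : IsMultiplier a) (u : L2 n) : L2 n := 𝓕⁻ ((ha.memLp u).toLp _)

theorem IsMultiplier.op_add (ha : IsMultiplier a) (u v : L2 n) : ha.op (u + v) = ha.op u + ha.op v := by
  rw [IsMultiplier.op, IsMultiplier.op, IsMultiplier.op, ← FourierTransform.fourierInv_add, ← MemLp.toLp_add]
  congr 1
  refine (MemLp.toLp_eq_toLp_iff _ _).2 ?_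
  filter_upwards [Lp.coeFn_add u v] with ξ h
  rw [h, Pi.add_apply, Pi.add_apply, mul_add]

theorem IsMultiplier.op_smul (ha : IsMultiplier a) (c : ℂ) (u : L2 n) : ha.op (c • u) = c • ha.op u := by
  rw [IsMultiplier.op, IsMultiplier.op, ← FourierTransform.fourierInv_smul, ← MemLp.toLp_const_smul]
  congr 1
  refine (MemLp.toLp_eq_toLp_iff _ _).2 ?_
  filter_upwards [Lp.coeFn_smul c u] with ξ h
  simp [h, mul_left_comm]

theorem norm_fourierInv_eq (u : L2 n) : ‖(𝓕⁻ u : L2 n)‖ = ‖u‖ := by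
  rw [← Lp.norm_fourier_eq (𝓕⁻ u), fourier_fourierInv_eq]

theorem IsMultiplier.ofReal_sq_norm_op (ha : IsMultiplier a) (u : L2 n) :
    ENNReal.ofReal (‖ha.op u‖ ^ 2) = ∫⁻ ξ, ENNReal.ofReal (a ξ ^ 2) * ‖u ξ‖ₑ ^ 2 := by
  rw [IsMultiplier.op, norm_fourierInv_eq, ← lintegral_enorm_sq_eq]
  refine lintegral_congr_ae ?_
  filter_upwards [(ha.memLp u).coeFn_toLp] with ξ h
  rw [h, enorm_mul, mul_pow, ← sq_abs, ENNReal.ofReal_pow (abs_nonneg _)]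
  congr 2
  rw [← ofReal_norm, Complex.norm_real, Real.norm_eq_abs]

/-- A square integrable multiplier maps into bounded functions. -/
theorem IsMultiplier.ae_enorm_op_sq_le (ha : IsMultiplier a) (ha2 : ∫⁻ ξ, ENNReal.ofReal (a ξ ^ 2) < ∞)
    (u : L2 n) :
    ∀ᵐ x, ‖ha.op u x‖ₑ ^ 2 ≤ (∫⁻ ξ, ENNReal.ofReal (a ξ ^ 2)) * ENNReal.ofReal (‖u‖ ^ 2) := by
  have hm : AEStronglyMeasurable (fun ξ => (a ξ : ℂ)) volume :=
    (Complex.measurable_ofReal.comp ha.measurable).aestronglyMeasurable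
  have he : ∀ ξ, ‖(a ξ : ℂ)‖ₑ ^ 2 = ENNReal.ofReal (a ξ ^ 2) := fun ξ => by
    rw [← sq_abs, ENNReal.ofReal_pow (abs_nonneg _), ← ofReal_norm, Complex.norm_real, Real.norm_eq_abs]
  have ha' : MemLp (fun ξ => (a ξ : ℂ)) 2 volume := (memLp_two_iff_lintegral hm).2 (by simpa only [he] using ha2)
  have hint : Integrable fun ξ => (a ξ : ℂ) * u ξ := ha'.integrable_mul (Lp.memLp u)
  filter_upwards [fourierInv_toLp_ae_eq hint (ha.memLp u)] with x hx
  rw [IsMultiplier.op, hx, ← lintegral_enorm_sq_eq, Real.fourierInv_eq]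
  have h1 : ∀ ξ, Real.fourierChar ⟪ξ, x⟫ • ((a ξ : ℂ) * u ξ) = (Real.fourierChar ⟪ξ, x⟫ * (a ξ : ℂ)) * u ξ :=
    fun ξ => by rw [Circle.smul_def, smul_eq_mul, mul_assoc]
  simp_rw [h1]
  refine (enorm_integral_mul_sq_le ?_ (Lp.memLp u).1).trans_eq ?_
  · refine Continuous.aestronglyMeasurable ?_ |>.mul hm
    fun_prop
  · congr 2
    ext ξ
    rw [← he, enorm_mul, ← ofReal_norm (Real.fourierChar _ : ℂ), Circle.norm_coe, ENNReal.ofReal_one, one_mul]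

theorem IsMultiplier.op_eq_add_indicator (ha : IsMultiplier a) {s : Set (Rn n)} (hs : MeasurableSet s) (u : L2 n) :
    ha.op u = (ha.indicator hs).op u + (ha.indicator hs.compl).op u := by
  rw [IsMultiplier.op, IsMultiplier.op, IsMultiplier.op, ← FourierTransform.fourierInv_add, ← MemLp.toLp_add]
  congr 1
  refine (MemLp.toLp_eq_toLp_iff _ _).2 (Eventually.of_forall fun ξ => ?_)
  by_cases h : ξ ∈ s <;> simp [h]

end Multiplier

section Sobolev

variable {n : ℕ} {a : Rn n → ℝ}

theorem IsMultiplier.lintegral_indicator_sq_le (hn : n ≠ 0) {t C R : ℝ} (ht : t < n)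
    (hC : ∀ ξ, a ξ ^ 2 * ‖ξ‖ ^ t ≤ C) (hC0 : 0 ≤ C) (hR : 0 ≤ R) {s : Set (Rn n)}
    (hsR : s ⊆ Metric.ball 0 R) :
    ∫⁻ ξ, ENNReal.ofReal (s.indicator a ξ ^ 2) ≤
      ENNReal.ofReal (C * (n * volume.real (Metric.ball (0 : Rn n) 1) / (n - t) * R ^ ((n : ℝ) - t))) := by
  have : NeZero n := ⟨hn⟩
  rw [ENNReal.ofReal_mul hC0, ← lintegral_ball_norm_rpow_neg ht hn hR, ← lintegral_const_mul' _ _ ENNReal.ofReal_ne_top,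
    ← lintegral_indicator measurableSet_ball]
  have h0 : ∀ᵐ ξ : Rn n, ξ ≠ 0 := by simp [ae_iff]
  refine lintegral_mono_ae ?_
  filter_upwards [h0] with ξ hξ
  by_cases h : ξ ∈ s
  · rw [indicator_of_mem h, indicator_of_mem (hsR h), ← ENNReal.ofReal_mul hC0]
    refine ENNReal.ofReal_le_ofReal ?_
    rw [Real.rpow_neg (norm_nonneg _), ← div_eq_mul_inv, le_div_iff₀ (Real.rpow_pos_of_pos (norm_pos_iff.2 hξ) _)]
    exact hC ξ
  · rw [indicator_of_notMem h]; simp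

/-- The multiplier is cut at the frequency where 2c|ξ|^((n-t)/2) = l. By the choice of c the low
part is at most l/2 almost everywhere, so where the whole exceeds l the high part is at least l/2;
Chebyshev and Plancherel finish. -/
theorem IsMultiplier.meas_lt_norm_op_le (ha : IsMultiplier a) (hn : n ≠ 0) {t C c : ℝ} (ht : t < n)
    (hC : ∀ ξ, a ξ ^ 2 * ‖ξ‖ ^ t ≤ C) (hC0 : 0 ≤ C) (hc : 0 < c)
    (hcC : C * (n * volume.real (Metric.ball (0 : Rn n) 1) / (n - t)) ≤ c ^ 2) {u : L2 n} (hu : ‖u‖ ≤ 1)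
    {l : ℝ} (hl : 0 < l) :
    volume {x | l < ‖ha.op u x‖} ≤ ENNReal.ofReal (4 / l ^ 2) *
      ∫⁻ ξ, {ξ : Rn n | l ≤ 2 * c * ‖ξ‖ ^ (((n : ℝ) - t) / 2)}.indicator
        (fun ξ => ENNReal.ofReal (a ξ ^ 2) * ‖u ξ‖ₑ ^ 2) ξ := by
  set α := ((n : ℝ) - t) / 2 with hα
  have hα0 : 0 < α := by rw [hα]; linarith
  set s : Set (Rn n) := {ξ | 2 * c * ‖ξ‖ ^ α < l} with hs
  have hsm : MeasurableSet s := measurableSet_lt (by fun_prop) measurable_const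
  have hsc : sᶜ = {ξ : Rn n | l ≤ 2 * c * ‖ξ‖ ^ α} := by ext; simp [hs]
  set R := (l / (2 * c)) ^ (α⁻¹) with hR
  have hsR : s ⊆ Metric.ball 0 R := fun ξ hξ => by
    have h1 : ‖ξ‖ ^ α < l / (2 * c) := by
      rw [lt_div_iff₀ (by positivity), mul_comm]; exact hξ
    rw [mem_ball_zero_iff, hR, ← Real.rpow_rpow_inv (norm_nonneg ξ) hα0.ne']
    exact Real.rpow_lt_rpow (by positivity) h1 (inv_pos.2 hα0)
  have hlow0 := IsMultiplier.lintegral_indicator_sq_le hn ht hC hC0 (by positivity : 0 ≤ R) hsR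
  have hRp : R ^ ((n : ℝ) - t) = (l / (2 * c)) ^ 2 := by
    rw [hR, ← Real.rpow_mul (by positivity), ← Real.rpow_two]
    congr 1
    rw [hα]; field_simp
    exact div_self (by linarith)
  have hlow1 : ∫⁻ ξ, ENNReal.ofReal (s.indicator a ξ ^ 2) ≤ ENNReal.ofReal ((l / 2) ^ 2) := by
    refine hlow0.trans (ENNReal.ofReal_le_ofReal ?_)
    rw [hRp, ← mul_assoc]
    calc _ ≤ c ^ 2 * (l / (2 * c)) ^ 2 := by gcongr
      _ = _ := by field_simp
  have hlow : ∀ᵐ x, ‖(ha.indicator hsm).op u x‖ ≤ l / 2 := by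
    filter_upwards [(ha.indicator hsm).ae_enorm_op_sq_le (hlow1.trans_lt ENNReal.ofReal_lt_top) u] with x hx
    refine (sq_le_sq₀ (norm_nonneg _) (by positivity)).1 ?_
    rw [← ENNReal.ofReal_le_ofReal_iff (by positivity), ENNReal.ofReal_pow (norm_nonneg _), ofReal_norm]
    refine hx.trans ((mul_le_mul' hlow1 (ENNReal.ofReal_le_one.2 (pow_le_one₀ (norm_nonneg _) hu))).trans_eq
      (mul_one _))
  have hsub : volume {x | l < ‖ha.op u x‖} ≤
      volume {x | ENNReal.ofReal ((l / 2) ^ 2) ≤ ‖(ha.indicator hsm.compl).op u x‖ₑ ^ 2} := by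
    refine measure_mono_ae ?_
    have hsplit : ha.op u =ᵐ[volume] (ha.indicator hsm).op u + (ha.indicator hsm.compl).op u := by
      rw [ha.op_eq_add_indicator hsm u]
      exact Lp.coeFn_add _ _
    filter_upwards [hlow, hsplit] with x h1 h2 (h3 : l < ‖ha.op u x‖)
    change ENNReal.ofReal ((l / 2) ^ 2) ≤ ‖(ha.indicator hsm.compl).op u x‖ₑ ^ 2
    rw [← ofReal_norm, ← ENNReal.ofReal_pow (norm_nonneg _)]
    refine ENNReal.ofReal_le_ofReal (pow_le_pow_left₀ (by positivity) ?_ 2)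
    rw [h2, Pi.add_apply] at h3
    linarith [norm_add_le ((ha.indicator hsm).op u x) ((ha.indicator hsm.compl).op u x)]
  refine hsub.trans ?_
  have hl2 : (0 : ℝ) < (l / 2) ^ 2 := by positivity
  refine (meas_ge_le_lintegral_div ((Lp.memLp _).1.enorm.pow_const 2) (ENNReal.ofReal_pos.2 hl2).ne'
    ENNReal.ofReal_ne_top).trans ?_
  rw [lintegral_enorm_sq_eq, (ha.indicator hsm.compl).ofReal_sq_norm_op, div_eq_mul_inv, mul_comm,
    ← ENNReal.ofReal_inv_of_pos hl2]
  refine mul_le_mul' (ENNReal.ofReal_le_ofReal (by field_simp; norm_num)) (lintegral_mono fun ξ => ?_)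
  rw [hsc]
  by_cases h : ξ ∈ {ξ : Rn n | l ≤ 2 * c * ‖ξ‖ ^ α}
  · rw [indicator_of_mem h, indicator_of_mem h]
  · rw [indicator_of_notMem h]; simp

/-- The critical Sobolev inequality for Fourier multipliers. -/
theorem exists_lintegral_op_rpow_le (hn : n ≠ 0) {t C : ℝ} (ht0 : 0 < t) (ht : t < n) :
    ∃ C' : ℝ, 0 ≤ C' ∧ ∀ (a : Rn n → ℝ) (ha : IsMultiplier a), (∀ ξ, a ξ ^ 2 * ‖ξ‖ ^ t ≤ C) →
      ∀ u : L2 n, ‖u‖ ≤ 1 →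
        ∫⁻ x, ENNReal.ofReal (‖ha.op u x‖ ^ (2 * n / (n - t) : ℝ)) ≤ ENNReal.ofReal C' := by
  set q : ℝ := 2 * n / (n - t) with hq
  set I : ℝ := n * volume.real (Metric.ball (0 : Rn n) 1) / (n - t) with hI
  have hnt : 0 < (n : ℝ) - t := by linarith
  have hI0 : 0 ≤ I := by positivity
  set α := ((n : ℝ) - t) / 2 with hα
  have hα0 : 0 < α := by positivity
  have hq2 : q - 2 = t / α := by rw [hq, hα]; field_simp; ring
  have hq20 : 0 < q - 2 := by rw [hq2]; positivity
  have hq0 : 0 < q := by linarith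
  -- The low-frequency bound needs c² ≥ |C| I; the added 1 keeps c positive when this product
  -- vanishes.
  set c : ℝ := √(|C| * I) + 1 with hc
  have hc0 : 0 < c := by positivity
  have hcC : |C| * I ≤ c ^ 2 := by
    have h1 := Real.sq_sqrt (by positivity : 0 ≤ |C| * I)
    have h2 := Real.sqrt_nonneg (|C| * I)
    rw [hc]; nlinarith
  refine ⟨q * (4 * ((2 * c) ^ (q - 2) / (q - 2) * |C|)), by positivity, fun a ha haC u hu => ?_⟩
  have haC' : ∀ ξ, a ξ ^ 2 * ‖ξ‖ ^ t ≤ |C| := fun ξ => (haC ξ).trans (le_abs_self C)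
  rw [lintegral_rpow_eq_lintegral_meas_lt_mul volume (Eventually.of_forall fun x => norm_nonneg _)
    (Lp.memLp (ha.op u)).1.norm.aemeasurable hq0, ENNReal.ofReal_mul hq0.le]
  refine mul_le_mul_right ?_ _
  set w : Rn n → ℝ≥0∞ := fun ξ => ENNReal.ofReal (a ξ ^ 2) * ‖u ξ‖ₑ ^ 2 with hw
  have hwm : AEMeasurable w := (ha.measurable.pow_const 2).ennreal_ofReal.aemeasurable.mul
    ((Lp.memLp u).1.enorm.pow_const 2)
  set D : Set (ℝ × Rn n) := {z | z.1 ≤ 2 * c * ‖z.2‖ ^ α} with hD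
  have hDm : MeasurableSet D := measurableSet_le (by fun_prop) (by fun_prop)
  calc ∫⁻ l in Ioi 0, volume {x | l < ‖ha.op u x‖} * ENNReal.ofReal (l ^ (q - 1))
      ≤ ∫⁻ l in Ioi 0, ∫⁻ ξ, D.indicator (fun z => 4 * ENNReal.ofReal (z.1 ^ (q - 2 - 1)) * w z.2) (l, ξ) := by
        refine setLIntegral_mono' measurableSet_Ioi fun l hl => ?_
        have hl0 : (0 : ℝ) < l := hl
        refine (mul_le_mul_left (ha.meas_lt_norm_op_le hn ht haC' (abs_nonneg _) hc0 hcC hu hl0) _).trans ?_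
        rw [mul_right_comm, ← ENNReal.ofReal_mul (by positivity), ← lintegral_const_mul' _ _ ENNReal.ofReal_ne_top]
        refine lintegral_mono fun ξ => ?_
        have e1 : 4 / l ^ 2 * l ^ (q - 1) = 4 * l ^ (q - 2 - 1) := by
          rw [div_mul_eq_mul_div, mul_div_assoc, ← Real.rpow_two, ← Real.rpow_sub hl0]
          congr 2; ring
        rw [e1, ENNReal.ofReal_mul (by norm_num)]
        by_cases h : l ≤ 2 * c * ‖ξ‖ ^ α
        · rw [indicator_of_mem (show ξ ∈ {ξ : Rn n | l ≤ 2 * c * ‖ξ‖ ^ α} from h),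
            indicator_of_mem (show (l, ξ) ∈ D from h)]
          rw [ENNReal.ofReal_ofNat]
        · rw [indicator_of_notMem (show ξ ∉ {ξ : Rn n | l ≤ 2 * c * ‖ξ‖ ^ α} from h)]
          simp
    -- After the exchange each ξ collects the levels l ≤ 2c|ξ|^α. Their integral is proportional to
    -- |ξ|^(α(q-2)) = |ξ|^t, exactly what the decay of a² compensates.
    _ = ∫⁻ ξ, ∫⁻ l in Ioi 0, D.indicator (fun z => 4 * ENNReal.ofReal (z.1 ^ (q - 2 - 1)) * w z.2) (l, ξ) := by
        refine lintegral_lintegral_swap (AEMeasurable.indicator ?_ hDm)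
        have h1 : Measurable fun z : ℝ × Rn n => 4 * ENNReal.ofReal (z.1 ^ (q - 2 - 1)) := by fun_prop
        exact h1.aemeasurable.mul hwm.comp_snd
    _ ≤ ∫⁻ ξ, ENNReal.ofReal (4 * ((2 * c) ^ (q - 2) / (q - 2) * |C|)) * ‖u ξ‖ₑ ^ 2 := by
        refine lintegral_mono fun ξ => ?_
        have hb : 0 ≤ 2 * c * ‖ξ‖ ^ α := by positivity
        have e1 : ∀ l : ℝ, D.indicator (fun z => 4 * ENNReal.ofReal (z.1 ^ (q - 2 - 1)) * w z.2) (l, ξ) =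
            (Iic (2 * c * ‖ξ‖ ^ α)).indicator (fun l => 4 * ENNReal.ofReal (l ^ (q - 2 - 1)) * w ξ) l := fun l => by
          by_cases h : l ≤ 2 * c * ‖ξ‖ ^ α
          · rw [indicator_of_mem (show (l, ξ) ∈ D from h), indicator_of_mem (mem_Iic.2 h)]
          · rw [indicator_of_notMem (show (l, ξ) ∉ D from h), indicator_of_notMem (by simpa using h)]
        simp_rw [e1]
        rw [setLIntegral_indicator measurableSet_Iic, inter_comm, Ioi_inter_Iic,
          lintegral_mul_const _ (by fun_prop), lintegral_const_mul _ (by fun_prop),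
          lintegral_Ioc_rpow hb hq20, hw, ← mul_assoc]
        refine mul_le_mul_left ?_ _
        rw [show (4 : ℝ≥0∞) = ENNReal.ofReal 4 by simp, ← ENNReal.ofReal_mul (by norm_num),
          ← ENNReal.ofReal_mul (by positivity)]
        refine ENNReal.ofReal_le_ofReal ?_
        have e2 : (2 * c * ‖ξ‖ ^ α) ^ (q - 2) = (2 * c) ^ (q - 2) * ‖ξ‖ ^ t := by
          rw [Real.mul_rpow (by positivity) (by positivity), ← Real.rpow_mul (norm_nonneg _), hq2,
            mul_div_cancel₀ _ hα0.ne']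
        rw [e2]
        calc 4 * ((2 * c) ^ (q - 2) * ‖ξ‖ ^ t / (q - 2)) * a ξ ^ 2
            = 4 * ((2 * c) ^ (q - 2) / (q - 2) * (a ξ ^ 2 * ‖ξ‖ ^ t)) := by ring
          _ ≤ _ := by gcongr; exact haC' ξ
    _ ≤ _ := by
        rw [lintegral_const_mul' _ _ ENNReal.ofReal_ne_top, lintegral_enorm_sq_eq]
        exact mul_le_of_le_one_right' (ENNReal.ofReal_le_one.2 (pow_le_one₀ (norm_nonneg _) hu))

end Sobolev

/-! ### Potentials against the part of the resolvent away from S -/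

section PotentialBounds

variable {n : ℕ}

theorem lintegral_enorm_mul_op_le_of_unit {a : Rn n → ℝ} (ha : IsMultiplier a) (V : Rn n → ℝ) {B : ℝ≥0∞}
    (h : ∀ u : L2 n, ‖u‖ ≤ 1 → ∫⁻ x, ‖V x‖ₑ * ‖ha.op u x‖ₑ ^ 2 ≤ B) (u : L2 n) :
    ∫⁻ x, ‖V x‖ₑ * ‖ha.op u x‖ₑ ^ 2 ≤ B * ENNReal.ofReal (‖u‖ ^ 2) := by
  rcases eq_or_ne u 0 with rfl | hu
  · have h0 : ha.op 0 = 0 := by simpa using ha.op_smul 0 0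
    rw [h0]
    have : ∫⁻ x, ‖V x‖ₑ * ‖(0 : L2 n) x‖ₑ ^ 2 = 0 := by
      rw [← lintegral_zero (μ := (volume : Measure (Rn n)))]
      refine lintegral_congr_ae ?_
      filter_upwards [Lp.coeFn_zero ℂ 2 (volume : Measure (Rn n))] with x hx
      rw [hx]; simp
    rw [this]
    exact zero_le
  have hu0 : 0 < ‖u‖ := norm_pos_iff.2 hu
  set v : L2 n := ((‖u‖⁻¹ : ℝ) : ℂ) • u with hv
  have hv1 : ‖v‖ ≤ 1 := by
    rw [hv, norm_smul, Complex.norm_real, norm_inv, norm_norm, inv_mul_cancel₀ hu0.ne']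
  have huv : u = ((‖u‖ : ℝ) : ℂ) • v := by
    rw [hv, smul_smul, ← Complex.ofReal_mul, mul_inv_cancel₀ hu0.ne', Complex.ofReal_one, one_smul]
  have h1 : ∫⁻ x, ‖V x‖ₑ * ‖ha.op u x‖ₑ ^ 2 =
      ∫⁻ x, (‖V x‖ₑ * ‖ha.op v x‖ₑ ^ 2) * ENNReal.ofReal (‖u‖ ^ 2) := by
    have h2 : ha.op u = ((‖u‖ : ℝ) : ℂ) • ha.op v := by
      conv_lhs => rw [huv]
      exact ha.op_smul _ _
    refine lintegral_congr_ae ?_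
    filter_upwards [Lp.coeFn_smul ((‖u‖ : ℝ) : ℂ) (ha.op v)] with x hx
    rw [h2, hx, Pi.smul_apply, smul_eq_mul, enorm_mul, mul_pow, mul_assoc]
    congr 1
    rw [mul_comm, ← ofReal_norm (((‖u‖ : ℝ) : ℂ)), Complex.norm_real, norm_norm, ENNReal.ofReal_pow hu0.le]
  rw [h1, lintegral_mul_const' _ _ ENNReal.ofReal_ne_top]
  exact mul_le_mul_left (h v hv1) _

/-- Hölder with exponents n/t and n/(n-t): the second turns the square into the Sobolev power
2n/(n-t). -/
theorem exists_lintegral_mul_op_le_of_lt (hn : n ≠ 0) {t C : ℝ} (ht0 : 0 < t) (ht : t < n) :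
    ∃ C' : ℝ, 0 ≤ C' ∧ ∀ (a : Rn n → ℝ) (ha : IsMultiplier a), (∀ ξ, a ξ ^ 2 * ‖ξ‖ ^ t ≤ C) →
      ∀ V : Rn n → ℝ, MemLp V (ENNReal.ofReal (n / t)) volume → ∀ u : L2 n,
        ∫⁻ x, ‖V x‖ₑ * ‖ha.op u x‖ₑ ^ 2 ≤
          ENNReal.ofReal (C' * lpNorm V (ENNReal.ofReal (n / t)) volume) * ENNReal.ofReal (‖u‖ ^ 2) := by
  obtain ⟨C', hC', h⟩ := exists_lintegral_op_rpow_le hn (C := C) ht0 ht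
  have hnt : 0 < (n : ℝ) - t := by linarith
  have hn0 : (0 : ℝ) < n := by positivity
  set p : ℝ := n / t with hp
  set p' : ℝ := n / (n - t) with hp'
  have hpp : p.HolderConjugate p' := by
    rw [Real.holderConjugate_iff]
    refine ⟨(one_lt_div ht0).2 ht, ?_⟩
    rw [hp, hp']
    field_simp; ring
  refine ⟨C' ^ (1 / p'), by positivity, fun a ha haC V hV u => ?_⟩
  refine lintegral_enorm_mul_op_le_of_unit ha V (fun u hu => ?_) u
  have h1 := ENNReal.lintegral_mul_le_Lp_mul_Lq volume hpp hV.1.enorm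
    ((Lp.memLp (ha.op u)).1.enorm.pow_const 2)
  refine h1.trans ?_
  rw [mul_comm, ENNReal.ofReal_mul (by positivity)]
  refine mul_le_mul' ?_ (le_of_eq ?_)
  · rw [← ENNReal.ofReal_rpow_of_nonneg hC' (by positivity)]
    refine ENNReal.rpow_le_rpow ?_ (by positivity)
    refine le_trans (le_of_eq ?_) (h a ha haC u hu)
    congr 1
    ext x
    rw [← ofReal_norm, ← ENNReal.ofReal_pow (norm_nonneg _),
      ENNReal.ofReal_rpow_of_nonneg (by positivity) (by positivity), ← Real.rpow_two,
      ← Real.rpow_mul (norm_nonneg _)]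
    congr 2
    rw [hp']; ring
  · have hp0 : 0 < p := by positivity
    rw [ofReal_lpNorm hV, eLpNorm_eq_lintegral_rpow_enorm_toReal (by simpa using hp0) ENNReal.ofReal_ne_top,
      ENNReal.toReal_ofReal hp0.le]

/-- For s > n the multiplier is square integrable, its output is bounded, and V only has to be
integrable. -/
theorem exists_lintegral_mul_op_le_of_gt {s C : ℝ} (hs : (n : ℝ) < s) :
    ∃ C' : ℝ, 0 ≤ C' ∧ ∀ (a : Rn n → ℝ) (ha : IsMultiplier a), (∀ ξ, a ξ ^ 2 ≤ C * (1 + ‖ξ‖) ^ (-s)) →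
      ∀ V : Rn n → ℝ, MemLp V 1 volume → ∀ u : L2 n,
        ∫⁻ x, ‖V x‖ₑ * ‖ha.op u x‖ₑ ^ 2 ≤
          ENNReal.ofReal (C' * lpNorm V 1 volume) * ENNReal.ofReal (‖u‖ ^ 2) := by
  have hint : Integrable (fun ξ : Rn n => |C| * (1 + ‖ξ‖) ^ (-s)) :=
    (integrable_one_add_norm (by simpa using hs)).const_mul _
  refine ⟨∫ ξ : Rn n, |C| * (1 + ‖ξ‖) ^ (-s), integral_nonneg fun ξ => by positivity, fun a ha haC V hV u => ?_⟩
  have h1 : ∫⁻ ξ, ENNReal.ofReal (a ξ ^ 2) ≤ ENNReal.ofReal (∫ ξ : Rn n, |C| * (1 + ‖ξ‖) ^ (-s)) := by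
    rw [ofReal_integral_eq_lintegral_ofReal hint (Eventually.of_forall fun ξ => by positivity)]
    refine lintegral_mono fun ξ => ENNReal.ofReal_le_ofReal ((haC ξ).trans ?_)
    gcongr
    exact le_abs_self C
  have h2 := ha.ae_enorm_op_sq_le (h1.trans_lt ENNReal.ofReal_lt_top) u
  calc ∫⁻ x, ‖V x‖ₑ * ‖ha.op u x‖ₑ ^ 2
      ≤ ∫⁻ x, ‖V x‖ₑ * (ENNReal.ofReal (∫ ξ : Rn n, |C| * (1 + ‖ξ‖) ^ (-s)) * ENNReal.ofReal (‖u‖ ^ 2)) := by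
        refine lintegral_mono_ae ?_
        filter_upwards [h2] with x hx
        gcongr
        exact hx.trans (mul_le_mul_left h1 _)
    _ = _ := by
        rw [lintegral_mul_const'' _ hV.1.enorm, ← eLpNorm_one_eq_lintegral_enorm, ← ofReal_lpNorm hV, ← mul_assoc,
          ← ENNReal.ofReal_mul lpNorm_nonneg, mul_comm (lpNorm V 1 volume)]

namespace KineticSymbol

variable {K : KineticSymbol n} {χ : Rn n → ℝ}

theorem exists_lintegral_mul_op_le (K : KineticSymbol n) (hn : n ≠ 0) {ε : ℝ} (hε : 0 < ε) {C : ℝ} (hC0 : 0 ≤ C) :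
    ∃ C' : ℝ, 0 ≤ C' ∧ ∀ (a : Rn n → ℝ) (ha : IsMultiplier a), (∀ ξ, a ξ ^ 2 ≤ C * (1 + ‖ξ‖) ^ (-K.s)) →
      ∀ V : Rn n → ℝ, MemLp V (K.exponent ε) volume → ∀ u : L2 n,
        ∫⁻ x, ‖V x‖ₑ * ‖ha.op u x‖ₑ ^ 2 ≤ ENNReal.ofReal (C' * K.A ε V) * ENNReal.ofReal (‖u‖ ^ 2) := by
  have hs := K.s_pos
  have hn0 : (0 : ℝ) < n := by positivity
  have hle : ∀ t, 0 < t → t ≤ K.s → ∀ (a : Rn n → ℝ), (∀ ξ, a ξ ^ 2 ≤ C * (1 + ‖ξ‖) ^ (-K.s)) →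
      ∀ ξ, a ξ ^ 2 * ‖ξ‖ ^ t ≤ C := by
    intro t ht0 ht a ha ξ
    have h1 : ‖ξ‖ ^ t ≤ (1 + ‖ξ‖) ^ K.s :=
      (Real.rpow_le_rpow (norm_nonneg _) (by linarith) ht0.le).trans
        (Real.rpow_le_rpow_of_exponent_le (by linarith [norm_nonneg ξ]) ht)
    calc a ξ ^ 2 * ‖ξ‖ ^ t ≤ C * (1 + ‖ξ‖) ^ (-K.s) * (1 + ‖ξ‖) ^ K.s := by
          gcongr; exact ha ξ
      _ = C := by
          rw [mul_assoc, ← Real.rpow_add (by positivity)]; simp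
  rcases lt_trichotomy K.s n with h | h | h
  · obtain ⟨C', hC', H⟩ := exists_lintegral_mul_op_le_of_lt (C := C) hn hs h
    refine ⟨C', hC', fun a ha haC V hV u => ?_⟩
    have he : K.exponent ε = ENNReal.ofReal (n / K.s) := by simp [exponent, h]
    rw [A, he]
    rw [he] at hV
    exact H a ha (hle _ hs le_rfl a haC) V hV u
  -- In the borderline case some decay is given away: t = n/(1+ε) < s is subcritical, and its
  -- exponent n/t is 1 + ε.
  · set t : ℝ := n / (1 + ε) with ht
    have ht0 : 0 < t := by positivity
    have htn : t < n := div_lt_self hn0 (by linarith)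
    obtain ⟨C', hC', H⟩ := exists_lintegral_mul_op_le_of_lt (C := C) hn ht0 htn
    refine ⟨C', hC', fun a ha haC V hV u => ?_⟩
    have he : K.exponent ε = ENNReal.ofReal (n / t) := by
      rw [exponent, if_neg (by linarith), if_pos h, ht, div_div_cancel₀ hn0.ne']
    rw [A, he]
    rw [he] at hV
    exact H a ha (hle _ ht0 (by linarith) a haC) V hV u
  · obtain ⟨C', hC', H⟩ := exists_lintegral_mul_op_le_of_gt (C := C) h
    refine ⟨C', hC', fun a ha haC V hV u => ?_⟩
    have he : K.exponent ε = 1 := by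
      rw [exponent, if_neg (by linarith), if_neg (by linarith)]
    rw [A, he]
    rw [he] at hV
    exact H a ha haC V hV u

/-- On Ω minus an open set around S where χ = 1, the quotient T/(1+|p|)^s is continuous and positive
on a compact set. Off Ω the assumed growth applies, the factor 2^s comparing (1+|p|)^s with 1 +
|p|^s. -/
theorem IsCutoff.exists_le_T (hχ : K.IsCutoff χ) : ∃ c > 0, ∀ p, χ p ≠ 1 → c * (1 + ‖p‖) ^ K.s ≤ K.T p := by
  obtain ⟨O, hO, hSO, hO1⟩ := eventually_nhdsSet_iff_exists.1 hχ.eventually_eq_one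
  have hcont : ContinuousOn K.T K.Ω := K.continuousOn_P.abs.rpow_const fun _ _ => Or.inr K.r_pos.le
  have hcpt : IsCompact (K.Ω \ O) := K.isCompact_Ω.diff hO
  have hq : ContinuousOn (fun p => K.T p / (1 + ‖p‖) ^ K.s) (K.Ω \ O) := by
    refine (hcont.mono sdiff_subset).div (Continuous.continuousOn ?_) fun p _ => by positivity
    exact (continuous_const.add continuous_norm).rpow_const fun p => Or.inr K.s_pos.le
  have hpos : ∀ p ∈ K.Ω \ O, 0 < K.T p / (1 + ‖p‖) ^ K.s := fun p hp => by
    refine div_pos ((K.T_nonneg p).lt_of_ne fun h => hp.2 (hSO ?_)) (by positivity)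
    exact h.symm
  obtain ⟨δ, hδ, hδ'⟩ := hcpt.exists_forall_le' hq hpos
  refine ⟨min δ (min K.C₁ K.C₂ / 2 ^ K.s), lt_min hδ (div_pos (lt_min K.C₁_pos K.C₂_pos) (by positivity)),
    fun p hp => ?_⟩
  have hpO : p ∉ O := fun h => hp (hO1 p h)
  by_cases hpΩ : p ∈ K.Ω
  · have h1 := hδ' p ⟨hpΩ, hpO⟩
    rw [le_div_iff₀ (by positivity)] at h1
    refine le_trans ?_ h1
    gcongr
    exact min_le_left _ _
  · refine le_trans ?_ (K.lower_bound p hpΩ)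
    have h2 : (1 + ‖p‖) ^ K.s ≤ 2 ^ K.s * (1 + ‖p‖ ^ K.s) := by
      rcases le_total ‖p‖ 1 with h | h
      · have : (1 + ‖p‖) ^ K.s ≤ 2 ^ K.s := Real.rpow_le_rpow (by positivity) (by linarith) K.s_pos.le
        refine this.trans (le_mul_of_one_le_right (by positivity) ?_)
        linarith [Real.rpow_nonneg (norm_nonneg p) K.s]
      · have : (1 + ‖p‖) ^ K.s ≤ (2 * ‖p‖) ^ K.s := Real.rpow_le_rpow (by positivity) (by linarith) K.s_pos.le
        refine this.trans ?_
        rw [Real.mul_rpow (by norm_num) (norm_nonneg _)]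
        gcongr
        linarith
    have hm : 0 < min K.C₁ K.C₂ := lt_min K.C₁_pos K.C₂_pos
    calc min δ (min K.C₁ K.C₂ / 2 ^ K.s) * (1 + ‖p‖) ^ K.s
        ≤ min K.C₁ K.C₂ / 2 ^ K.s * (2 ^ K.s * (1 + ‖p‖ ^ K.s)) := by
          gcongr
          exact min_le_right _ _
      _ = min K.C₁ K.C₂ * ‖p‖ ^ K.s + min K.C₁ K.C₂ := by field_simp; ring
      _ ≤ _ := by gcongr <;> [exact min_le_left _ _; exact min_le_right _ _]

/-- The square root of the part of the resolvent away from the minimum set. -/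
noncomputable def remainder (K : KineticSymbol n) (χ : Rn n → ℝ) (e : ℝ) (ξ : Rn n) : ℝ :=
  √((1 - χ ((2 * Real.pi) • ξ)) / (K.T ((2 * Real.pi) • ξ) + e))

theorem IsCutoff.sq_remainder (hχ : K.IsCutoff χ) {e : ℝ} (he : 0 < e) (ξ : Rn n) :
    K.remainder χ e ξ ^ 2 = (1 - χ ((2 * Real.pi) • ξ)) / (K.T ((2 * Real.pi) • ξ) + e) := by
  have h1 := (hχ.mem_Icc ((2 * Real.pi) • ξ)).2
  have h2 := K.T_nonneg ((2 * Real.pi) • ξ)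
  exact Real.sq_sqrt (div_nonneg (by linarith) (by linarith))

theorem IsCutoff.exists_sq_remainder_le (hχ : K.IsCutoff χ) :
    ∃ C, 0 ≤ C ∧ ∀ e > 0, ∀ ξ, K.remainder χ e ξ ^ 2 ≤ C * (1 + ‖ξ‖) ^ (-K.s) := by
  obtain ⟨c, hc, h⟩ := hχ.exists_le_T
  refine ⟨c⁻¹, by positivity, fun e he ξ => ?_⟩
  rw [hχ.sq_remainder he]
  set p := (2 * Real.pi) • ξ with hp
  by_cases h1 : χ p = 1
  · rw [h1, sub_self, zero_div]; positivity
  have hm := hχ.mem_Icc p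
  have hξp : ‖ξ‖ ≤ ‖p‖ := by
    rw [hp, norm_smul, Real.norm_eq_abs, abs_of_pos Real.two_pi_pos]
    exact le_mul_of_one_le_left (norm_nonneg _) (by linarith [Real.pi_gt_three])
  have h2 : c * (1 + ‖ξ‖) ^ K.s ≤ K.T p + e := by
    refine le_trans ?_ ((h p h1).trans (by linarith))
    have := K.s_pos
    gcongr
  have h3 : 0 < c * (1 + ‖ξ‖) ^ K.s := by positivity
  rw [Real.rpow_neg (by positivity), ← mul_inv, ← one_div]
  gcongr
  linarith [hm.1]

theorem IsCutoff.isMultiplier_remainder (hχ : K.IsCutoff χ) {e : ℝ} (he : 0 < e) :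
    IsMultiplier (K.remainder χ e) := by
  refine ⟨?_, e⁻¹.sqrt, fun ξ => ?_⟩
  · have h1 : Measurable fun ξ : Rn n => (2 * Real.pi) • ξ := measurable_const_smul _
    exact (((measurable_const.sub hχ.contDiff.continuous.measurable).div
      (K.measurable_T.add_const e)).comp h1).sqrt
  · rw [remainder, abs_of_nonneg (Real.sqrt_nonneg _), ← one_div]
    have hm := hχ.mem_Icc ((2 * Real.pi) • ξ)
    have := K.T_nonneg ((2 * Real.pi) • ξ)
    refine Real.sqrt_le_sqrt ?_
    gcongr <;> linarith [hm.1]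

end KineticSymbol

end PotentialBounds

/-! ### Sandwiched operators and uniqueness -/

section Sandwich

variable {n : ℕ} {V : Rn n → ℝ} {b : Rn n → ℝ} {a : Rn n → ℝ}

theorem exists_clm_mul_op (ha : IsMultiplier a) (hb : AEStronglyMeasurable b volume)
    (hbV : ∀ x, ‖b x‖ₑ ^ 2 ≤ ‖V x‖ₑ) {B : ℝ} (hB : 0 ≤ B)
    (h : ∀ u, ∫⁻ x, ‖V x‖ₑ * ‖ha.op u x‖ₑ ^ 2 ≤ ENNReal.ofReal (B ^ 2) * ENNReal.ofReal (‖u‖ ^ 2)) :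
    ∃ A : L2 n →L[ℂ] L2 n, ‖A‖ ≤ B ∧ ∀ u, A u =ᵐ[volume] fun x => (b x : ℂ) * ha.op u x := by
  refine exists_clm_of_ae (T := fun u x => (b x : ℂ) * ha.op u x) (fun u => ?_) (fun u v => ?_) (fun c u => ?_) hB
    fun u => ?_
  · exact (Complex.continuous_ofReal.comp_aestronglyMeasurable hb).mul (Lp.memLp _).1
  · filter_upwards [Lp.coeFn_add (ha.op u) (ha.op v)] with x hx
    rw [Pi.add_apply, ha.op_add, hx, Pi.add_apply, mul_add]
  · filter_upwards [Lp.coeFn_smul c (ha.op u)] with x hx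
    rw [Pi.smul_apply, ha.op_smul, hx, Pi.smul_apply, smul_eq_mul, smul_eq_mul, mul_left_comm]
  · refine le_trans (lintegral_mono fun x => ?_) (h u)
    rw [enorm_mul, mul_pow]
    refine mul_le_mul_left ((le_of_eq ?_).trans (hbV x)) _
    rw [← ofReal_norm, Complex.norm_real, ofReal_norm]

theorem IsMultiplier.inner_op (ha : IsMultiplier a) (φ u : L2 n) :
    inner ℂ φ (ha.op u) = inner ℂ ((ha.memLp (𝓕 φ)).toLp _) u := by
  rw [IsMultiplier.op, ← Lp.inner_fourier_eq, fourier_fourierInv_eq, L2.inner_def, L2.inner_def]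
  refine integral_congr_ae ?_
  filter_upwards [(ha.memLp u).coeFn_toLp, (ha.memLp (𝓕 φ)).coeFn_toLp] with ξ h1 h2
  rw [h1, h2]
  simp only [RCLike.inner_apply, map_mul, Complex.conj_ofReal]
  ring

/-- This supplies the right half of the sandwich: the adjoint multiplies by b in position space,
takes the Fourier transform and multiplies by a, on the domain of b. -/
theorem adjoint_mul_op_apply (ha : IsMultiplier a) {A : L2 n →L[ℂ] L2 n}
    (hA : ∀ u, A u =ᵐ[volume] fun x => (b x : ℂ) * ha.op u x) (ψ : L2 n)
    (hψ : MemLp (fun x => (b x : ℂ) * ψ x) 2 volume) :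
    ContinuousLinearMap.adjoint A ψ = (ha.memLp (𝓕 (hψ.toLp _ : L2 n))).toLp _ := by
  refine ext_inner_right ℂ fun u => ?_
  rw [ContinuousLinearMap.adjoint_inner_left, ← ha.inner_op, L2.inner_def, L2.inner_def]
  refine integral_congr_ae ?_
  filter_upwards [hA u, hψ.coeFn_toLp] with x h1 h2
  rw [h1, h2]
  simp only [RCLike.inner_apply, map_mul, Complex.conj_ofReal]
  ring

/-- A vector η = (M - M')*φ is orthogonal to the domain of w. The domain contains η/(1+w), because
w/(1+w) ≤ 1; hence ∫ |η|²/(1+w) = 0 and η = 0. -/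
theorem clm_eq_of_eq_on_domain {w : Rn n → ℝ} (hw : AEStronglyMeasurable w volume) (hw0 : ∀ x, 0 ≤ w x)
    {M M' : L2 n →L[ℂ] L2 n}
    (h : ∀ ψ : L2 n, MemLp (fun x => (w x : ℂ) * ψ x) 2 volume → M ψ = M' ψ) : M = M' := by
  rw [← sub_eq_zero, ← ContinuousLinearMap.adjoint.map_eq_zero_iff]
  ext1 φ
  set η := ContinuousLinearMap.adjoint (M - M') φ with hη
  have hb : AEStronglyMeasurable (fun x => (((1 + w x)⁻¹ : ℝ) : ℂ)) volume :=
    Complex.continuous_ofReal.comp_aestronglyMeasurable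
      (((hw.aemeasurable.const_add 1).inv).aestronglyMeasurable)
  have h1 : MemLp (fun x => (((1 + w x)⁻¹ : ℝ) : ℂ) * η x) 2 volume := by
    refine (Lp.memLp η).of_le (hb.mul (Lp.memLp η).1) (Eventually.of_forall fun x => ?_)
    rw [norm_mul, Complex.norm_real, norm_inv, Real.norm_eq_abs, abs_of_nonneg (by linarith [hw0 x])]
    exact mul_le_of_le_one_left (norm_nonneg _) (inv_le_one_of_one_le₀ (by linarith [hw0 x]))
  have h2 : MemLp (fun x => (w x : ℂ) * h1.toLp _ x) 2 volume := by
    refine (Lp.memLp η).of_le ((Complex.continuous_ofReal.comp_aestronglyMeasurable hw).mul (Lp.memLp _).1) ?_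
    filter_upwards [h1.coeFn_toLp] with x hx
    rw [hx, ← mul_assoc, norm_mul, ← Complex.ofReal_mul, Complex.norm_real, Real.norm_eq_abs,
      abs_of_nonneg (mul_nonneg (hw0 x) (inv_nonneg.2 (by linarith [hw0 x])))]
    refine mul_le_of_le_one_left (norm_nonneg _) ?_
    rw [← div_eq_mul_inv]
    exact div_le_one_of_le₀ (by linarith) (by linarith [hw0 x])
  have h3 : inner ℂ (h1.toLp _ : L2 n) η = 0 := by
    refine (ContinuousLinearMap.adjoint_inner_right (M - M') _ φ).trans ?_
    rw [sub_apply, h _ h2, sub_self, inner_zero_left]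
  have h4 : inner ℂ (h1.toLp _ : L2 n) η = ((∫ x, (1 + w x)⁻¹ * ‖η x‖ ^ 2 : ℝ) : ℂ) := by
    rw [L2.inner_def, ← integral_complex_ofReal]
    refine integral_congr_ae ?_
    filter_upwards [h1.coeFn_toLp] with x hx
    rw [hx]
    simp only [RCLike.inner_apply, map_mul, Complex.conj_ofReal]
    rw [mul_left_comm, Complex.mul_conj, Complex.normSq_eq_norm_sq]
    push_cast
    ring
  rw [h4, Complex.ofReal_eq_zero, integral_eq_zero_iff_of_nonneg
    (fun x => mul_nonneg (inv_nonneg.2 (by linarith [hw0 x])) (by positivity))] at h3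
  · refine (Lp.eq_zero_iff_ae_eq_zero).2 ?_
    filter_upwards [h3] with x hx
    have h5 : (1 + w x)⁻¹ ≠ 0 := inv_ne_zero (by linarith [hw0 x])
    simpa [h5] using hx
  · have h6 : Integrable fun x => ‖η x‖ ^ 2 := (Lp.memLp η).integrable_norm_pow two_ne_zero
    refine h6.bdd_mul (c := 1) ((hw.aemeasurable.const_add 1).inv).aestronglyMeasurable
      (Eventually.of_forall fun x => ?_)
    rw [norm_inv, Real.norm_eq_abs, abs_of_nonneg (by linarith [hw0 x])]
    exact inv_le_one_of_one_le₀ (by linarith [hw0 x])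

theorem measurable_realSign : Measurable Real.sign := by
  have : Real.sign = fun r : ℝ => if r < 0 then (-1 : ℝ) else if 0 < r then 1 else 0 := rfl
  rw [this]
  exact Measurable.ite measurableSet_Iio measurable_const
    (Measurable.ite measurableSet_Ioi measurable_const measurable_const)

theorem abs_realSign_le (t : ℝ) : |Real.sign t| ≤ 1 := by
  rcases Real.sign_apply_eq t with h | h | h <;> simp [h]

theorem aestronglyMeasurable_sqrt_abs (hV : AEStronglyMeasurable V volume) :
    AEStronglyMeasurable (fun x => √|V x|) volume :=
  (Real.continuous_sqrt.comp continuous_abs).comp_aestronglyMeasurable hV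

theorem aestronglyMeasurable_sign_mul_sqrt (hV : AEStronglyMeasurable V volume) :
    AEStronglyMeasurable (fun x => Real.sign (V x) * √|V x|) volume :=
  (measurable_realSign.comp_aemeasurable hV.aemeasurable).aestronglyMeasurable.mul (aestronglyMeasurable_sqrt_abs hV)

theorem enorm_sqrt_abs_sq (t : ℝ) : ‖√|t|‖ₑ ^ 2 = ‖t‖ₑ := by
  rw [← ofReal_norm, ← ENNReal.ofReal_pow (norm_nonneg _), Real.norm_eq_abs, sq_abs, Real.sq_sqrt (abs_nonneg _),
    ← Real.norm_eq_abs, ofReal_norm]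

theorem enorm_sign_mul_sqrt_abs_sq_le (t : ℝ) : ‖Real.sign t * √|t|‖ₑ ^ 2 ≤ ‖t‖ₑ := by
  rw [enorm_mul, mul_pow, enorm_sqrt_abs_sq]
  refine mul_le_of_le_one_left' (pow_le_one' ?_ 2)
  rw [← ofReal_norm]
  exact ENNReal.ofReal_le_one.2 (abs_realSign_le t)

end Sandwich

/-! ### The part near S as a convolution operator -/

namespace KineticSymbol

variable {n : ℕ} {K : KineticSymbol n} {χ : Rn n → ℝ}

instance isFiniteMeasure_surface (K : KineticSymbol n) : IsFiniteMeasure K.surface := by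
  refine ⟨?_⟩
  have h := measure_levelSet_inter_lt_top K.measurable_P isOpen_interior K.contDiffOn_one K.gradient_ne_zero
    K.isCompact_S K.S_subset_interior
  rw [← S_eq, Measure.restrict_apply_self] at h
  rwa [surface, Measure.restrict_apply_univ]

theorem ae_surface_mem (K : KineticSymbol n) : ∀ᵐ p ∂K.surface, p ∈ K.S :=
  ae_restrict_mem K.measurableSet_S

theorem continuousOn_gradient (K : KineticSymbol n) : ContinuousOn (fun p => ‖gradient K.P p‖) (interior K.Ω) := by
  simp only [norm_gradient]
  exact (K.contDiffOn_one.continuousOn_fderiv_of_isOpen isOpen_interior le_rfl).norm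

theorem aestronglyMeasurable_inv_gradient (K : KineticSymbol n) :
    AEStronglyMeasurable (fun p => ‖gradient K.P p‖⁻¹) K.surface :=
  ((K.continuousOn_gradient.mono K.S_subset_interior).inv₀ fun p hp =>
    norm_ne_zero_iff.2 (K.gradient_ne_zero p (K.S_subset_interior hp))).aestronglyMeasurable K.measurableSet_S

theorem integrable_inv_gradient (K : KineticSymbol n) : Integrable (fun p => ‖gradient K.P p‖⁻¹) K.surface := by
  obtain ⟨C, hC⟩ := K.isCompact_S.exists_bound_of_continuousOn
    ((K.continuousOn_gradient.mono K.S_subset_interior).inv₀ fun p hp =>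
      norm_ne_zero_iff.2 (K.gradient_ne_zero p (K.S_subset_interior hp)))
  exact Integrable.of_bound K.aestronglyMeasurable_inv_gradient C (K.ae_surface_mem.mono hC)

/-- The part of the resolvent symbol near the minimum set. -/
noncomputable def mainSymbol (K : KineticSymbol n) (χ : Rn n → ℝ) (e : ℝ) (ξ : Rn n) : ℝ :=
  χ ((2 * Real.pi) • ξ) / (K.T ((2 * Real.pi) • ξ) + e)

theorem IsCutoff.integrable_mainSymbol (hχ : K.IsCutoff χ) {e : ℝ} (he : 0 < e) :
    Integrable (K.mainSymbol χ e) :=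
  (hχ.integrable_div he).comp_smul Real.two_pi_pos.ne'

theorem IsCutoff.isMultiplier_mainSymbol (hχ : K.IsCutoff χ) {e : ℝ} (he : 0 < e) :
    IsMultiplier (K.mainSymbol χ e) := by
  refine ⟨?_, e⁻¹, fun ξ => ?_⟩
  · exact (hχ.contDiff.continuous.measurable.div (K.measurable_T.add_const e)).comp (measurable_const_smul (2 * Real.pi))
  · have hm := hχ.mem_Icc ((2 * Real.pi) • ξ)
    have := K.T_nonneg ((2 * Real.pi) • ξ)
    rw [mainSymbol, abs_of_nonneg (div_nonneg hm.1 (by linarith)), ← one_div]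
    gcongr
    · exact hm.2
    · linarith

/-- The remainder enters as the square of its root, so that each of the two factors of V can be
paired with one root. -/
theorem IsCutoff.resolvent_eq (hχ : K.IsCutoff χ) {e : ℝ} (he : 0 < e) (φ : L2 n) :
    K.resolvent he φ = (hχ.isMultiplier_mainSymbol he).op (𝓕 φ) +
      (hχ.isMultiplier_remainder he).op (((hχ.isMultiplier_remainder he).memLp (𝓕 φ)).toLp _) := by
  rw [resolvent, IsMultiplier.op, IsMultiplier.op, ← FourierTransform.fourierInv_add, ← MemLp.toLp_add]
  congr 1
  refine (MemLp.toLp_eq_toLp_iff _ _).2 ?_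
  filter_upwards [((hχ.isMultiplier_remainder he).memLp (𝓕 φ)).coeFn_toLp] with ξ hξ
  rw [Pi.add_apply, hξ, ← mul_assoc, ← add_mul, ← Complex.ofReal_mul, ← pow_two, hχ.sq_remainder he,
    ← Complex.ofReal_add, mainSymbol, ← add_div, add_sub_cancel, one_div]

theorem integral_mainSymbol (K : KineticSymbol n) (χ : Rn n → ℝ) (e : ℝ) (z : Rn n) :
    ∫ ξ, (K.mainSymbol χ e ξ : ℂ) * Complex.exp (Complex.I * (⟪z, (2 * Real.pi) • ξ⟫ : ℝ)) =
      (((2 * Real.pi) ^ n : ℝ) : ℂ)⁻¹ * ∫ p, (χ p / (K.T p + e)) • Complex.exp (Complex.I * (⟪z, p⟫ : ℝ)) := by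
  have h := Measure.integral_comp_smul (volume : Measure (Rn n))
    (fun p => (χ p / (K.T p + e)) • Complex.exp (Complex.I * (⟪z, p⟫ : ℝ))) (2 * Real.pi)
  rw [finrank_euclideanSpace_fin, abs_of_pos (by positivity)] at h
  rw [← Complex.ofReal_inv, ← Complex.real_smul, ← h]
  rfl

/-- For integrable h the transform is bounded and the main symbol integrable, so the inverse
transform is an absolutely convergent double integral and Fubini makes it a convolution. -/
theorem IsCutoff.op_fourier_ae_eq (hχ : K.IsCutoff χ) {e : ℝ} (he : 0 < e) {h : Rn n → ℂ} (h1 : Integrable h)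
    (h2 : MemLp h 2) :
    (hχ.isMultiplier_mainSymbol he).op (𝓕 (h2.toLp h : L2 n)) =ᵐ[volume] fun x =>
      ∫ y, ((((2 * Real.pi) ^ n : ℝ) : ℂ)⁻¹ *
        ∫ p, (χ p / (K.T p + e)) • Complex.exp (Complex.I * (⟪x - y, p⟫ : ℝ))) * h y := by
  have hint := hχ.integrable_mainSymbol he
  have hcont : Continuous (𝓕 h) := VectorFourier.fourierIntegral_continuous Real.continuous_fourierChar
    (L := innerₗ (Rn n)) continuous_inner h1
  have hbd : ∀ ξ, ‖𝓕 h ξ‖ ≤ ∫ x, ‖h x‖ := fun ξ =>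
    VectorFourier.norm_fourierIntegral_le_integral_norm _ _ _ _ _
  have hI : Integrable fun ξ => (K.mainSymbol χ e ξ : ℂ) * 𝓕 h ξ :=
    hint.ofReal.mul_bdd hcont.aestronglyMeasurable (Eventually.of_forall hbd)
  have hM : MemLp (fun ξ => (K.mainSymbol χ e ξ : ℂ) * 𝓕 h ξ) 2 volume := by
    refine MemLp.ae_eq ?_ ((hχ.isMultiplier_mainSymbol he).memLp (𝓕 (h2.toLp h : L2 n)))
    filter_upwards [fourier_toLp_ae_eq h1 h2] with ξ hξ
    rw [hξ]
  have hop : (hχ.isMultiplier_mainSymbol he).op (𝓕 (h2.toLp h : L2 n)) = 𝓕⁻ (hM.toLp _ : L2 n) := by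
    rw [IsMultiplier.op]
    congr 1
    refine (MemLp.toLp_eq_toLp_iff _ _).2 ?_
    filter_upwards [fourier_toLp_ae_eq h1 h2] with ξ hξ
    rw [hξ]
  rw [hop]
  filter_upwards [fourierInv_toLp_ae_eq hI hM] with x hx
  rw [hx, Real.fourierInv_eq']
  have e1 : ∀ ξ, Complex.exp ((2 * Real.pi * ⟪ξ, x⟫ : ℝ) * Complex.I) • ((K.mainSymbol χ e ξ : ℂ) * 𝓕 h ξ) =
      ∫ y, ((K.mainSymbol χ e ξ : ℂ) * Complex.exp (Complex.I * (⟪x - y, (2 * Real.pi) • ξ⟫ : ℝ))) * h y := by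
    intro ξ
    rw [Real.fourier_eq', smul_eq_mul, ← mul_assoc, ← integral_const_mul]
    congr 1
    ext y
    have e2 : Complex.exp (Complex.I * (⟪x - y, (2 * Real.pi) • ξ⟫ : ℝ)) =
        Complex.exp ((2 * Real.pi * ⟪ξ, x⟫ : ℝ) * Complex.I) *
          Complex.exp ((-2 * Real.pi * ⟪y, ξ⟫ : ℝ) * Complex.I) := by
      rw [← Complex.exp_add, inner_smul_right, inner_sub_left, real_inner_comm ξ x]
      congr 1
      push_cast
      ring
    rw [e2, smul_eq_mul]
    ring
  simp_rw [e1]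
  rw [integral_integral_swap]
  · congr 1
    ext y
    rw [integral_mul_const, integral_mainSymbol]
  · have h4 : Integrable (fun z : Rn n × Rn n => (K.mainSymbol χ e z.1 : ℂ) * h z.2)
        (volume.prod volume) := hint.ofReal.mul_prod h1
    have h5 := h4.bdd_mul (c := 1)
      (f := fun z : Rn n × Rn n => Complex.exp (Complex.I * (⟪x - z.2, (2 * Real.pi) • z.1⟫ : ℝ)))
      (Continuous.aestronglyMeasurable (by fun_prop)) (Eventually.of_forall fun z => by
        rw [mul_comm, Complex.norm_exp_ofReal_mul_I])
    refine h5.congr (Eventually.of_forall fun z => ?_)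
    simp only [Function.uncurry]
    ring

/-- Fubini over the finite measure on S; the two factors |∇P|^(-1/2), one from each operator,
combine into |∇P|⁻¹, and likewise the powers of 2π. -/
theorem FSadj_FS_eq (K : KineticSymbol n) {h : Rn n → ℂ} (h1 : Integrable h) (x : Rn n) :
    K.FSadj (K.FS h) x = ∫ y, ((((2 * Real.pi) ^ n : ℝ) : ℂ)⁻¹ *
      ∫ p, (‖gradient K.P p‖⁻¹ : ℝ) • Complex.exp (Complex.I * (⟪x - y, p⟫ : ℝ)) ∂K.surface) * h y := by
  have e1 : ∀ p ∈ K.S, (Complex.exp (Complex.I * (⟪x, p⟫ : ℝ)) / (Real.sqrt ‖gradient K.P p‖ : ℝ)) * K.FS h p =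
      ((√((2 * Real.pi) ^ n) : ℝ) : ℂ)⁻¹ *
        ∫ y, ((‖gradient K.P p‖⁻¹ : ℝ) • Complex.exp (Complex.I * (⟪x - y, p⟫ : ℝ))) * h y := by
    intro p hp
    have hg : 0 < ‖gradient K.P p‖ := norm_pos_iff.2 (K.gradient_ne_zero p (K.S_subset_interior hp))
    have hs : ((√‖gradient K.P p‖ : ℝ) : ℂ) ^ 2 = (‖gradient K.P p‖ : ℂ) := by
      rw [← Complex.ofReal_pow, Real.sq_sqrt hg.le]
    have e2 : ∀ y, ((‖gradient K.P p‖⁻¹ : ℝ) • Complex.exp (Complex.I * (⟪x - y, p⟫ : ℝ))) * h y =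
        ((‖gradient K.P p‖ : ℂ)⁻¹ * Complex.exp (Complex.I * (⟪x, p⟫ : ℝ))) *
          (Complex.exp (-Complex.I * (⟪y, p⟫ : ℝ)) * h y) := by
      intro y
      rw [Complex.real_smul, inner_sub_left, Complex.ofReal_sub, mul_sub, sub_eq_add_neg, Complex.exp_add, neg_mul]
      push_cast
      ring
    simp_rw [e2]
    rw [integral_const_mul, FS, ← hs]
    push_cast
    have h3 : ((√‖gradient K.P p‖ : ℝ) : ℂ) ≠ 0 := by
      exact_mod_cast (Real.sqrt_pos.2 hg).ne'
    field_simp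
  have e3 : ∫ p, (Complex.exp (Complex.I * (⟪x, p⟫ : ℝ)) / (Real.sqrt ‖gradient K.P p‖ : ℝ)) * K.FS h p ∂K.surface =
      ∫ p, ((√((2 * Real.pi) ^ n) : ℝ) : ℂ)⁻¹ *
        (∫ y, ((‖gradient K.P p‖⁻¹ : ℝ) • Complex.exp (Complex.I * (⟪x - y, p⟫ : ℝ))) * h y) ∂K.surface :=
    integral_congr_ae (K.ae_surface_mem.mono e1)
  rw [FSadj, e3, integral_const_mul, ← mul_assoc, ← mul_inv, ← Complex.ofReal_mul, Real.mul_self_sqrt (by positivity),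
    integral_integral_swap]
  · rw [← integral_const_mul]
    congr 1
    ext y
    rw [integral_mul_const, mul_assoc]
  · have h4 : Integrable (fun z : Rn n × Rn n => ((‖gradient K.P z.1‖⁻¹ : ℝ) : ℂ) * h z.2)
        (K.surface.prod volume) := K.integrable_inv_gradient.ofReal.mul_prod h1
    have h5 := h4.bdd_mul (c := 1) (f := fun z : Rn n × Rn n => Complex.exp (Complex.I * (⟪x - z.2, z.1⟫ : ℝ)))
      (Continuous.aestronglyMeasurable (by fun_prop)) (Eventually.of_forall fun z => by
        rw [mul_comm, Complex.norm_exp_ofReal_mul_I])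
    refine h5.congr (Eventually.of_forall fun z => ?_)
    simp only [Function.uncurry, Complex.real_smul]
    ring

theorem continuous_integral_smul_cexp {μ : Measure (Rn n)} {G : Rn n → ℝ} (hG : Integrable G μ) :
    Continuous fun z : Rn n => ∫ p, G p • Complex.exp (Complex.I * (⟪z, p⟫ : ℝ)) ∂μ := by
  refine continuous_of_dominated (bound := fun p => ‖G p‖) (fun z => ?_) (fun z => ?_) hG.norm ?_
  · exact hG.1.smul (Continuous.aestronglyMeasurable (by fun_prop))
  · refine Eventually.of_forall fun p => ?_
    rw [norm_smul, mul_comm Complex.I, Complex.norm_exp_ofReal_mul_I, mul_one]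
  · exact Eventually.of_forall fun p => by fun_prop

theorem norm_integral_smul_cexp_le {μ : Measure (Rn n)} (G : Rn n → ℝ) (z : Rn n) :
    ‖∫ p, G p • Complex.exp (Complex.I * (⟪z, p⟫ : ℝ)) ∂μ‖ ≤ ∫ p, ‖G p‖ ∂μ := by
  refine (norm_integral_le_integral_norm _).trans_eq ?_
  congr 1
  ext p
  rw [norm_smul, mul_comm Complex.I, Complex.norm_exp_ofReal_mul_I, mul_one]

theorem IsCutoff.continuous_kernel (hχ : K.IsCutoff χ) {e : ℝ} (he : 0 < e) : Continuous (K.kernel χ e) :=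
  (continuous_integral_smul_cexp (hχ.integrable_div he)).sub
    (continuous_const.mul (continuous_integral_smul_cexp K.integrable_inv_gradient))

theorem exists_norm_kernel_le_const (K : KineticSymbol n) (χ : Rn n → ℝ) (e : ℝ) :
    ∃ D, ∀ z, ‖K.kernel χ e z‖ ≤ D := by
  refine ⟨(∫ p, ‖χ p / (K.T p + e)‖) + ‖(K.f e : ℂ)‖ * ∫ p, ‖‖gradient K.P p‖⁻¹‖ ∂K.surface, fun z => ?_⟩
  refine (norm_sub_le _ _).trans (add_le_add (norm_integral_smul_cexp_le _ _) ?_)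
  rw [norm_mul]
  gcongr
  exact norm_integral_smul_cexp_le _ _

theorem IsCutoff.op_sub_FSadj_ae_eq (hχ : K.IsCutoff χ) {e : ℝ} (he : 0 < e) {h : Rn n → ℂ} (h1 : Integrable h)
    (h2 : MemLp h 2) :
    (fun x => (hχ.isMultiplier_mainSymbol he).op (𝓕 (h2.toLp h : L2 n)) x - K.f e * K.FSadj (K.FS h) x)
      =ᵐ[volume] fun x => ∫ y, (((2 * Real.pi) ^ n : ℝ) : ℂ)⁻¹ * K.kernel χ e (x - y) * h y := by
  filter_upwards [hχ.op_fourier_ae_eq he h1 h2] with x hx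
  rw [hx, K.FSadj_FS_eq h1, ← integral_const_mul, ← integral_sub]
  · congr 1
    ext y
    rw [kernel]
    ring
  · refine h1.bdd_mul (c := ‖(((2 * Real.pi) ^ n : ℝ) : ℂ)⁻¹‖ * ∫ p, ‖χ p / (K.T p + e)‖) ?_
      (Eventually.of_forall fun y => ?_)
    · exact Continuous.aestronglyMeasurable (continuous_const.mul
        ((continuous_integral_smul_cexp (hχ.integrable_div he)).comp (continuous_const.sub continuous_id)))
    · rw [norm_mul]
      gcongr
      exact norm_integral_smul_cexp_le _ _
  · refine Integrable.const_mul ?_ _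
    refine h1.bdd_mul (c := ‖(((2 * Real.pi) ^ n : ℝ) : ℂ)⁻¹‖ * ∫ p, ‖‖gradient K.P p‖⁻¹‖ ∂K.surface) ?_
      (Eventually.of_forall fun y => ?_)
    · exact Continuous.aestronglyMeasurable (continuous_const.mul
        ((continuous_integral_smul_cexp K.integrable_inv_gradient).comp (continuous_const.sub continuous_id)))
    · rw [norm_mul]
      gcongr
      exact norm_integral_smul_cexp_le _ _

end KineticSymbol

/-! ### Assembly of the operator -/

namespace KineticSymbol

variable {n : ℕ} {K : KineticSymbol n} {χ : Rn n → ℝ}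

theorem IsM.eq {V : Rn n → ℝ} (hV : AEStronglyMeasurable V volume) {e : ℝ} {he : 0 < e} {M M' : L2 n →L[ℂ] L2 n}
    (hM : K.IsM V he M) (hM' : K.IsM V he M') : M = M' :=
  clm_eq_of_eq_on_domain (aestronglyMeasurable_sqrt_abs hV) (fun _ => Real.sqrt_nonneg _) fun ψ hψ =>
    Lp.ext ((hM ψ hψ).trans (hM' ψ hψ).symm)

/-- This is the squared Hilbert–Schmidt norm of the sandwiched kernel: the summand 1 of the bound
yields the square of the L¹ norm, the summand |z|^κ the weighted double integral. -/
theorem lintegral_weightedPair_le {V : Rn n → ℝ} (hV : MemLp V 1 volume) {κ : ℝ}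
    (hκ : Integrable (weightedPair κ V) (volume.prod volume)) {Q : ℝ} (hQ : 0 ≤ Q) {k : Rn n → ℂ}
    (hk : ∀ z, ‖k z‖ ^ 2 ≤ Q * (1 + ‖z‖ ^ κ)) :
    ∫⁻ z : Rn n × Rn n, ‖V z.1‖ₑ * ‖k (z.1 - z.2)‖ₑ ^ 2 * ‖V z.2‖ₑ ∂(volume.prod volume) ≤
      ENNReal.ofReal (Q * (lpNorm V 1 volume ^ 2 + ∫ z, weightedPair κ V z ∂(volume.prod volume))) := by
  have hV1 : Integrable V := memLp_one_iff_integrable.1 hV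
  have h1 : Integrable (fun z : Rn n × Rn n => ‖V z.1‖ * ‖V z.2‖) (volume.prod volume) := hV1.norm.mul_prod hV1.norm
  have h2 : ∫ z : Rn n × Rn n, ‖V z.1‖ * ‖V z.2‖ ∂(volume.prod volume) = lpNorm V 1 volume ^ 2 := by
    rw [integral_prod_mul (fun x => ‖V x‖) fun x => ‖V x‖, lpNorm_one_eq_integral_norm hV.1, pow_two]
  have h3 : Integrable (fun z : Rn n × Rn n => Q * (‖V z.1‖ * ‖V z.2‖ + weightedPair κ V z)) (volume.prod volume) :=
    (h1.add hκ).const_mul Q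
  rw [← h2, ← integral_add h1 hκ, ← integral_const_mul, ofReal_integral_eq_lintegral_ofReal h3
    (Eventually.of_forall fun z => ?_)]
  · refine lintegral_mono fun z => ?_
    rw [← ofReal_norm, ← ofReal_norm, ← ofReal_norm, ← ENNReal.ofReal_pow (norm_nonneg _),
      ← ENNReal.ofReal_mul (norm_nonneg _), ← ENNReal.ofReal_mul (by positivity)]
    refine ENNReal.ofReal_le_ofReal ?_
    calc ‖V z.1‖ * ‖k (z.1 - z.2)‖ ^ 2 * ‖V z.2‖
        ≤ ‖V z.1‖ * (Q * (1 + ‖z.1 - z.2‖ ^ κ)) * ‖V z.2‖ := by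
          gcongr; exact hk _
      _ = Q * (‖V z.1‖ * ‖V z.2‖ + weightedPair κ V z) := by
          rw [weightedPair, Real.norm_eq_abs, Real.norm_eq_abs]; ring
  · exact mul_nonneg hQ (add_nonneg (by positivity)
      (mul_nonneg (mul_nonneg (abs_nonneg _) (by positivity)) (abs_nonneg _)))

theorem IsCutoff.exists_clm_kernel (hχ : K.IsCutoff χ) {V : Rn n → ℝ} (hV : MemLp V 1 volume) {κ : ℝ}
    (hκ : Integrable (weightedPair κ V) (volume.prod volume)) {e : ℝ} (he : 0 < e) {Q : ℝ} (hQ : 0 ≤ Q)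
    (hk : ∀ z, ‖K.kernel χ e z‖ ^ 2 ≤ Q * (1 + ‖z‖ ^ κ)) :
    ∃ A : L2 n →L[ℂ] L2 n,
      ‖A‖ ≤ √(Q * (lpNorm V 1 volume ^ 2 + ∫ z, weightedPair κ V z ∂(volume.prod volume))) ∧
      ∀ ψ, A ψ =ᵐ[volume] fun x => ((Real.sign (V x) * √|V x| : ℝ) : ℂ) *
        ∫ y, (((2 * Real.pi) ^ n : ℝ) : ℂ)⁻¹ * K.kernel χ e (x - y) * (((√|V y| : ℝ) : ℂ) * ψ y) := by
  set k : Rn n × Rn n → ℂ := fun z => ((Real.sign (V z.1) * √|V z.1| : ℝ) : ℂ) *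
    ((((2 * Real.pi) ^ n : ℝ) : ℂ)⁻¹ * K.kernel χ e (z.1 - z.2)) * ((√|V z.2| : ℝ) : ℂ) with hkdef
  have hkm : AEStronglyMeasurable k (volume.prod volume) := by
    refine AEStronglyMeasurable.mul (AEStronglyMeasurable.mul ?_ ?_) ?_
    · exact (Complex.continuous_ofReal.comp_aestronglyMeasurable (aestronglyMeasurable_sign_mul_sqrt hV.1)).comp_fst
    · exact (continuous_const.mul ((hχ.continuous_kernel he).comp (continuous_fst.sub continuous_snd))).aestronglyMeasurable
    · exact (Complex.continuous_ofReal.comp_aestronglyMeasurable (aestronglyMeasurable_sqrt_abs hV.1)).comp_snd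
  have hX : 0 ≤ ∫ z, weightedPair κ V z ∂(volume.prod volume) := integral_nonneg fun z =>
    mul_nonneg (mul_nonneg (abs_nonneg _) (by positivity)) (abs_nonneg _)
  -- The factor (2π)^(-n) is dropped, being at most 1.
  have hpi : ‖(((2 * Real.pi) ^ n : ℝ) : ℂ)⁻¹‖ₑ ≤ 1 := by
    rw [← ofReal_norm, norm_inv, Complex.norm_real, Real.norm_eq_abs, abs_of_pos (by positivity)]
    exact ENNReal.ofReal_le_one.2 (inv_le_one_of_one_le₀ (one_le_pow₀ (by linarith [Real.pi_gt_three])))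
  have hsq : ∫⁻ z, ‖k z‖ₑ ^ 2 ∂(volume.prod volume) ≤ ENNReal.ofReal
      (√(Q * (lpNorm V 1 volume ^ 2 + ∫ z, weightedPair κ V z ∂(volume.prod volume))) ^ 2) := by
    rw [Real.sq_sqrt (by positivity)]
    refine le_trans (lintegral_mono fun z => ?_) (lintegral_weightedPair_le hV hκ hQ hk)
    have hr : ∀ t : ℝ, ‖(t : ℂ)‖ₑ = ‖t‖ₑ := fun t => by rw [← ofReal_norm, Complex.norm_real, ofReal_norm]
    rw [hkdef, enorm_mul, enorm_mul, enorm_mul, mul_pow, mul_pow, mul_pow, hr (Real.sign _ * _), hr (√_),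
      enorm_sqrt_abs_sq]
    gcongr
    · exact enorm_sign_mul_sqrt_abs_sq_le _
    · exact mul_le_of_le_one_left' (pow_le_one' hpi 2)
  obtain ⟨A, hA, hA'⟩ := exists_clm_of_kernel hkm (Real.sqrt_nonneg _) hsq
  refine ⟨A, hA, fun ψ => (hA' ψ).trans (Eventually.of_forall fun x => ?_)⟩
  simp only [hkdef]
  rw [← integral_const_mul]
  congr 1
  ext y
  ring

/-- The operator is A + D B*, with A the Hilbert–Schmidt part and D, B the root of the remainder
multiplied by V^(1/2) and |V|^(1/2). Each of D and B has norm at most √(C𝒜(V)), so their product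
contributes C𝒜(V). The kernel bound is left as a hypothesis with free Q and κ, since existence and
the uniform estimate use different ones. -/
theorem exists_isM (K : KineticSymbol n) (hn : n ≠ 0) {ε : ℝ} (hε : 0 < ε) (hχ : K.IsCutoff χ) :
    ∃ C : ℝ, 0 ≤ C ∧ ∀ V : Rn n → ℝ, MemLp V 1 volume → MemLp V (K.exponent ε) volume → ∀ κ : ℝ,
      Integrable (weightedPair κ V) (volume.prod volume) → ∀ (e : ℝ) (he : 0 < e) (Q : ℝ), 0 ≤ Q →
        (∀ z, ‖K.kernel χ e z‖ ^ 2 ≤ Q * (1 + ‖z‖ ^ κ)) →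
          ∃ M : L2 n →L[ℂ] L2 n, K.IsM V he M ∧
            ‖M‖ ≤ √(Q * (lpNorm V 1 volume ^ 2 + ∫ z, weightedPair κ V z ∂(volume.prod volume))) +
              C * K.A ε V := by
  obtain ⟨C₁, hC₁, hrem⟩ := hχ.exists_sq_remainder_le
  obtain ⟨C, hC, hop⟩ := K.exists_lintegral_mul_op_le hn hε hC₁
  refine ⟨C, hC, fun V hV1 hVA κ hκ e he Q hQ hk => ?_⟩
  have ha := hχ.isMultiplier_remainder he
  have hA0 : 0 ≤ K.A ε V := lpNorm_nonneg
  have hbound : ∀ u : L2 n, ∫⁻ x, ‖V x‖ₑ * ‖ha.op u x‖ₑ ^ 2 ≤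
      ENNReal.ofReal (√(C * K.A ε V) ^ 2) * ENNReal.ofReal (‖u‖ ^ 2) := fun u => by
    rw [Real.sq_sqrt (by positivity)]
    exact hop _ ha (hrem e he) V hVA u
  obtain ⟨A, hA, hA'⟩ := hχ.exists_clm_kernel hV1 hκ he hQ hk
  obtain ⟨B, hB, hB'⟩ := exists_clm_mul_op ha (aestronglyMeasurable_sqrt_abs hV1.1)
    (fun x => (enorm_sqrt_abs_sq (V x)).le) (Real.sqrt_nonneg _) hbound
  obtain ⟨D, hD, hD'⟩ := exists_clm_mul_op ha (aestronglyMeasurable_sign_mul_sqrt hV1.1)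
    (fun x => enorm_sign_mul_sqrt_abs_sq_le (V x)) (Real.sqrt_nonneg _) hbound
  refine ⟨A + D.comp (ContinuousLinearMap.adjoint B), fun ψ hψ => ?_, ?_⟩
  -- As V is integrable, its root is in L², so |V|^(1/2)ψ is integrable as well as square
  -- integrable; the convolution formula requires both.
  · have hw2 : MemLp (fun x => ((√|V x| : ℝ) : ℂ)) 2 volume := by
      refine (memLp_two_iff_lintegral
        (Complex.continuous_ofReal.comp_aestronglyMeasurable (aestronglyMeasurable_sqrt_abs hV1.1))).2 ?_
      have : ∀ x, ‖((√|V x| : ℝ) : ℂ)‖ₑ ^ 2 = ‖V x‖ₑ := fun x => by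
        rw [← ofReal_norm, Complex.norm_real, ofReal_norm, enorm_sqrt_abs_sq]
      simp_rw [this]
      exact (memLp_one_iff_integrable.1 hV1).2
    have hint : Integrable fun x => ((√|V x| : ℝ) : ℂ) * ψ x := hw2.integrable_mul (Lp.memLp ψ)
    have hadj := adjoint_mul_op_apply ha hB' ψ hψ
    have hres := hχ.resolvent_eq he (hψ.toLp _)
    filter_upwards [Lp.coeFn_add (A ψ) (D (ContinuousLinearMap.adjoint B ψ)), hA' ψ,
      hD' (ContinuousLinearMap.adjoint B ψ),
      Lp.coeFn_add ((hχ.isMultiplier_mainSymbol he).op (𝓕 (hψ.toLp _ : L2 n)))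
        (ha.op ((ha.memLp (𝓕 (hψ.toLp _ : L2 n))).toLp _)), hχ.op_sub_FSadj_ae_eq he hint hψ] with x h1 h2 h3 h4 h5
    rw [add_apply, ContinuousLinearMap.comp_apply, h1, Pi.add_apply, h2, h3, hres, h4, Pi.add_apply, ← h5, hadj]
    ring
  · refine (norm_add_le _ _).trans (add_le_add hA ?_)
    refine (ContinuousLinearMap.opNorm_comp_le _ _).trans ?_
    rw [LinearIsometryEquiv.norm_map]
    calc ‖D‖ * ‖B‖ ≤ √(C * K.A ε V) * √(C * K.A ε V) := by gcongr
      _ = _ := Real.mul_self_sqrt (by positivity)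

end KineticSymbol

/-! ### The theorem -/

theorem lemma3p2 {n : ℕ} (hn : 2 ≤ n) (K : KineticSymbol n) (ε : ℝ) (hε : 0 < ε) :
    -- `M_e` is a well-defined bounded operator
    (∀ V : Rn n → ℝ, MemLp V 1 volume → MemLp V (K.exponent ε) volume →
      ∀ (e : ℝ) (he : 0 < e), ∃! M : L2 n →L[ℂ] L2 n, K.IsM V he M) ∧
    ∀ κ : ℝ, K.AdmissibleWeight κ →
      -- the bound, with a constant independent of `V` and `e`
      (∃ C : ℝ, ∀ V : Rn n → ℝ, MemLp V 1 volume → MemLp V (K.exponent ε) volume →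
        Integrable (weightedPair κ V) (volume.prod volume) →
        ∀ (e : ℝ) (he : 0 < e) (M : L2 n →L[ℂ] L2 n), K.IsM V he M →
          ‖M‖ ≤ C * (K.g e * (lpNorm V 1 volume +
            Real.sqrt (∫ z, weightedPair κ V z ∂(volume.prod volume))) + K.A ε V)) ∧
      -- uniform boundedness of `M_e` for `r < 2`
      (K.r < 2 → ∀ V : Rn n → ℝ, MemLp V 1 volume → MemLp V (K.exponent ε) volume →
        Integrable (weightedPair κ V) (volume.prod volume) →
        ∃ B : ℝ, ∀ (e : ℝ) (he : 0 < e) (M : L2 n →L[ℂ] L2 n), K.IsM V he M → ‖M‖ ≤ B) := by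
  have hn0 : n ≠ 0 := by omega
  refine ⟨fun V hV1 hVA e he => ?_, fun κ hκ => ?_⟩
  · obtain ⟨χ, hχ⟩ := K.exists_isCutoff
    obtain ⟨D, hD⟩ := K.exists_norm_kernel_le_const χ e
    obtain ⟨C, hC, h⟩ := K.exists_isM hn0 hε hχ
    have hV := memLp_one_iff_integrable.1 hV1
    -- Existence at a fixed e needs no weighted integrability: the kernel is bounded by a constant
    -- depending on e, so the weight κ = 0 suffices, and it is integrable because V is.
    have hw : Integrable (weightedPair 0 V) (volume.prod volume) := by
      refine (hV.norm.mul_prod hV.norm).congr (Eventually.of_forall fun z => ?_)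
      simp [weightedPair]
    obtain ⟨M, hM, -⟩ := h V hV1 hVA 0 hw e he (D ^ 2) (by positivity) fun z => by
      have h1 := pow_le_pow_left₀ (norm_nonneg _) (hD z) 2
      rw [Real.rpow_zero]
      nlinarith [sq_nonneg D]
    exact ⟨M, hM, fun M' hM' => KineticSymbol.IsM.eq hV1.1 hM' hM⟩
  have hmain : ∃ C : ℝ, ∀ V : Rn n → ℝ, MemLp V 1 volume → MemLp V (K.exponent ε) volume →
      Integrable (weightedPair κ V) (volume.prod volume) →
      ∀ (e : ℝ) (he : 0 < e) (M : L2 n →L[ℂ] L2 n), K.IsM V he M →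
        ‖M‖ ≤ C * (K.g e * (lpNorm V 1 volume +
          Real.sqrt (∫ z, weightedPair κ V z ∂(volume.prod volume))) + K.A ε V) := by
    obtain ⟨χ, hχ, C₁, hC₁⟩ := K.exists_norm_kernel_le hn hκ
    obtain ⟨C₂, hC₂, h⟩ := K.exists_isM hn0 hε hχ
    refine ⟨max √|C₁| C₂, fun V hV1 hVA hw e he M hM => ?_⟩
    have hg : 0 < K.g e := zero_lt_one.trans_le (K.one_le_g he)
    -- The bound is proved for the operator constructed above, which by uniqueness is the given one.
    obtain ⟨M', hM', hle⟩ := h V hV1 hVA κ hw e he (|C₁| * K.g e ^ 2) (by positivity) fun z => by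
      refine (hC₁ e he z).trans ?_
      gcongr
      exact le_abs_self _
    rw [KineticSymbol.IsM.eq hV1.1 hM hM']
    refine hle.trans ?_
    set X := ∫ z, weightedPair κ V z ∂(volume.prod volume) with hX
    have hX0 : 0 ≤ X := integral_nonneg fun z =>
      mul_nonneg (mul_nonneg (abs_nonneg _) (by positivity)) (abs_nonneg _)
    have hL0 : 0 ≤ lpNorm V 1 volume := lpNorm_nonneg
    have hA0 : 0 ≤ K.A ε V := lpNorm_nonneg
    have h2 : √(|C₁| * K.g e ^ 2 * (lpNorm V 1 volume ^ 2 + X)) ≤ √|C₁| * (K.g e * (lpNorm V 1 volume + √X)) := by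
      rw [Real.sqrt_mul (by positivity), Real.sqrt_mul (abs_nonneg _), Real.sqrt_sq hg.le, mul_assoc]
      gcongr
      refine Real.sqrt_le_iff.2 ⟨by positivity, ?_⟩
      nlinarith [Real.sq_sqrt hX0, Real.sqrt_nonneg X]
    rw [mul_add (max _ _)]
    refine add_le_add (h2.trans ?_) ?_
    · gcongr
      exact le_max_left _ _
    · gcongr
      exact le_max_right _ _
  refine ⟨hmain, fun hr V hV1 hVA hw => ?_⟩
  obtain ⟨C, hC⟩ := hmain
  refine ⟨C * (1 * (lpNorm V 1 volume +
    Real.sqrt (∫ z, weightedPair κ V z ∂(volume.prod volume))) + K.A ε V), fun e he M hM => ?_⟩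
  have := hC V hV1 hVA hw e he M hM
  rwa [show K.g e = 1 by simp [KineticSymbol.g, hr]] at this
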